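/- **Setting.** Let $\Gamma$ be a finite connected graph of rank $n$ all of whose vertices have valence $>2$, and let $\Sigma_\Gamma$ be the set of $\ell:E(\Gamma)\to[0,1]$ with $\sum_e\ell(e)=1$ whose zero set $\{e:\ell(e)=0\}$ is a forest. A tangent vector at $\ell$ is a function $\tau:E(\Gamma)\to\mathbb R$ with $\sum_e\tau(e)=0$; it is integrable if $\tau(e)<0$ implies $\ell(e)>0$. A loop is a nontrivial immersed closed edge path $\alpha$ (up to cyclic rotation), and $\ell(\alpha),\tau(\alpha)$ are the sums of the weights of the edges it crosses, with multiplicity. Put $$\|(\ell,\tau)\|^L=\sup_{\alpha}\frac{\tau(\alpha)}{\ell(\alpha)},$$ the supremum being over all loops $\alpha$ in $\Gamma$. Let $\Gamma_i\to\Gamma$, $i=1,\dots,2^n-1$, be the nontrivial double covers of $\Gamma$, with the pulled back weights $\ell_i,\tau_i$. For $0\ne a\in H_1(\Gamma_i;\mathbb Z/2)$ let $\ell_i(a)$ be the length of a shortest loop of $\Gamma_i$ in the class $a$. With $K=(2^n-1)(2^{2n-1}-1)$ define $$\Psi(\ell)=-\frac1{K+1}\sum_{\Gamma_i}\ \sum_{0\ne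 a\in H_1(\Gamma_i;\mathbb Z/2)}\log\ell_i(a),$$ $$\|(\ell,\tau)\|^N=\|(\ell,\tau)\|^L-\frac1{K+1}\sum_{\Gamma_i}\ \sum_{0\ne a\in H_1(\Gamma_i;\mathbb Z/2)}\frac{\min\tau_i(\alpha)}{\ell_i(a)},$$ where the minimum is over the loops $\alpha$ in $\Gamma_i$ of class $a$ that realize $\ell_i(a)$. Let $\|(\ell,\tau)\|^{N,\max}$ be defined in the same way with $\max$ in place of $\min$. Outer space $\mathcal X_n$ is the set of triples $(\Gamma,f,\ell)$, where $f$ is a marking of $\Gamma$ by the free group $F_n$ (a homotopy equivalence from the rose $R_n$, up to homotopy) and $\ell\in\Sigma_\Gamma$, modulo the equivalence relation generated by collapsing forests of length zero and by isometries compatible with the markings. For $x,y\in\mathcal X_n$ represented by $(\Gamma,f,\ell)$ and $(\Gamma',f',\ell')$, $d(x,y)$ is the minimum of $\log\sigma(\phi)$ over all maps $\phi:\Gamma\to\Gamma'$, linear on edges, with $\phi f\simeq f'$, where $\sigma(\phi)$ is the largest slope of $\phi$. For a piecewise linear path $\gamma:[0,1]\to\mathcal X_n$ (on each interval of some finite subdivision,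 $\gamma$ moves affinely in $\Sigma_\Gamma$ for a marked graph $(\Gamma,f)$) put $$len_L(\gamma)=\sup_{0=t_0<\dots<t_p=1}\ \sum_{i=1}^p d(\gamma(t_{i-1}),\gamma(t_i)),\qquad len_N(\gamma)=\int_0^1\|(\gamma(t),\dot\gamma(t))\|^N\,dt .$$ **Proposition.** 1. If $\ell\in\Sigma_\Gamma$ and $\tau$ is an integrable tangent vector at $\ell$, then the derivative from the right $d_\tau\Psi$ at $t=0$ of $t\mapsto\Psi(\ell+t\tau)$ exists, and $$\|(\ell,\tau)\|^N=\|(\ell,\tau)\|^L+d_\tau\Psi .$$ 2. $\Psi(\ell)$ depends only on the point of $\mathcal X_n$ represented by $(\Gamma,f,\ell)$, so that $\Psi:\mathcal X_n\to\mathbb R$ is well defined. If $\gamma$ is a piecewise linear path in $\mathcal X_n$ from $x$ to $y$, then $len_L(\gamma)$ is finite, the integral $len_N(\gamma)$ exists, and $$len_N(\gamma)=len_L(\gamma)+\Psi(y)-\Psi(x).$$ Moreover, $\int_0^1\|(\gamma(t),\dot\gamma(t))\|^{N,\max}\,dt$ exists and equals $len_N(\gamma)$. -/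

import Mathlib

/-!
Finite graphs, metrics on them, their double covers, Outer space, the Lipschitz metric and its
corrected Finsler norm.

Graphs are combinatorial: a type of vertices, a type of edges, and for each edge an (arbitrarily
chosen) initial and terminal vertex.  An edge crossed in a direction is a *dart* `(e, b)`, where
`b = true` means that `e` is crossed from `src e` to `tgt e`.  An edge path is a list of darts, so
it is also a word in the free group on the set of edges, and two edge paths with the same end
points are homotopic rel end points iff these words agree in the free group.
-/

open Set

namespace OuterSp

noncomputable section

/-- A graph (loops and multiple edges allowed), each edge with a chosen orientation. -/
structure Gr (V E : Type*) where
  src : E → V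
  tgt : E → V

namespace Gr

variable {V E : Type*} (G : Gr V E)

/-! ### Edge paths and loops -/

/-- Initial vertex of a dart. -/
def dsrc (d : E × Bool) : V := if d.2 then G.src d.1 else G.tgt d.1

/-- Terminal vertex of a dart. -/
def dtgt (d : E × Bool) : V := if d.2 then G.tgt d.1 else G.src d.1

/-- The list `w` of darts is an edge path from `u` to `v`. -/
def IsPath : V → V → List (E × Bool) → Prop
  | u, v, [] => u = v
  | u, v, d :: w => G.dsrc d = u ∧ IsPath (G.dtgt d) v w

/-- A (nontrivial, immersed) loop: a nonempty cyclic word of darts, each of which starts where the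
preceding one ends and is not the reverse of the preceding one. -/
def IsLoop (α : Cycle (E × Bool)) : Prop :=
  α ≠ Cycle.nil ∧ α.Chain fun d d' => G.dtgt d = G.dsrc d' ∧ d' ≠ (d.1, !d.2)

/-- The total weight `τ(α)` of the edges that `α` crosses, with multiplicity. -/
def weight (τ : E → ℝ) (α : Cycle (E × Bool)) : ℝ :=
  (α.toMultiset.map fun d => τ d.1).sum

/-- A connected graph all of whose vertices have valence greater than `2`. -/
structure IsAdmissible : Prop where
  nonempty : Nonempty V
  connected : ∀ u v, ∃ w, G.IsPath u v w
  valence : ∀ v, 2 < Set.ncard {d : E × Bool | G.dsrc d = v}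

/-! ### Metrics, tangent vectors -/

/-- `ℓ` is a point of `Σ_Γ`: lengths in `[0,1]` of total sum `1`, and the edges of length zero
form a forest. -/
structure IsMetric [Fintype E] (ℓ : E → ℝ) : Prop where
  mem_Icc : ∀ e, ℓ e ∈ Icc (0 : ℝ) 1
  sum_eq : ∑ e, ℓ e = 1
  forest : ∀ α, G.IsLoop α → ∃ d ∈ α, ℓ d.1 ≠ 0

/-- `τ` is an integrable tangent vector at `ℓ`. -/
structure IsIntegrable [Fintype E] (ℓ τ : E → ℝ) : Prop where
  sum_eq : ∑ e, τ e = 0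
  pos_of_neg : ∀ e, τ e < 0 → 0 < ℓ e

/-- The norm `‖(ℓ, τ)‖^L`. -/
def normL (ℓ τ : E → ℝ) : ℝ :=
  sSup {r | ∃ α, G.IsLoop α ∧ r = weight τ α / weight ℓ α}

/-! ### Homology mod 2 and double covers -/

open Classical in
/-- The cellular boundary map mod 2; its kernel is `H₁(Γ; ℤ/2)`. -/
def boundary [Fintype E] (a : E → ZMod 2) (v : V) : ZMod 2 :=
  ∑ e, a e * ((if G.tgt e = v then 1 else 0) - (if G.src e = v then 1 else 0))

open Classical in
/-- The mod 2 cycle of a loop. -/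
def loopClass (α : Cycle (E × Bool)) (e : E) : ZMod 2 :=
  ((α.toMultiset.map Prod.fst).count e : ZMod 2)

/-- The length `ℓ(a)` of a shortest loop in the homology class `a`. -/
def classLength (ℓ : E → ℝ) (a : E → ZMod 2) : ℝ :=
  sInf {r | ∃ α, G.IsLoop α ∧ loopClass α = a ∧ r = weight ℓ α}

/-- The values `τ(α)` on the loops `α` that realize `ℓ(a)`. -/
def realizedValues (ℓ τ : E → ℝ) (a : E → ZMod 2) : Set ℝ :=
  {r | ∃ α, G.IsLoop α ∧ loopClass α = a ∧ weight ℓ α = G.classLength ℓ a ∧ r = weight τ α}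

/-- The cellular coboundary map mod 2. -/
def coboundary : (V → ZMod 2) →ₗ[ZMod 2] (E → ZMod 2) where
  toFun f e := f (G.tgt e) - f (G.src e)
  map_add' f g := by ext e; simp only [Pi.add_apply]; ring
  map_smul' r f := by ext e; simp only [Pi.smul_apply, smul_eq_mul, RingHom.id_apply]; ring

/-- `H¹(Γ; ℤ/2)`. -/
abbrev Coh : Type _ := (E → ZMod 2) ⧸ LinearMap.range G.coboundary

/-- The double cover given by a 1-cochain `c`: the edge `e` is lifted to an edge that changes
sheets iff `c e = 1`.  Every double cover arises in this way, two cochains give isomorphic covers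
iff they are cohomologous, and the cover is nontrivial (connected, if the graph is) iff the class
of `c` is not zero. -/
def cover (c : E → ZMod 2) : Gr (V × ZMod 2) (E × ZMod 2) where
  src e := (G.src e.1, e.2)
  tgt e := (G.tgt e.1, e.2 + c e.1)

/-- The double cover of the cohomology class `c`. -/
def coverOf (c : G.Coh) : Gr (V × ZMod 2) (E × ZMod 2) := G.cover (Quotient.out c)

/-- The pull back of an edge weight to a double cover. -/
def lift (ℓ : E → ℝ) (e : E × ZMod 2) : ℝ := ℓ e.1

open Classical in
/-- The sum of `F Γ' a` over the nontrivial double covers `Γ'` of the graph and the nonzero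
classes `a` in `H₁(Γ'; ℤ/2)`. -/
def coverSum [Fintype V] [Fintype E]
    (F : Gr (V × ZMod 2) (E × ZMod 2) → (E × ZMod 2 → ZMod 2) → ℝ) : ℝ :=
  ∑ c : G.Coh with c ≠ 0,
    ∑ a : E × ZMod 2 → ZMod 2 with ((G.coverOf c).boundary a = 0 ∧ a ≠ 0), F (G.coverOf c) a

/-- The number `K` of summands in `coverSum`, for a graph of rank `n`. -/
def numK (n : ℕ) : ℝ := (2 ^ n - 1) * (2 ^ (2 * n - 1) - 1)

/-- The corrected norm, where `pick` selects one of the values of `τ` on the loops realizing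
`ℓ(a)`. -/
def normWith (pick : Set ℝ → ℝ) (n : ℕ) [Fintype V] [Fintype E] (ℓ τ : E → ℝ) : ℝ :=
  G.normL ℓ τ + 1 / (numK n + 1) *
    (- G.coverSum fun G' a =>
      pick (G'.realizedValues (lift ℓ) (lift τ) a) / G'.classLength (lift ℓ) a)

/-- The norm `‖(ℓ, τ)‖^N`: in the correction term, `τ` is evaluated on a loop realizing `ℓ(a)` on
which it is minimal. -/
def normN (n : ℕ) [Fintype V] [Fintype E] (ℓ τ : E → ℝ) : ℝ := G.normWith sInf n ℓ τ

/-- The variant of `normN` in which `τ` is evaluated on a loop realizing `ℓ(a)` on which it is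
maximal.  The two differ only where several loops realizing `ℓ(a)` have different `τ`-weights. -/
def normNMax (n : ℕ) [Fintype V] [Fintype E] (ℓ τ : E → ℝ) : ℝ := G.normWith sSup n ℓ τ

/-- The potential `Ψ` on `Σ_Γ`. -/
def psi (n : ℕ) [Fintype V] [Fintype E] (ℓ : E → ℝ) : ℝ :=
  - (1 / (numK n + 1)) * G.coverSum fun G' a => Real.log (G'.classLength (lift ℓ) a)

/-! ### The fundamental group -/

variable {G}

theorem IsPath.append {u v x : V} {w w' : List (E × Bool)} (h : G.IsPath u v w)
    (h' : G.IsPath v x w') : G.IsPath u x (w ++ w') := by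
  induction w generalizing u with
  | nil =>
    have huv : u = v := h
    subst huv
    exact h'
  | cons d w ih => exact ⟨h.1, ih h.2⟩

theorem IsPath.invRev {u v : V} {w : List (E × Bool)} (h : G.IsPath u v w) :
    G.IsPath v u (FreeGroup.invRev w) := by
  induction w generalizing u with
  | nil => exact Eq.symm h
  | cons d w ih =>
    have h2 := ih h.2
    have hs : G.IsPath (G.dtgt d) u [(d.1, !d.2)] := by
      refine ⟨?_, ?_⟩
      · cases hd : d.2 <;> simp [dsrc, dtgt, hd]
      · rw [← h.1]
        cases hd : d.2 <;> simp [IsPath, dsrc, dtgt, hd]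
    have h3 := h2.append hs
    simpa [FreeGroup.invRev] using h3

variable (G)

/-- The fundamental group based at `v`: the homotopy classes of closed edge paths at `v`. -/
def pi1 (v : V) : Subgroup (FreeGroup E) where
  carrier := {g | ∃ w, G.IsPath v v w ∧ g = FreeGroup.mk w}
  mul_mem' := by
    rintro _ _ ⟨w, hw, rfl⟩ ⟨w', hw', rfl⟩
    exact ⟨w ++ w', hw.append hw', by simp⟩
  one_mem' := ⟨[], rfl, rfl⟩
  inv_mem' := by
    rintro _ ⟨w, hw, rfl⟩
    exact ⟨_, hw.invRev, FreeGroup.inv_mk⟩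

end Gr

/-! ### Outer space -/

/-- A marked graph of rank `n`.  A homotopy equivalence from the rose to a graph is given, up to
homotopy, by an isomorphism from the free group onto the fundamental group of the graph. -/
structure MarkedGraph (n : ℕ) where
  V : Type
  E : Type
  fintypeV : Fintype V
  fintypeE : Fintype E
  G : Gr V E
  admissible : G.IsAdmissible
  base : V
  mark : FreeGroup (Fin n) ≃* G.pi1 base

attribute [instance] MarkedGraph.fintypeV MarkedGraph.fintypeE

/-- A triple `(Γ, f, ℓ)`. -/
structure MarkedMetricGraph (n : ℕ) extends MarkedGraph n where
  ℓ : E → ℝ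
  isMetric : G.IsMetric ℓ

variable {n : ℕ}

/-- `Y` is obtained from `X` by collapsing a forest on which the metric of `X` vanishes (possibly
the empty forest, so this includes the isometries compatible with the markings). -/
structure Collapse (X Y : MarkedMetricGraph n) where
  /-- the images of the vertices -/
  vmap : X.V → Y.V
  /-- the image of an edge that is not collapsed -/
  emap : X.E → Option (Y.E × Bool)
  collapsed : ∀ e, emap e = none → vmap (X.G.src e) = vmap (X.G.tgt e) ∧ X.ℓ e = 0
  mapped : ∀ e d, emap e = some d → vmap (X.G.src e) = Y.G.dsrc d ∧
    vmap (X.G.tgt e) = Y.G.dtgt d ∧ X.ℓ e = Y.ℓ d.1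
  bij : ∀ e', ∃! e, ∃ b, emap e = some (e', b)
  fiber : ∀ u v, vmap u = vmap v → ∃ w, X.G.IsPath u v w ∧ ∀ d ∈ w, emap d.1 = none
  /-- the collapse carries the marking of `X` to that of `Y`, up to free homotopy -/
  marking : ∃ u, Y.G.IsPath Y.base (vmap X.base) u ∧ ∀ g : FreeGroup (Fin n),
    FreeGroup.lift (fun e => FreeGroup.mk (emap e).toList) (X.mark g : FreeGroup X.E) =
      (FreeGroup.mk u)⁻¹ * (Y.mark g : FreeGroup Y.E) * FreeGroup.mk u

/-- Outer space: the triples `(Γ, f, ℓ)` modulo the equivalence relation generated by collapses. -/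
def OuterSpace (n : ℕ) : Type 1 :=
  Quot fun X Y : MarkedMetricGraph n => Nonempty (Collapse X Y)

/-- The point of Outer space represented by a triple. -/
def MarkedMetricGraph.pt (X : MarkedMetricGraph n) : OuterSpace n := Quot.mk _ X

/-- The potential on Outer space, through an arbitrary representative. -/
def Psi (x : OuterSpace n) : ℝ := (Quot.out x).G.psi n (Quot.out x).ℓ

/-! ### The Lipschitz metric -/

namespace Gr

variable {V E : Type*} (G : Gr V E)

/-- A point of the graph: the point at parameter `pos` on the edge `edge`. -/
structure Point (E : Type*) where
  edge : E
  pos : ℝ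
  mem : pos ∈ Icc (0 : ℝ) 1

/-- The end of the edge of `p` at parameter `1` (`b = true`) or `0` (`b = false`). -/
def legEnd (p : Point E) (b : Bool) : V := if b then G.tgt p.edge else G.src p.edge

/-- The distance along the edge from `p` to that end. -/
def legLength (ℓ : E → ℝ) (p : Point E) (b : Bool) : ℝ :=
  (if b then 1 - p.pos else p.pos) * ℓ p.edge

/-- The class of the path, inside the edge of `p`, from its initial vertex to that end. -/
def legWord (p : Point E) (b : Bool) : FreeGroup E := if b then FreeGroup.of p.edge else 1

/-- There is a path from `p` to `q` of length `L` in the homotopy class `g`; here the class of a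
path is recorded as that of the closed up path from the initial vertex of the edge of `p` to `p`,
then along the path to `q`, and back to the initial vertex of the edge of `q`.  The path either
stays inside an edge, or leaves the edge of `p` through one of its ends, follows an edge path and
enters the edge of `q` through one of its ends. -/
def HasPath (ℓ : E → ℝ) (p q : Point E) (g : FreeGroup E) (L : ℝ) : Prop :=
  (p.edge = q.edge ∧ g = 1 ∧ L = |p.pos - q.pos| * ℓ p.edge) ∨
  ∃ (b b' : Bool) (w : List (E × Bool)), G.IsPath (G.legEnd p b) (G.legEnd q b') w ∧
    g = legWord p b * FreeGroup.mk w * (legWord q b')⁻¹ ∧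
    L = legLength ℓ p b + (w.map fun d => ℓ d.1).sum + legLength ℓ q b'

end Gr

/-- A difference of markings, linear on edges: each vertex is sent to a point, and each edge `e`
runs with constant speed through a path of class `cls e` and length `len e`. -/
structure DiffOfMarkings (X Y : MarkedMetricGraph n) where
  vert : X.V → Gr.Point Y.E
  cls : X.E → FreeGroup Y.E
  len : X.E → ℝ
  path : ∀ e, Y.G.HasPath Y.ℓ (vert (X.G.src e)) (vert (X.G.tgt e)) (cls e) (len e)
  /-- composed with the marking of `X` it is homotopic to the marking of `Y` -/
  homotopic : ∃ u, Y.G.IsPath Y.base (Y.G.src (vert X.base).edge) u ∧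
    ∀ g : FreeGroup (Fin n), FreeGroup.lift cls (X.mark g : FreeGroup X.E) =
      (FreeGroup.mk u)⁻¹ * (Y.mark g : FreeGroup Y.E) * FreeGroup.mk u

/-- The Lipschitz distance: the infimum of the numbers `r` such that some difference of markings
has all its slopes at most `exp r` (an edge of length zero has to go to a path of length zero). -/
def lipDist (x y : OuterSpace n) : ℝ :=
  sInf {r | ∃ X Y : MarkedMetricGraph n, X.pt = x ∧ Y.pt = y ∧
    ∃ φ : DiffOfMarkings X Y, ∀ e, φ.len e ≤ Real.exp r * X.ℓ e}

/-! ### Piecewise linear paths and their lengths -/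

/-- The sums `∑ d(γ(tᵢ₋₁), γ(tᵢ))` over the subdivisions of `[0,1]`. -/
def polygonalSums (γ : ℝ → OuterSpace n) : Set ℝ :=
  {r | ∃ (p : ℕ) (t : Fin (p + 1) → ℝ), StrictMono t ∧ t 0 = 0 ∧ t (Fin.last p) = 1 ∧
    r = ∑ i : Fin p, lipDist (γ (t i.castSucc)) (γ (t i.succ))}

/-- The Lipschitz length of a path. -/
def lenL (γ : ℝ → OuterSpace n) : ℝ := sSup (polygonalSums γ)

/-- A piecewise linear path `[0,1] → 𝒳ₙ` (the values of `toFun` outside `[0,1]` play no role):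
on each interval of some subdivision, it moves linearly, with velocity `vel j`, in the closed
simplex of a marked graph. -/
structure PLPath (n : ℕ) where
  toFun : ℝ → OuterSpace n
  m : ℕ
  s : Fin (m + 1) → ℝ
  strictMono : StrictMono s
  s_zero : s 0 = 0
  s_last : s (Fin.last m) = 1
  graph : Fin m → MarkedGraph n
  start : ∀ j, (graph j).E → ℝ
  vel : ∀ j, (graph j).E → ℝ
  isMetric : ∀ j, ∀ t ∈ Icc (s j.castSucc) (s j.succ),
    (graph j).G.IsMetric (start j + (t - s j.castSucc) • vel j)
  toFun_eq : ∀ j t (ht : t ∈ Icc (s j.castSucc) (s j.succ)),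
    toFun t = MarkedMetricGraph.pt
      { toMarkedGraph := graph j
        ℓ := start j + (t - s j.castSucc) • vel j
        isMetric := isMetric j t ht }

namespace PLPath

/-- The speed `‖(γ(t), γ'(t))‖^N` on the `j`-th interval. -/
def speedN (γ : PLPath n) (j : Fin γ.m) (t : ℝ) : ℝ :=
  (γ.graph j).G.normN n (γ.start j + (t - γ.s j.castSucc) • γ.vel j) (γ.vel j)

/-- The same with the variant `normNMax`. -/
def speedNMax (γ : PLPath n) (j : Fin γ.m) (t : ℝ) : ℝ :=
  (γ.graph j).G.normNMax n (γ.start j + (t - γ.s j.castSucc) • γ.vel j) (γ.vel j)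

/-- The length `len_N`, the integral of `speedN` over `[0,1]`. -/
def lenN (γ : PLPath n) : ℝ := ∑ j, ∫ t in (γ.s j.castSucc)..(γ.s j.succ), γ.speedN j t

/-- The integral of `speedNMax` over `[0,1]`. -/
def lenNMax (γ : PLPath n) : ℝ := ∑ j, ∫ t in (γ.s j.castSucc)..(γ.s j.succ), γ.speedNMax j t

end PLPath

end

end OuterSp

/-! ### Finite combinatorics of cycles, walks and edge paths -/

open Set

namespace OuterSp

noncomputable section

/-! ### Cycles of a relation on a finite type -/

section Cycles

variable {D : Type*} {R : D → D → Prop}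

/-! The length of a homology class is a minimum over loops, and a loop enters only through its
multiplicity vector in `E → ℕ`. By Dickson's lemma a class has finitely many minimal vectors, so
along `ℓ + t • τ` its length is a minimum of finitely many affine functions. The right derivative of
such a minimum is the least slope among the functions attaining it. Passing to minimal vectors
changes a realizing loop only on edges of length zero, where an integrable `τ` is nonnegative, so
this slope is the minimum in the correction term. This is `hasDerivWithinAt_log_classLength`, and
the pointwise formula is its sum over covers and classes. Classes that contain no loop contribute
`log 0 = 0` and slope `0`.

The potential descends to Outer space because collapsing a forest of length zero induces a bijection
on `H¹`, hence on double covers. Each cover is collapsed along the lifted forest, and the classes of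
loops correspond with equal lengths (`ForestCollapse.psi_eq`).

The Lipschitz length of a path is the integral of the Lipschitz norm (`isLUB_polygonalSums`). A map
of slope at most `exp r` stretches no loop by more than `exp r`, which follows by comparing the
growth of powers; so the distance is at least the logarithmic stretch of every loop
(`log_div_le_lipDist`), and over a short step the loop attaining the norm gives almost the whole
integral. Conversely, a map with slopes bounded by the largest stretch of a loop is needed only
between nearby metrics. There it comes from a duality: if `c = exp r • ℓ - ℓ'` is nonnegative on
loops, infima of weights of walks give displacements of the vertices that realize the slack `c`
(`IsAdmissible.exists_potential`, `lipMap_of_close`). Short steps are composed in the interior of a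
segment, and the ends, which may lie on faces of the simplex, are reached by maps with slopes at
most `exp ε`.

Finally `normN - normL` is the right derivative of the potential, so it integrates to the increment
of the potential on each piece, and the increments telescope. The variants with minimum and maximum
differ inside a piece only at times when two affine functions of different slopes cross, which is a
countable set. -/

theorem exists_splitting_of_not_nodup {l : List D} (h : ¬ l.Nodup) :
    ∃ l₁ d l₂ l₃, l = l₁ ++ d :: (l₂ ++ d :: l₃) := by
  obtain ⟨d, hd⟩ := List.exists_duplicate_iff_not_nodup.2 h
  have h2 := List.duplicate_iff_sublist.1 hd
  obtain ⟨l₁, r, rfl, h3, h4⟩ := List.cons_sublist_iff.1 h2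
  obtain ⟨a, b, rfl⟩ := List.append_of_mem h3
  obtain ⟨a', b', rfl⟩ := List.append_of_mem (List.singleton_sublist.1 h4)
  exact ⟨a, d, b ++ a', b', by simp⟩

/-- A weight that is nonnegative on the cycles without repetitions is nonnegative on all cycles. -/
theorem cycle_sum_nonneg (c : D → ℝ)
    (h : ∀ α : Cycle D, α.Nodup → α.Chain R → 0 ≤ (α.toMultiset.map c).sum) (α : Cycle D)
    (hα : α.Chain R) : 0 ≤ (α.toMultiset.map c).sum := by
  induction hn : α.length using Nat.strong_induction_on generalizing α with
  | _ n ih =>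
    by_cases hnd : α.Nodup
    · exact h α hnd hα
    induction α using Quotient.inductionOn with
    | _ l =>
    change ¬ Cycle.Nodup (l : Cycle D) at hnd
    rw [Cycle.nodup_coe_iff] at hnd
    obtain ⟨l₁, d, l₂, l₃, rfl⟩ := exists_splitting_of_not_nodup hnd
    -- Rotated so that the repeated element `d` comes first, the cycle splits at its second
    -- occurrence into two shorter cycles.
    have hrot : ((l₁ ++ d :: (l₂ ++ d :: l₃) : List D) : Cycle D) =
        ((d :: (l₂ ++ d :: (l₃ ++ l₁)) : List D) : Cycle D) := by
      have : (l₁ ++ d :: (l₂ ++ d :: l₃)).IsRotated (d :: (l₂ ++ d :: l₃) ++ l₁) :=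
        List.isRotated_append
      rw [Cycle.coe_eq_coe]
      simpa using this
    change Cycle.Chain R ((l₁ ++ d :: (l₂ ++ d :: l₃) : List D) : Cycle D) at hα
    change Cycle.length ((l₁ ++ d :: (l₂ ++ d :: l₃) : List D) : Cycle D) = n at hn
    change 0 ≤ (Multiset.map c (Cycle.toMultiset
      ((l₁ ++ d :: (l₂ ++ d :: l₃) : List D) : Cycle D))).sum
    rw [hrot] at hα hn ⊢
    rw [Cycle.chain_coe_cons] at hα
    have e : d :: (l₂ ++ d :: (l₃ ++ l₁) ++ [d]) = (d :: l₂) ++ d :: (l₃ ++ l₁ ++ [d]) := by simp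
    rw [e, List.isChain_split] at hα
    rw [Cycle.length_coe] at hn
    simp only [List.length_cons, List.length_append] at hn
    have h1 := ih _ (by rw [← hn, Cycle.length_coe, List.length_cons]; omega)
      ((d :: l₂ : List D) : Cycle D) (by
      rw [Cycle.chain_coe_cons]; simpa using hα.1) rfl
    have h2 := ih _ (by rw [← hn, Cycle.length_coe, List.length_cons, List.length_append]; omega)
      ((d :: (l₃ ++ l₁) : List D) : Cycle D) (by
      rw [Cycle.chain_coe_cons]; simpa using hα.2) rfl
    simp only [Cycle.coe_toMultiset, Multiset.map_coe, Multiset.sum_coe, List.map_cons,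
      List.map_append, List.sum_cons, List.sum_append] at h1 h2 ⊢
    linarith

/-- If no cycle has negative weight, every walk can be replaced by a walk without repetitions,
from the same initial element and of at most the same weight. -/
theorem exists_nodup_walk (c : D → ℝ)
    (h : ∀ α : Cycle D, α.Chain R → 0 ≤ (α.toMultiset.map c).sum) (d : D) (l : List D)
    (hl : (d :: l).IsChain R) :
    ∃ l', (d :: l').IsChain R ∧ (d :: l').Nodup ∧
      ((d :: l').map c).sum ≤ ((d :: l).map c).sum := by
  induction hn : l.length using Nat.strong_induction_on generalizing l with
  | _ n ih =>
    by_cases hnd : (d :: l).Nodup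
    · exact ⟨l, hl, hnd, le_rfl⟩
    obtain ⟨l₁, x, l₂, l₃, hx⟩ := exists_splitting_of_not_nodup hnd
    have hcyc : 0 ≤ ((x :: l₂).map c).sum := by
      have := h ((x :: l₂ : List D) : Cycle D) (by
        rw [Cycle.chain_coe_cons]
        have e : d :: l = l₁ ++ (x :: (l₂ ++ [x])) ++ l₃ := by rw [hx]; simp
        rw [e] at hl
        exact hl.left_of_append.right_of_append)
      simpa using this
    have hch : (l₁ ++ x :: l₃).IsChain R := by
      have e : d :: l = (l₁ ++ x :: l₂) ++ x :: l₃ := by rw [hx]; simp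
      have h1 := hl
      rw [hx, List.isChain_split] at h1
      rw [e, List.isChain_split] at hl
      rw [List.isChain_split]
      exact ⟨h1.1, hl.2⟩
    have hsum : ((d :: l).map c).sum = ((l₁ ++ x :: l₃).map c).sum + ((x :: l₂).map c).sum := by
      rw [hx]; simp only [List.map_append, List.map_cons, List.sum_append, List.sum_cons]; ring
    have hlen : l.length + 1 = (l₁ ++ x :: l₃).length + (l₂.length + 1) := by
      have := congrArg List.length hx
      simp only [List.length_append, List.length_cons] at this ⊢
      omega
    -- Cutting out the closed piece `x :: l₂` keeps the initial element, even when the piece begins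
    -- there.
    obtain ⟨l', hl'⟩ : ∃ l', l₁ ++ x :: l₃ = d :: l' := by
      cases l₁ with
      | nil =>
        simp only [List.nil_append, List.cons.injEq] at hx
        exact ⟨l₃, by simp [hx.1]⟩
      | cons a l₁ =>
        simp only [List.cons_append, List.cons.injEq] at hx
        exact ⟨l₁ ++ x :: l₃, by simp [hx.1]⟩
    rw [hl'] at hch hsum hlen
    simp only [List.length_cons] at hlen
    obtain ⟨l'', h1, h2, h3⟩ := ih l'.length (by omega) l' hch rfl
    exact ⟨l'', h1, h2, by linarith⟩

/-- Without cycles of negative weight, the weights of the walks are bounded from below. -/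
theorem walk_sum_ge [Fintype D] (c : D → ℝ) {κ : ℝ} (hκ : ∀ d, |c d| ≤ κ)
    (h : ∀ α : Cycle D, α.Chain R → 0 ≤ (α.toMultiset.map c).sum) (d : D) (l : List D)
    (hl : (d :: l).IsChain R) : -(Fintype.card D * κ) ≤ ((d :: l).map c).sum := by
  obtain ⟨l', -, h2, h3⟩ := exists_nodup_walk c h d l hl
  refine le_trans ?_ h3
  have h4 : (d :: l').length ≤ Fintype.card D := h2.length_le_card
  have h5 : ((d :: l').map c).sum ≥ (d :: l').length * (-κ) := by
    have : ∀ m : List D, (m.length : ℝ) * (-κ) ≤ (m.map c).sum := by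
      intro m
      induction m with
      | nil => simp
      | cons a m ih =>
        have := (abs_le.1 (hκ a)).1
        simp only [List.length_cons, List.map_cons, List.sum_cons]
        push_cast
        linarith
    exact this _
  have h6 : 0 ≤ κ := le_trans (abs_nonneg _) (hκ d)
  have h7 : ((d :: l').length : ℝ) ≤ Fintype.card D := by exact_mod_cast h4
  nlinarith

/-- A relation on a finite type in which each element of `S` is related to an element of `S` has a
cycle inside `S`. -/
theorem exists_cycle_of_forall_exists [Finite D] (S : Set D) (hne : S.Nonempty)
    (h : ∀ d ∈ S, ∃ d' ∈ S, R d d') :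
    ∃ α : Cycle D, α ≠ Cycle.nil ∧ α.Chain R ∧ ∀ d ∈ α, d ∈ S := by
  choose! f hf using h
  obtain ⟨d₀, hd₀⟩ := hne
  have hit : ∀ k, f^[k] d₀ ∈ S := by
    intro k
    induction k with
    | zero => exact hd₀
    | succ k ih => rw [Function.iterate_succ_apply']; exact (hf _ ih).1
  -- The orbit of a chosen successor function is eventually periodic; its periodic part is the
  -- cycle.
  obtain ⟨i, j, hij, he⟩ := Finite.exists_ne_map_eq_of_infinite fun k : ℕ => f^[k] d₀
  wlog hlt : i < j generalizing i j
  · exact this j i hij.symm he.symm (by omega)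
  have hper : Function.IsPeriodicPt f (j - i) (f^[i] d₀) := by
    change f^[j - i] (f^[i] d₀) = f^[i] d₀
    rw [← Function.iterate_add_apply, Nat.sub_add_cancel hlt.le]
    exact he.symm
  have hmem : f^[i] d₀ ∈ Function.periodicPts f := ⟨j - i, by omega, hper⟩
  refine ⟨Function.periodicOrbit f (f^[i] d₀), ?_, ?_, ?_⟩
  · rw [Ne, Function.periodicOrbit_eq_nil_iff_not_periodic_pt]
    exact not_not.2 hmem
  · rw [Function.periodicOrbit_chain' _ hmem]
    intro k
    rw [Function.iterate_succ_apply']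
    refine (hf _ ?_).2
    rw [← Function.iterate_add_apply]
    exact hit _
  · intro d hd
    rw [Function.mem_periodicOrbit_iff hmem] at hd
    obtain ⟨k, rfl⟩ := hd
    rw [← Function.iterate_add_apply]
    exact hit _

end Cycles

namespace Gr

variable {V E : Type*} {G : Gr V E}

/-! ### Edge paths -/

/-- The darts `d`, `d'` can be crossed one after the other in an immersed path. -/
def Adj (G : Gr V E) (d d' : E × Bool) : Prop := G.dtgt d = G.dsrc d' ∧ d' ≠ (d.1, !d.2)

@[simp] theorem dsrc_drev (d : E × Bool) : G.dsrc (d.1, !d.2) = G.dtgt d := by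
  cases hd : d.2 <;> simp [dsrc, dtgt, hd]

@[simp] theorem dtgt_drev (d : E × Bool) : G.dtgt (d.1, !d.2) = G.dsrc d := by
  cases hd : d.2 <;> simp [dsrc, dtgt, hd]

theorem isPath_nil {u v : V} : G.IsPath u v [] ↔ u = v := Iff.rfl

theorem isPath_cons {u v : V} {d : E × Bool} {w : List (E × Bool)} :
    G.IsPath u v (d :: w) ↔ G.dsrc d = u ∧ G.IsPath (G.dtgt d) v w := Iff.rfl

theorem isPath_singleton (d : E × Bool) : G.IsPath (G.dsrc d) (G.dtgt d) [d] := ⟨rfl, rfl⟩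

theorem isPath_append {u v : V} {w w' : List (E × Bool)} :
    G.IsPath u v (w ++ w') ↔ ∃ x, G.IsPath u x w ∧ G.IsPath x v w' := by
  induction w generalizing u with
  | nil => simp [isPath_nil]
  | cons d w ih => simp [isPath_cons, ih, and_assoc]

theorem IsPath.eq_of_left {u v v' : V} {w : List (E × Bool)} (h : G.IsPath u v w)
    (h' : G.IsPath u v' w) : v = v' := by
  induction w generalizing u with
  | nil => exact (isPath_nil.1 h).symm.trans (isPath_nil.1 h')
  | cons d w ih => exact ih h.2 h'.2

theorem IsPath.step {u v : V} {w w' : List (E × Bool)} (h : G.IsPath u v w)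
    (hs : FreeGroup.Red.Step w w') : G.IsPath u v w' := by
  cases hs with
  | @not L₁ L₂ x b =>
    obtain ⟨y, h1, h2⟩ := isPath_append.1 h
    rw [isPath_cons, isPath_cons] at h2
    obtain ⟨h3, h4, h5⟩ := h2
    have : G.dtgt (x, !b) = G.dsrc (x, b) := dtgt_drev (x, b)
    rw [this, h3] at h5
    exact h1.append h5

theorem IsPath.red {u v : V} {w w' : List (E × Bool)} (h : G.IsPath u v w)
    (hs : FreeGroup.Red w w') : G.IsPath u v w' := by
  induction hs with
  | refl => exact h
  | tail _ h2 ih => exact ih.step h2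

theorem IsPath.isChain {u v : V} {w : List (E × Bool)} (h : G.IsPath u v w)
    (hr : FreeGroup.IsReduced w) : w.IsChain G.Adj := by
  induction w generalizing u with
  | nil => exact List.isChain_nil
  | cons d w ih =>
    cases w with
    | nil => exact List.isChain_singleton _
    | cons d' w =>
      rw [FreeGroup.IsReduced, List.isChain_cons_cons] at hr
      rw [List.isChain_cons_cons]
      refine ⟨⟨h.2.1.symm, ?_⟩, ih h.2 hr.2⟩
      rintro rfl
      simpa using hr.1

theorem isReduced_of_isChain {w : List (E × Bool)} (h : w.IsChain G.Adj) :
    FreeGroup.IsReduced w := by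
  refine List.IsChain.imp ?_ h
  rintro ⟨a, b⟩ ⟨a', b'⟩ ⟨-, h2⟩ (rfl : a = a')
  simp only [ne_eq, Prod.mk.injEq, true_and] at h2
  cases b <;> cases b' <;> simp_all

theorem isPath_of_isChain {d : E × Bool} {w : List (E × Bool)} (h : (d :: w).IsChain G.Adj) :
    G.IsPath (G.dsrc d) (G.dtgt ((d :: w).getLast (by simp))) (d :: w) := by
  induction w generalizing d with
  | nil => exact isPath_singleton d
  | cons d' w ih =>
    rw [List.isChain_cons_cons] at h
    refine ⟨rfl, ?_⟩
    rw [h.1.1, List.getLast_cons (by simp)]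
    exact ih h.2

/-- A loop, as a closed path. -/
theorem IsLoop.exists_path {α : Cycle (E × Bool)} (h : G.IsLoop α) :
    ∃ (v : V) (w : List (E × Bool)), α = (w : Cycle (E × Bool)) ∧ w ≠ [] ∧ G.IsPath v v w ∧
      FreeGroup.IsCyclicallyReduced w := by
  induction α using Quotient.inductionOn with
  | _ l =>
  cases l with
  | nil => exact absurd rfl h.1
  | cons d l =>
    have h2 : Cycle.Chain G.Adj ((d :: l : List (E × Bool)) : Cycle (E × Bool)) := h.2
    have h3 := h2
    rw [Cycle.chain_coe_cons] at h2
    rw [Cycle.chain_ne_nil _ (by simp)] at h3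
    have h4 : (d :: l).IsChain G.Adj := h3.tail
    have h5 := isPath_of_isChain h4
    have h6 : G.Adj ((d :: l).getLast (by simp)) d := by
      rw [List.isChain_cons_cons] at h3; exact h3.1
    rw [h6.1] at h5
    refine ⟨G.dsrc d, d :: l, rfl, by simp, h5, isReduced_of_isChain h4, ?_⟩
    intro a ha b hb
    rw [List.getLast?_eq_some_getLast (by simp)] at ha
    simp only [Option.mem_def, Option.some.injEq] at ha
    simp only [List.head?_cons, Option.mem_def, Option.some.injEq] at hb
    subst hb
    rw [ha] at h6
    have := isReduced_of_isChain (G := G) (w := [a, d]) (by simpa using h6)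
    simpa [FreeGroup.IsReduced] using this

theorem IsPath.isLoop {v : V} {w : List (E × Bool)} (h : G.IsPath v v w) (hne : w ≠ [])
    (hr : FreeGroup.IsCyclicallyReduced w) : G.IsLoop (w : Cycle (E × Bool)) := by
  refine ⟨by simpa using hne, ?_⟩
  have h1 := h.isChain hr.isReduced
  rw [Cycle.chain_ne_nil _ hne]
  cases w with
  | nil => exact absurd rfl hne
  | cons d w =>
    rw [List.isChain_cons_cons]
    refine ⟨⟨?_, ?_⟩, h1⟩
    · have h5 := isPath_of_isChain h1
      rw [h.1] at h5 ⊢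
      exact h5.eq_of_left h
    · intro hh
      have := hr.2 _ (List.getLast?_eq_some_getLast (by simp)) d (by simp)
      generalize (d :: w).getLast _ = a at *
      subst hh
      simpa using this rfl

open Classical in
/-- A closed path is freely homotopic to a closed path, through some of its edges, that is trivial
or a loop. -/
theorem IsPath.exists_tight {v : V} {w : List (E × Bool)} (h : G.IsPath v v w) :
    ∃ v' u w', G.IsPath v v' u ∧ G.IsPath v' v' w' ∧ w'.Sublist w ∧
      FreeGroup.mk w = FreeGroup.mk u * FreeGroup.mk w' * (FreeGroup.mk u)⁻¹ ∧
      (w' = [] ∨ G.IsLoop (w' : Cycle (E × Bool))) := by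
  have hred : FreeGroup.Red w (FreeGroup.reduce w) := FreeGroup.reduce.red
  have h1 := h.red hred
  have h2 : FreeGroup.IsReduced (FreeGroup.reduce w) := by
    rw [FreeGroup.isReduced_iff_reduce_eq, FreeGroup.reduce.idem]
  have h3 := FreeGroup.reduceCyclically.conj_conjugator_reduceCyclically (FreeGroup.reduce w)
  set c := FreeGroup.reduceCyclically.conjugator (FreeGroup.reduce w)
  set w' := FreeGroup.reduceCyclically (FreeGroup.reduce w)
  have h4 := h1
  rw [← h3, isPath_append] at h4
  obtain ⟨y, h4, h5⟩ := h4
  obtain ⟨x, h6, h7⟩ := isPath_append.1 h4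
  have hy : y = x := by
    have := h5.invRev
    rw [FreeGroup.invRev_invRev] at this
    exact this.eq_of_left h6
  subst hy
  refine ⟨_, c, w', h6, h7, ?_, ?_, ?_⟩
  · refine List.Sublist.trans ?_ hred.sublist
    rw [← h3]
    exact (List.sublist_append_right _ _).trans (List.sublist_append_left _ _)
  · rw [← FreeGroup.reduce.self (L := w), ← h3, FreeGroup.inv_mk, FreeGroup.mul_mk,
      FreeGroup.mul_mk]
  · by_cases hn : w' = []
    · exact Or.inl hn
    · exact Or.inr (h7.isLoop hn (FreeGroup.reduceCyclically.isCyclicallyReduced h2))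

/-- No loop crosses only edges of `Z`. -/
def IsForest (G : Gr V E) (Z : Set E) : Prop := ∀ α, G.IsLoop α → ∃ d ∈ α, d.1 ∉ Z

/-- Tightening uses only edges of the original path, so a nontrivial result would be a loop inside
the forest. -/
theorem IsForest.mk_eq_one {Z : Set E} (hZ : G.IsForest Z) {v : V} {w : List (E × Bool)}
    (h : G.IsPath v v w) (hw : ∀ d ∈ w, d.1 ∈ Z) : FreeGroup.mk w = 1 := by
  obtain ⟨v', u, w', -, -, h3, h4, h5⟩ := h.exists_tight
  rcases h5 with rfl | h5
  · rw [h4, ← FreeGroup.one_eq_mk, mul_one, mul_inv_cancel]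
  · obtain ⟨d, hd, hd'⟩ := hZ _ h5
    exact absurd (hw d (h3.subset (by simpa using hd))) hd'

/-- The total weight of the edges that an edge path crosses. -/
def pathWeight (τ : E → ℝ) (w : List (E × Bool)) : ℝ := (w.map fun d => τ d.1).sum

@[simp] theorem pathWeight_nil (τ : E → ℝ) : pathWeight τ [] = 0 := rfl

@[simp] theorem pathWeight_cons (τ : E → ℝ) (d : E × Bool) (w : List (E × Bool)) :
    pathWeight τ (d :: w) = τ d.1 + pathWeight τ w := by simp [pathWeight]

@[simp] theorem pathWeight_append (τ : E → ℝ) (w w' : List (E × Bool)) :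
    pathWeight τ (w ++ w') = pathWeight τ w + pathWeight τ w' := by simp [pathWeight]

@[simp] theorem pathWeight_invRev (τ : E → ℝ) (w : List (E × Bool)) :
    pathWeight τ (FreeGroup.invRev w) = pathWeight τ w := by
  simp [pathWeight, FreeGroup.invRev, List.sum_reverse, Function.comp_def]

@[simp] theorem weight_coe (τ : E → ℝ) (w : List (E × Bool)) :
    weight τ (w : Cycle (E × Bool)) = pathWeight τ w := by simp [weight, pathWeight]

theorem pathWeight_nonneg {ℓ : E → ℝ} (h : ∀ e, 0 ≤ ℓ e) (w : List (E × Bool)) :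
    0 ≤ pathWeight ℓ w := List.sum_nonneg (by simp only [List.mem_map]; rintro _ ⟨d, -, rfl⟩; exact h _)

theorem pathWeight_sublist {ℓ : E → ℝ} (h : ∀ e, 0 ≤ ℓ e) {w w' : List (E × Bool)}
    (hs : w'.Sublist w) : pathWeight ℓ w' ≤ pathWeight ℓ w :=
  (hs.map _).sum_le_sum (by simp only [List.mem_map]; rintro _ ⟨d, -, rfl⟩; exact h _)

theorem pathWeight_eq_zero {ℓ : E → ℝ} {w : List (E × Bool)} (h : ∀ d ∈ w, ℓ d.1 = 0) :
    pathWeight ℓ w = 0 := List.sum_eq_zero (by simp only [List.mem_map]; rintro _ ⟨d, hd, rfl⟩; exact h d hd)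

theorem IsAdmissible.exists_dart_ne [Finite E] (h : G.IsAdmissible) (d : E × Bool) :
    ∃ d', G.dsrc d' = G.dsrc d ∧ d' ≠ d := by
  have h1 := h.valence (G.dsrc d)
  obtain ⟨d', hd', hne⟩ := Set.exists_ne_of_one_lt_ncard (by omega :
    1 < Set.ncard {d' : E × Bool | G.dsrc d' = G.dsrc d}) d
  exact ⟨d', hd', hne⟩

theorem IsAdmissible.exists_dart (h : G.IsAdmissible) (v : V) : ∃ d, G.dsrc d = v := by
  have h1 := h.valence v
  exact Set.nonempty_of_ncard_ne_zero (s := {d : E × Bool | G.dsrc d = v}) (by omega)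

/-- By the valence condition every dart can be continued without backtracking, and a finite graph
forces such a walk to close up. -/
theorem IsAdmissible.exists_loop [Finite E] (h : G.IsAdmissible) : ∃ α, G.IsLoop α := by
  obtain ⟨v⟩ := h.nonempty
  obtain ⟨d, -⟩ := h.exists_dart v
  obtain ⟨α, h1, h2, -⟩ := exists_cycle_of_forall_exists (R := G.Adj) univ ⟨d, mem_univ _⟩ (by
    intro d _
    obtain ⟨d', h1, h2⟩ := h.exists_dart_ne (d.1, !d.2)
    exact ⟨d', mem_univ _, by rw [h1, dsrc_drev], h2⟩)
  exact ⟨α, h1, h2⟩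

theorem weight_nonneg {ℓ : E → ℝ} (h : ∀ e, 0 ≤ ℓ e) (α : Cycle (E × Bool)) : 0 ≤ weight ℓ α :=
  Multiset.sum_nonneg (by simp only [Multiset.mem_map]; rintro _ ⟨d, -, rfl⟩; exact h _)

theorem weight_pos {ℓ : E → ℝ} (h : ∀ e, 0 ≤ ℓ e) {α : Cycle (E × Bool)}
    (hα : ∃ d ∈ α, ℓ d.1 ≠ 0) : 0 < weight ℓ α := by
  obtain ⟨d, hd, hne⟩ := hα
  induction α using Quotient.inductionOn with
  | _ l =>
  change d ∈ (l : Cycle (E × Bool)) at hd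
  change 0 < weight ℓ (l : Cycle (E × Bool))
  rw [Cycle.mem_coe_iff] at hd
  obtain ⟨a, b, rfl⟩ := List.append_of_mem hd
  rw [weight_coe, pathWeight_append, pathWeight_cons]
  have h1 := pathWeight_nonneg h a
  have h2 := pathWeight_nonneg h b
  have h3 := lt_of_le_of_ne (h d.1) (Ne.symm hne)
  linarith

theorem IsMetric.nonneg [Fintype E] {ℓ : E → ℝ} (h : G.IsMetric ℓ) (e : E) : 0 ≤ ℓ e :=
  (h.mem_Icc e).1

theorem IsMetric.weight_pos [Fintype E] {ℓ : E → ℝ} (h : G.IsMetric ℓ) {α : Cycle (E × Bool)}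
    (hα : G.IsLoop α) : 0 < weight ℓ α := Gr.weight_pos h.nonneg (h.forest α hα)

theorem IsMetric.isForest [Fintype E] {ℓ : E → ℝ} (h : G.IsMetric ℓ) : G.IsForest {e | ℓ e = 0} :=
  h.forest

theorem weight_add_smul (ℓ τ : E → ℝ) (t : ℝ) (α : Cycle (E × Bool)) :
    weight (ℓ + t • τ) α = weight ℓ α + t * weight τ α := by
  simp [weight, Multiset.sum_map_add, Multiset.sum_map_mul_left]

end Gr

end

end OuterSp

/-! ### Lengths of homology classes as minima of finitely many linear functions, and the derivative
of the potential -/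

namespace OuterSp

noncomputable section

/-! ### Minima of finitely many affine functions -/

section Affine

variable {ι : Type*}

/-- For small `t ≥ 0` the functions with `p i > P` stay above the line `P + t * Q`, and those with
`p i = P` have slope at least `Q`. Hence the minimum coincides with that line near `0`. -/
theorem hasDerivWithinAt_inf'_affine (F : Finset ι) (hF : F.Nonempty) (p q : ι → ℝ) (P Q : ℝ)
    (hP : ∀ i ∈ F, P ≤ p i) (hQ : ∀ i ∈ F, p i = P → Q ≤ q i)
    (hPQ : ∃ i ∈ F, p i = P ∧ q i = Q) :
    HasDerivWithinAt (fun t : ℝ => F.inf' hF fun i => p i + t * q i) Q (Ici 0) 0 := by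
  have h1 : ∀ i ∈ F, ∀ᶠ t in nhdsWithin (0 : ℝ) (Ici 0), P + t * Q ≤ p i + t * q i := by
    intro i hi
    by_cases h : p i = P
    · filter_upwards [self_mem_nhdsWithin] with t ht
      have := mul_le_mul_of_nonneg_left (hQ i hi h) (show (0 : ℝ) ≤ t from ht)
      linarith
    · have h2 : P < p i := lt_of_le_of_ne (hP i hi) (Ne.symm h)
      have h3 : Filter.Tendsto (fun t : ℝ => P + t * Q) (nhds 0) (nhds (P + 0 * Q)) :=
        (by fun_prop : Continuous fun t : ℝ => P + t * Q).tendsto 0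
      have h4 : Filter.Tendsto (fun t : ℝ => p i + t * q i) (nhds 0) (nhds (p i + 0 * q i)) :=
        (by fun_prop : Continuous fun t : ℝ => p i + t * q i).tendsto 0
      filter_upwards [(h3.eventually_lt h4 (by simpa using h2)).filter_mono nhdsWithin_le_nhds]
        with t ht using ht.le
  have h2 : ∀ᶠ t in nhdsWithin (0 : ℝ) (Ici 0), ∀ i ∈ F, P + t * Q ≤ p i + t * q i :=
    (Filter.eventually_all_finset F).2 h1
  obtain ⟨i₀, hi₀, hp, hq⟩ := hPQ
  have h3 : HasDerivWithinAt (fun t : ℝ => P + t * Q) Q (Ici 0) 0 := by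
    simpa using ((hasDerivWithinAt_id (0 : ℝ) (Ici 0)).mul_const Q).const_add P
  refine h3.congr_of_eventuallyEq ?_ ?_
  · filter_upwards [h2] with t ht
    apply le_antisymm
    · exact (Finset.inf'_le _ hi₀).trans (by rw [hp, hq])
    · exact Finset.le_inf' _ _ fun i hi => ht i hi
  · apply le_antisymm
    · exact (Finset.inf'_le _ hi₀).trans (by rw [hp, hq])
    · exact Finset.le_inf' _ _ fun i hi => by simpa using hP i hi

end Affine

namespace Gr

variable {V E : Type*} {G : Gr V E}

/-! ### Multiplicity vectors -/

open Classical in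
/-- The numbers of times that a loop crosses the edges. -/
def mult (α : Cycle (E × Bool)) (e : E) : ℕ := (α.toMultiset.map Prod.fst).count e

variable [Fintype E]

/-- The weight of a multiplicity vector. -/
def dot (m : E → ℕ) (τ : E → ℝ) : ℝ := ∑ e, (m e : ℝ) * τ e

theorem dot_add_smul (m : E → ℕ) (ℓ τ : E → ℝ) (t : ℝ) :
    dot m (ℓ + t • τ) = dot m ℓ + t * dot m τ := by
  simp only [dot, Pi.add_apply, Pi.smul_apply, smul_eq_mul, mul_add, Finset.sum_add_distrib,
    Finset.mul_sum]
  congr 1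
  exact Finset.sum_congr rfl fun _ _ => by ring

theorem weight_eq_dot (τ : E → ℝ) (α : Cycle (E × Bool)) : weight τ α = dot (mult α) τ := by
  classical
  have h : weight τ α = ((α.toMultiset.map Prod.fst).map τ).sum := by
    simp [weight, Multiset.map_map]
  rw [h, Finset.sum_multiset_map_count]
  have h2 : ∀ e, (α.toMultiset.map Prod.fst).count e = mult α e := fun e => by
    unfold mult; congr!
  simp only [h2, nsmul_eq_mul, dot]
  refine Finset.sum_subset (Finset.subset_univ _) fun e _ he => ?_
  rw [← h2, Multiset.count_eq_zero_of_notMem (by simpa using he)]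
  simp

theorem dot_le_dot {m m' : E → ℕ} (h : m ≤ m') {τ : E → ℝ}
    (hτ : ∀ e, m e ≠ m' e → 0 ≤ τ e) : dot m τ ≤ dot m' τ := by
  refine Finset.sum_le_sum fun e _ => ?_
  by_cases he : m e = m' e
  · rw [he]
  · exact mul_le_mul_of_nonneg_right (by exact_mod_cast h e) (hτ e he)

theorem eq_zero_of_dot_eq {m m' : E → ℕ} (h : m ≤ m') {ℓ : E → ℝ} (hℓ : ∀ e, 0 ≤ ℓ e)
    (heq : dot m ℓ = dot m' ℓ) (e : E) (he : m e ≠ m' e) : ℓ e = 0 := by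
  have h1 : ∀ e ∈ Finset.univ, (m e : ℝ) * ℓ e ≤ m' e * ℓ e := fun e _ =>
    mul_le_mul_of_nonneg_right (by exact_mod_cast h e) (hℓ e)
  have h2 := (Finset.sum_eq_sum_iff_of_le h1).1 heq e (Finset.mem_univ e)
  by_contra h3
  exact he (by exact_mod_cast mul_right_cancel₀ h3 h2)

variable (G)

/-- The multiplicity vectors of the loops in a class. -/
def classMults (a : E → ZMod 2) : Set (E → ℕ) := {m | ∃ α, G.IsLoop α ∧ loopClass α = a ∧ mult α = m}

/-- Dickson's lemma: `E → ℕ` is well quasi-ordered, and minimal elements form an antichain. -/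
theorem finite_minimal_classMults (a : E → ZMod 2) :
    {m | Minimal (· ∈ G.classMults a) m}.Finite := by
  apply WellQuasiOrderedLE.finite_of_isAntichain
  intro m hm m' hm' hne hle
  exact hne (le_antisymm hle (hm'.2 hm.1 hle))

/-- The minimal multiplicity vectors of the loops in a class; by Dickson's lemma there are finitely
many. -/
def minMults (a : E → ZMod 2) : Finset (E → ℕ) := (G.finite_minimal_classMults a).toFinset

variable {G}

theorem mem_minMults {a : E → ZMod 2} {m : E → ℕ} :
    m ∈ G.minMults a ↔ Minimal (· ∈ G.classMults a) m := by simp [minMults]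

theorem exists_loop_of_mem_minMults {a : E → ZMod 2} {m : E → ℕ} (h : m ∈ G.minMults a) :
    ∃ α, G.IsLoop α ∧ loopClass α = a ∧ mult α = m := (mem_minMults.1 h).1

theorem exists_minMults_le {α : Cycle (E × Bool)} (h : G.IsLoop α) :
    ∃ m ∈ G.minMults (loopClass α), m ≤ mult α := by
  obtain ⟨m, h1, h2⟩ := exists_minimal_le_of_wellFoundedLT
    (· ∈ G.classMults (loopClass α)) (mult α) ⟨α, h, rfl, rfl⟩
  exact ⟨m, mem_minMults.2 h2, h1⟩

theorem minMults_eq_empty_iff {a : E → ZMod 2} :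
    G.minMults a = ∅ ↔ ∀ α, G.IsLoop α → loopClass α ≠ a := by
  constructor
  · rintro h α hα rfl
    obtain ⟨m, hm, -⟩ := exists_minMults_le hα
    simp [h] at hm
  · intro h
    rw [Finset.eq_empty_iff_forall_notMem]
    intro m hm
    obtain ⟨α, h1, h2, -⟩ := exists_loop_of_mem_minMults hm
    exact h α h1 h2

theorem classLength_of_minMults_eq_empty {a : E → ZMod 2} (h : G.minMults a = ∅) (ℓ : E → ℝ) :
    G.classLength ℓ a = 0 := by
  rw [classLength, ← Real.sInf_empty]
  congr 1
  rw [Set.eq_empty_iff_forall_notMem]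
  rintro r ⟨α, h1, h2, -⟩
  exact minMults_eq_empty_iff.1 h α h1 h2

theorem realizedValues_of_minMults_eq_empty {a : E → ZMod 2} (h : G.minMults a = ∅)
    (ℓ τ : E → ℝ) : G.realizedValues ℓ τ a = ∅ := by
  rw [Set.eq_empty_iff_forall_notMem]
  rintro r ⟨α, h1, h2, -⟩
  exact minMults_eq_empty_iff.1 h α h1 h2

theorem classLength_eq_inf' {a : E → ZMod 2} (h : (G.minMults a).Nonempty) {ℓ : E → ℝ}
    (hℓ : ∀ e, 0 ≤ ℓ e) : G.classLength ℓ a = (G.minMults a).inf' h fun m => dot m ℓ := by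
  refine IsLeast.csInf_eq ⟨?_, ?_⟩
  · obtain ⟨m, hm, he⟩ := Finset.exists_mem_eq_inf' h fun m => dot m ℓ
    obtain ⟨α, h1, h2, rfl⟩ := exists_loop_of_mem_minMults hm
    exact ⟨α, h1, h2, by rw [he, weight_eq_dot]⟩
  · rintro r ⟨α, h1, rfl, rfl⟩
    obtain ⟨m, hm, hle⟩ := exists_minMults_le h1
    rw [weight_eq_dot]
    exact (Finset.inf'_le _ hm).trans (dot_le_dot hle fun e _ => hℓ e)

omit [Fintype E] in
theorem classLength_le_weight {ℓ : E → ℝ} (hℓ : ∀ e, 0 ≤ ℓ e) {α : Cycle (E × Bool)}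
    (h : G.IsLoop α) : G.classLength ℓ (loopClass α) ≤ weight ℓ α := by
  refine csInf_le ⟨0, ?_⟩ ⟨α, h, rfl, rfl⟩
  rintro r ⟨β, -, -, rfl⟩
  exact weight_nonneg hℓ β

theorem exists_minMults_dot_eq {a : E → ZMod 2} (h : (G.minMults a).Nonempty) {ℓ : E → ℝ}
    (hℓ : ∀ e, 0 ≤ ℓ e) : ∃ m ∈ G.minMults a, dot m ℓ = G.classLength ℓ a := by
  rw [classLength_eq_inf' h hℓ]
  obtain ⟨m, hm, he⟩ := Finset.exists_mem_eq_inf' h fun m => dot m ℓ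
  exact ⟨m, hm, he.symm⟩

theorem classLength_le_dot {a : E → ZMod 2} {m : E → ℕ} (hm : m ∈ G.minMults a) {ℓ : E → ℝ}
    (hℓ : ∀ e, 0 ≤ ℓ e) : G.classLength ℓ a ≤ dot m ℓ := by
  rw [classLength_eq_inf' ⟨m, hm⟩ hℓ]
  exact Finset.inf'_le _ hm

theorem classLength_pos {a : E → ZMod 2} (h : (G.minMults a).Nonempty) {ℓ : E → ℝ}
    (hℓ : ∀ e, 0 ≤ ℓ e) (hpos : ∀ α, G.IsLoop α → 0 < weight ℓ α) : 0 < G.classLength ℓ a := by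
  obtain ⟨m, hm, he⟩ := exists_minMults_dot_eq h hℓ
  obtain ⟨α, h1, h2, rfl⟩ := exists_loop_of_mem_minMults hm
  rw [← he, ← weight_eq_dot]
  exact hpos α h1

/-- A loop realizing the length of its class has a minimal multiplicity vector, up to edges of
length zero. -/
theorem exists_minMults_of_realized {ℓ : E → ℝ} (hℓ : ∀ e, 0 ≤ ℓ e) {α : Cycle (E × Bool)}
    (h : G.IsLoop α) (hα : weight ℓ α = G.classLength ℓ (loopClass α)) :
    ∃ m ∈ G.minMults (loopClass α), m ≤ mult α ∧ dot m ℓ = G.classLength ℓ (loopClass α) ∧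
      ∀ e, m e ≠ mult α e → ℓ e = 0 := by
  obtain ⟨m, hm, hle⟩ := exists_minMults_le h
  have h1 := classLength_le_dot hm hℓ
  have h2 := dot_le_dot hle (τ := ℓ) fun e _ => hℓ e
  rw [weight_eq_dot] at hα
  have h3 : dot m ℓ = dot (mult α) ℓ := by linarith
  exact ⟨m, hm, hle, by linarith, eq_zero_of_dot_eq hle hℓ h3⟩

/-- There may be infinitely many realizing loops, since edges of length zero are free. Each of them
lies above a minimal vector that also realizes the length, and the surplus sits on edges of length
zero, where `τ ≥ 0`. So the minimum over loops is attained on the finite set of minimal vectors. -/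
theorem isLeast_realizedValues {a : E → ZMod 2} (h : (G.minMults a).Nonempty) {ℓ τ : E → ℝ}
    (hℓ : ∀ e, 0 ≤ ℓ e) (hτ : ∀ e, ℓ e = 0 → 0 ≤ τ e) :
    ∃ m ∈ G.minMults a, dot m ℓ = G.classLength ℓ a ∧
      IsLeast (G.realizedValues ℓ τ a) (dot m τ) ∧
      ∀ m' ∈ G.minMults a, dot m' ℓ = G.classLength ℓ a → dot m τ ≤ dot m' τ := by
  classical
  obtain ⟨m₀, hm₀, he₀⟩ := exists_minMults_dot_eq h hℓ
  obtain ⟨m, hm, hmin⟩ := Finset.exists_min_image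
    ((G.minMults a).filter fun m => dot m ℓ = G.classLength ℓ a) (fun m => dot m τ)
    ⟨m₀, by simp [hm₀, he₀]⟩
  rw [Finset.mem_filter] at hm
  refine ⟨m, hm.1, hm.2, ⟨?_, ?_⟩, fun m' h1 h2 => hmin m' (by simp [h1, h2])⟩
  · obtain ⟨α, h1, h2, rfl⟩ := exists_loop_of_mem_minMults hm.1
    exact ⟨α, h1, h2, by rw [weight_eq_dot, hm.2], by rw [weight_eq_dot]⟩
  · rintro r ⟨α, h1, rfl, h3, rfl⟩
    obtain ⟨m', h4, h5, h6, h7⟩ := exists_minMults_of_realized hℓ h1 h3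
    refine (hmin m' (by simp [h4, h6])).trans ?_
    rw [weight_eq_dot]
    exact dot_le_dot h5 fun e he => hτ e (h7 e he)

/-- The right derivative of the logarithm of the length of a class. -/
theorem hasDerivWithinAt_log_classLength (a : E → ZMod 2) {ℓ τ : E → ℝ}
    (hℓ : ∀ e, 0 ≤ ℓ e) (hτ : ∀ e, ℓ e = 0 → 0 ≤ τ e)
    (hpos : ∀ α, G.IsLoop α → 0 < weight ℓ α) :
    HasDerivWithinAt (fun t : ℝ => Real.log (G.classLength (ℓ + t • τ) a))
      (sInf (G.realizedValues ℓ τ a) / G.classLength ℓ a) (Ici 0) 0 := by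
  rcases (G.minMults a).eq_empty_or_nonempty with h | h
  · simp only [classLength_of_minMults_eq_empty h, div_zero]
    exact hasDerivWithinAt_const _ _ _
  obtain ⟨m, hm, h1, h2, h3⟩ := isLeast_realizedValues h hℓ hτ
  rw [h2.csInf_eq]
  -- The formula for the class length as a finite minimum needs nonnegative edge lengths, which
  -- persist for small `t ≥ 0` because `τ` does not decrease edges of length zero.
  have hnn : ∀ᶠ t in nhdsWithin (0 : ℝ) (Ici 0), ∀ e, 0 ≤ (ℓ + t • τ) e := by
    rw [Filter.eventually_all]
    intro e
    simp only [Pi.add_apply, Pi.smul_apply, smul_eq_mul]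
    by_cases he : ℓ e = 0
    · filter_upwards [self_mem_nhdsWithin] with t ht
      have := mul_nonneg (show (0 : ℝ) ≤ t from ht) (hτ e he)
      linarith
    · have h4 : 0 < ℓ e := lt_of_le_of_ne (hℓ e) (Ne.symm he)
      have h5 : Filter.Tendsto (fun t : ℝ => ℓ e + t * τ e) (nhds 0) (nhds (ℓ e + 0 * τ e)) :=
        (by fun_prop : Continuous fun t : ℝ => ℓ e + t * τ e).tendsto 0
      filter_upwards [(h5.eventually_const_lt (u := 0) (by simpa using h4)).filter_mono
        nhdsWithin_le_nhds] with t ht using ht.le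
  have hd := hasDerivWithinAt_inf'_affine (G.minMults a) h (fun m => dot m ℓ) (fun m => dot m τ)
    (G.classLength ℓ a) (dot m τ) (fun m' hm' => classLength_le_dot hm' hℓ) h3 ⟨m, hm, h1, rfl⟩
  have hd2 : HasDerivWithinAt (fun t : ℝ => G.classLength (ℓ + t • τ) a) (dot m τ) (Ici 0) 0 := by
    refine hd.congr_of_eventuallyEq ?_ ?_
    · filter_upwards [hnn] with t ht
      rw [classLength_eq_inf' h ht]
      simp only [dot_add_smul]
    · rw [classLength_eq_inf' h (by simpa using hℓ)]
      simp only [dot_add_smul]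
  have h6 := hd2.log (by simpa using (classLength_pos h hℓ hpos).ne')
  simpa using h6

/-! ### The length of a class along a segment -/

section Segment

variable {ℓ τ : E → ℝ} {x y : ℝ}

omit [Fintype E] in
-- An affine function that is nonnegative on an interval and vanishes at an interior point is
-- constant. Thus every velocity is integrable at interior times.
theorem eq_zero_of_mem_Ioo (hℓ : ∀ t ∈ Icc x y, ∀ e, 0 ≤ (ℓ + t • τ) e) {t : ℝ} (ht : t ∈ Ioo x y)
    {e : E} (he : (ℓ + t • τ) e = 0) : τ e = 0 := by
  have h1 := hℓ x ⟨le_rfl, (ht.1.trans ht.2).le⟩ e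
  have h2 := hℓ y ⟨(ht.1.trans ht.2).le, le_rfl⟩ e
  simp only [Pi.add_apply, Pi.smul_apply, smul_eq_mul] at h1 h2 he
  have h3 := ht.1
  have h4 := ht.2
  apply le_antisymm
  · by_contra! h
    have := mul_lt_mul_of_pos_right h3 h
    linarith
  · by_contra! h
    have := mul_lt_mul_of_neg_right h4 h
    linarith

theorem continuousOn_classLength (a : E → ZMod 2)
    (hℓ : ∀ t ∈ Icc x y, ∀ e, 0 ≤ (ℓ + t • τ) e) :
    ContinuousOn (fun t : ℝ => G.classLength (ℓ + t • τ) a) (Icc x y) := by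
  rcases (G.minMults a).eq_empty_or_nonempty with h | h
  · simp only [classLength_of_minMults_eq_empty h]
    exact continuousOn_const
  · have : Continuous fun t : ℝ => (G.minMults a).inf' h fun m => dot m ℓ + t * dot m τ :=
      Continuous.finset_inf'_apply h fun m _ => by fun_prop
    refine this.continuousOn.congr fun t ht => ?_
    simp only [classLength_eq_inf' h (hℓ t ht), dot_add_smul]

theorem continuousOn_log_classLength (a : E → ZMod 2)
    (hℓ : ∀ t ∈ Icc x y, ∀ e, 0 ≤ (ℓ + t • τ) e)
    (hpos : ∀ t ∈ Icc x y, ∀ α, G.IsLoop α → 0 < weight (ℓ + t • τ) α) :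
    ContinuousOn (fun t : ℝ => Real.log (G.classLength (ℓ + t • τ) a)) (Icc x y) := by
  rcases (G.minMults a).eq_empty_or_nonempty with h | h
  · simp only [classLength_of_minMults_eq_empty h]
    exact continuousOn_const
  · exact (continuousOn_classLength a hℓ).log fun t ht =>
      (classLength_pos h (hℓ t ht) (hpos t ht)).ne'

/-- The class length is concave in `t`, being a minimum of affine functions, so the slopes of the
functions attaining it are antitone and hence integrable. The factor `1 / length` is continuous. -/
theorem intervalIntegrable_slope (hxy : x ≤ y) (a : E → ZMod 2)
    (hℓ : ∀ t ∈ Icc x y, ∀ e, 0 ≤ (ℓ + t • τ) e)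
    (hpos : ∀ t ∈ Icc x y, ∀ α, G.IsLoop α → 0 < weight (ℓ + t • τ) α) :
    IntervalIntegrable (fun t : ℝ => sInf (G.realizedValues (ℓ + t • τ) τ a) /
      G.classLength (ℓ + t • τ) a) MeasureTheory.volume x y := by
  rcases (G.minMults a).eq_empty_or_nonempty with h | h
  · simp only [classLength_of_minMults_eq_empty h, div_zero]
    exact intervalIntegrable_const
  have key : ∀ t ∈ Icc x y, ∃ m ∈ G.minMults a, dot m (ℓ + t • τ) = G.classLength (ℓ + t • τ) a ∧
      (t ∈ Ioo x y → sInf (G.realizedValues (ℓ + t • τ) τ a) = dot m τ) := by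
    intro t ht
    by_cases ht' : t ∈ Ioo x y
    · obtain ⟨m, h1, h2, h3, -⟩ := isLeast_realizedValues h (hℓ t ht)
        (τ := τ) fun e he => (eq_zero_of_mem_Ioo hℓ ht' he).ge
      exact ⟨m, h1, h2, fun _ => h3.csInf_eq⟩
    -- At the two end points `τ` may be negative on an edge of length zero and the infimum is not
    -- controlled. Any vector realizing the length serves for monotonicity there, and two points do
    -- not affect the integral.
    · obtain ⟨m, h1, h2⟩ := exists_minMults_dot_eq h (hℓ t ht)
      exact ⟨m, h1, h2, fun h => absurd h ht'⟩
  choose! m hm1 hm2 hm3 using key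
  have hanti : AntitoneOn (fun t => dot (m t) τ) (uIcc x y) := by
    rw [uIcc_of_le hxy]
    intro t ht t' ht' hle
    rcases hle.eq_or_lt with rfl | hlt
    · exact le_rfl
    have h1 := classLength_le_dot (hm1 t' ht') (hℓ t ht)
    have h2 := classLength_le_dot (hm1 t ht) (hℓ t' ht')
    rw [← hm2 t ht] at h1
    rw [← hm2 t' ht'] at h2
    simp only [dot_add_smul] at h1 h2
    have h3 : (t' - t) * dot (m t') τ ≤ (t' - t) * dot (m t) τ := by linarith
    exact le_of_mul_le_mul_left h3 (by linarith)
  have hcont : ContinuousOn (fun t : ℝ => (G.classLength (ℓ + t • τ) a)⁻¹) (uIcc x y) := by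
    rw [uIcc_of_le hxy]
    exact (continuousOn_classLength a hℓ).inv₀ fun t ht =>
      (classLength_pos h (hℓ t ht) (hpos t ht)).ne'
  refine (hanti.intervalIntegrable.mul_continuousOn hcont).congr_ae ?_
  rw [uIoc_of_le hxy, MeasureTheory.Measure.restrict_congr_set
    (MeasureTheory.Ioo_ae_eq_Ioc (μ := MeasureTheory.volume) (a := x) (b := y)).symm]
  filter_upwards [MeasureTheory.ae_restrict_mem measurableSet_Ioo] with t ht
  rw [hm3 t (Ioo_subset_Icc_self ht) ht, div_eq_mul_inv]

/-- Two minimal vectors of different slopes have equal length at most once; these times form the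
exceptional set. At any other interior time all minimal vectors realizing the length have one slope,
and realizing loops have the same `τ`-weight as the minimal vectors below them because `τ` vanishes
on edges of length zero. -/
theorem sSup_realizedValues_eq_sInf (a : E → ZMod 2)
    (hℓ : ∀ t ∈ Icc x y, ∀ e, 0 ≤ (ℓ + t • τ) e) :
    ∃ S : Set ℝ, S.Countable ∧ ∀ t ∈ Ioo x y \ S,
      sSup (G.realizedValues (ℓ + t • τ) τ a) = sInf (G.realizedValues (ℓ + t • τ) τ a) := by
  rcases (G.minMults a).eq_empty_or_nonempty with h | h
  · exact ⟨∅, countable_empty, fun t _ => by simp [realizedValues_of_minMults_eq_empty h]⟩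
  refine ⟨⋃ m ∈ G.minMults a, ⋃ m' ∈ G.minMults a,
    {t | dot m (ℓ + t • τ) = dot m' (ℓ + t • τ) ∧ dot m τ ≠ dot m' τ}, ?_, ?_⟩
  · refine Set.Countable.biUnion (Finset.countable_toSet _) fun m _ =>
      Set.Countable.biUnion (Finset.countable_toSet _) fun m' _ => ?_
    apply Set.Subsingleton.countable
    rintro t ⟨h1, h2⟩ t' ⟨h3, -⟩
    simp only [dot_add_smul] at h1 h3
    have h4 : (t - t') * (dot m τ - dot m' τ) = 0 := by linarith
    rcases mul_eq_zero.1 h4 with h5 | h5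
    · linarith
    · exact absurd (by linarith) h2
  · rintro t ⟨ht, hS⟩
    have hn := hℓ t (Ioo_subset_Icc_self ht)
    obtain ⟨m, h1, h2, h3, -⟩ := isLeast_realizedValues h hn
      (τ := τ) fun e he => (eq_zero_of_mem_Ioo hℓ ht he).ge
    have : G.realizedValues (ℓ + t • τ) τ a = {dot m τ} := by
      refine Set.Subset.antisymm ?_ (by simpa using h3.1)
      rintro r ⟨α, h4, rfl, h5, rfl⟩
      obtain ⟨m', h6, h7, h8, h9⟩ := exists_minMults_of_realized hn h4 h5
      have h10 : dot m' τ = dot (mult α) τ := le_antisymm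
        (dot_le_dot h7 fun e he => (eq_zero_of_mem_Ioo hℓ ht (h9 e he)).ge) (by
          refine Finset.sum_le_sum fun e _ => ?_
          by_cases he : m' e = mult α e
          · rw [he]
          · rw [eq_zero_of_mem_Ioo hℓ ht (h9 e he)]; simp)
      simp only [mem_iUnion, not_exists] at hS
      have h11 := hS m h1 m' h6
      simp only [mem_ofPred_eq, not_and, not_not] at h11
      rw [mem_singleton_iff, weight_eq_dot, ← h10, h11 (by rw [h2, h8])]
    rw [this, csSup_singleton, csInf_singleton]

end Segment

end Gr

/-! ### Double covers and the potential -/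

namespace Gr

variable {V E : Type*} {G : Gr V E}

/-- The image in the graph of a dart of a double cover. -/
def projDart (d : (E × ZMod 2) × Bool) : E × Bool := (d.1.1, d.2)

theorem dsrc_cover (c : E → ZMod 2) (d : (E × ZMod 2) × Bool) :
    ((G.cover c).dsrc d).1 = G.dsrc (projDart d) := by
  rcases d with ⟨⟨e, i⟩, _ | _⟩ <;> simp [dsrc, cover, projDart]

theorem dtgt_cover (c : E → ZMod 2) (d : (E × ZMod 2) × Bool) :
    ((G.cover c).dtgt d).1 = G.dtgt (projDart d) := by
  rcases d with ⟨⟨e, i⟩, _ | _⟩ <;> simp [dtgt, cover, projDart]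

theorem IsLoop.proj {c : E → ZMod 2} {α : Cycle ((E × ZMod 2) × Bool)}
    (h : (G.cover c).IsLoop α) : G.IsLoop (α.map projDart) := by
  refine ⟨by rw [Ne, Cycle.map_eq_nil]; exact h.1, ?_⟩
  rw [Cycle.chain_map]
  refine h.2.imp ?_
  rintro ⟨⟨e, i⟩, b⟩ ⟨⟨e', i'⟩, b'⟩ ⟨h1, h2⟩
  refine ⟨by rw [← dtgt_cover c, ← dsrc_cover c, h1], ?_⟩
  simp only [projDart]
  intro h3
  obtain ⟨rfl, rfl⟩ := Prod.mk.inj h3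
  apply h2
  -- A backtracking in the projection would be one upstairs: the common vertex determines the sheet,
  -- so both darts lie on the same lift of the edge.
  cases b <;> simp_all [dsrc, dtgt, cover]

theorem weight_lift (τ : E → ℝ) (α : Cycle ((E × ZMod 2) × Bool)) :
    weight (lift τ) α = weight τ (α.map projDart) := by
  induction α using Quotient.inductionOn with
  | _ l =>
  change weight (lift τ) (l : Cycle _) = weight τ (Cycle.map projDart (l : Cycle _))
  rw [Cycle.map_coe, weight_coe, weight_coe]
  simp [pathWeight, projDart, lift, Function.comp_def]

theorem weight_lift_pos {c : E → ZMod 2} {ℓ : E → ℝ} (h : ∀ α, G.IsLoop α → 0 < weight ℓ α)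
    (α : Cycle ((E × ZMod 2) × Bool)) (hα : (G.cover c).IsLoop α) : 0 < weight (lift ℓ) α := by
  rw [weight_lift]; exact h _ hα.proj

theorem hasDerivWithinAt_psi (n : ℕ) [Fintype V] [Fintype E] {ℓ τ : E → ℝ}
    (hℓ : ∀ e, 0 ≤ ℓ e) (hτ : ∀ e, ℓ e = 0 → 0 ≤ τ e)
    (hpos : ∀ α, G.IsLoop α → 0 < weight ℓ α) :
    HasDerivWithinAt (fun t : ℝ => G.psi n (ℓ + t • τ)) (G.normN n ℓ τ - G.normL ℓ τ)
      (Ici 0) 0 := by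
  have h1 : G.normN n ℓ τ - G.normL ℓ τ = -(1 / (numK n + 1)) * G.coverSum fun G' a =>
      sInf (G'.realizedValues (lift ℓ) (lift τ) a) / G'.classLength (lift ℓ) a := by
    simp only [normN, normWith]; ring
  rw [h1]
  unfold psi coverSum
  refine HasDerivWithinAt.const_mul _ (HasDerivWithinAt.fun_sum fun c _ =>
    HasDerivWithinAt.fun_sum fun a _ => ?_)
  exact hasDerivWithinAt_log_classLength a (fun e => hℓ e.1) (fun e => hτ e.1)
    (weight_lift_pos hpos)

end Gr

end

end OuterSp

/-! ### Invariance of the potential under collapses of forests of length zero -/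

namespace OuterSp

noncomputable section

namespace Gr

variable {V E V' E' : Type*} {G : Gr V E} {G' : Gr V' E'}

theorem zmod_two_add_self (x : ZMod 2) : x + x = 0 := by revert x; decide

theorem zmod_two_neg (x : ZMod 2) : -x = x := by revert x; decide

theorem zmod_two_sub (x y : ZMod 2) : x - y = x + y := by revert x y; decide

/-! ### Cochains mod 2 and classes of paths -/

/-- The value of a cochain on a path. -/
def cochainSum (c : E → ZMod 2) (w : List (E × Bool)) : ZMod 2 := (w.map fun d => c d.1).sum

@[simp] theorem cochainSum_nil (c : E → ZMod 2) : cochainSum c [] = 0 := rfl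

@[simp] theorem cochainSum_cons (c : E → ZMod 2) (d : E × Bool) (w : List (E × Bool)) :
    cochainSum c (d :: w) = c d.1 + cochainSum c w := by simp [cochainSum]

@[simp] theorem cochainSum_append (c : E → ZMod 2) (w w' : List (E × Bool)) :
    cochainSum c (w ++ w') = cochainSum c w + cochainSum c w' := by simp [cochainSum]

/-- The value of a cochain, as a homomorphism. -/
def cochainHom (c : E → ZMod 2) : FreeGroup E →* Multiplicative (ZMod 2) :=
  FreeGroup.lift fun e => Multiplicative.ofAdd (c e)

theorem cochainHom_mk (c : E → ZMod 2) (w : List (E × Bool)) :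
    cochainHom c (FreeGroup.mk w) = Multiplicative.ofAdd (cochainSum c w) := by
  induction w with
  | nil => rw [← FreeGroup.one_eq_mk]; simp
  | cons d w ih =>
    have h : FreeGroup.mk (d :: w) = FreeGroup.mk [d] * FreeGroup.mk w := by simp
    rw [h, map_mul, ih, cochainSum_cons, ofAdd_add]
    congr 1
    rcases d with ⟨e, _ | _⟩
    · simp only [cochainHom, FreeGroup.lift_mk, List.map_cons, List.map_nil, cond_false,
        List.prod_cons, List.prod_nil, mul_one]
      rw [← ofAdd_neg, zmod_two_neg]
    · simp [cochainHom, FreeGroup.lift_mk]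

/-- A cochain defines a homomorphism to a commutative group, which does not see conjugation. In
particular tightening a closed path keeps its class mod 2. -/
theorem cochainSum_eq_of_conj (c : E → ZMod 2) {w w' : List (E × Bool)} {u : FreeGroup E}
    (h : FreeGroup.mk w = u * FreeGroup.mk w' * u⁻¹) : cochainSum c w = cochainSum c w' := by
  have h1 := congrArg (cochainHom c) h
  rw [map_mul, map_mul, map_inv, mul_right_comm, mul_inv_cancel, one_mul, cochainHom_mk,
    cochainHom_mk] at h1
  exact Multiplicative.ofAdd.injective h1

theorem cochainSum_eq_zero (c : E → ZMod 2) {w : List (E × Bool)} (h : FreeGroup.mk w = 1) :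
    cochainSum c w = 0 :=
  cochainSum_eq_of_conj c (w' := []) (u := 1) (by rw [h, ← FreeGroup.one_eq_mk]; simp)

open Classical in
/-- The chain mod 2 of a path. -/
def pathClass (w : List (E × Bool)) (e : E) : ZMod 2 := cochainSum (Pi.single e 1) w

theorem loopClass_coe (w : List (E × Bool)) :
    loopClass (w : Cycle (E × Bool)) = pathClass w := by
  classical
  ext e
  simp only [loopClass, pathClass, Cycle.coe_toMultiset, Multiset.map_coe, Multiset.coe_count]
  induction w with
  | nil => simp
  | cons d w ih =>
    rw [cochainSum_cons, List.map_cons, List.count_cons, Nat.cast_add, ← ih, add_comm]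
    congr 1
    by_cases h : d.1 = e
    · simp [h]
    · simp [h]

/-- A closed path in a nonzero class can be tightened to a loop. -/
theorem IsPath.exists_loop {v : V} {w : List (E × Bool)} (h : G.IsPath v v w)
    (hw : pathClass w ≠ 0) {ℓ : E → ℝ} (hℓ : ∀ e, 0 ≤ ℓ e) :
    ∃ α, G.IsLoop α ∧ loopClass α = pathClass w ∧ weight ℓ α ≤ pathWeight ℓ w := by
  obtain ⟨v', u, w', -, -, h3, h4, h5⟩ := h.exists_tight
  have h6 : pathClass w = pathClass w' := by
    ext e; exact cochainSum_eq_of_conj _ h4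
  rcases h5 with rfl | h5
  · exact absurd (h6.trans (by ext; rfl)) hw
  · exact ⟨_, h5, by rw [loopClass_coe, h6], by rw [weight_coe]; exact pathWeight_sublist hℓ h3⟩

section Boundary

variable [Fintype E]

theorem boundary_add (a b : E → ZMod 2) (v : V) :
    G.boundary (a + b) v = G.boundary a v + G.boundary b v := by
  simp [boundary, add_mul, Finset.sum_add_distrib]

omit [Fintype E] in
theorem pathClass_cons (d : E × Bool) (w : List (E × Bool)) [DecidableEq E] :
    pathClass (d :: w) = Pi.single d.1 1 + pathClass w := by
  ext e
  simp only [pathClass, cochainSum_cons, Pi.add_apply]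
  congr 1
  by_cases h : d.1 = e
  · subst h; simp
  · simp [h, Ne.symm h]

open Classical in
theorem IsPath.boundary {u x : V} {w : List (E × Bool)} (h : G.IsPath u x w) (v : V) :
    G.boundary (pathClass w) v = (if x = v then 1 else 0) + (if u = v then 1 else 0) := by
  induction w generalizing u with
  | nil =>
    rw [isPath_nil.1 h, zmod_two_add_self]
    simp [Gr.boundary, pathClass]
  | cons d w ih =>
    rw [pathClass_cons, boundary_add, ih h.2, ← h.1]
    have h1 : G.boundary (Pi.single d.1 1) v =
        (if G.dtgt d = v then 1 else 0) + (if G.dsrc d = v then 1 else 0) := by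
      rw [Gr.boundary, Finset.sum_eq_single d.1]
      · rw [Pi.single_eq_same, one_mul, zmod_two_sub]
        rcases d with ⟨e, _ | _⟩
        · simp [dtgt, dsrc, add_comm]
        · simp [dtgt, dsrc]
      · intro e _ he
        rw [Pi.single_eq_of_ne he, zero_mul]
      · simp
    rw [h1]
    generalize (if G.dtgt d = v then (1 : ZMod 2) else 0) = p
    generalize (if G.dsrc d = v then (1 : ZMod 2) else 0) = q
    generalize (if x = v then (1 : ZMod 2) else 0) = r
    revert p q r
    decide

theorem IsLoop.boundary {α : Cycle (E × Bool)} (h : G.IsLoop α) (v : V) :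
    G.boundary (loopClass α) v = 0 := by
  obtain ⟨x, w, rfl, -, h2, -⟩ := h.exists_path
  rw [loopClass_coe, h2.boundary, zmod_two_add_self]

open Classical in
theorem boundary_eq_sum_darts (a : E → ZMod 2) (v : V) :
    G.boundary a v = ∑ d : E × Bool, if G.dsrc d = v then a d.1 else 0 := by
  rw [Fintype.sum_prod_type, Gr.boundary]
  refine Finset.sum_congr rfl fun e _ => ?_
  rw [Fintype.sum_bool, zmod_two_sub]
  simp only [dsrc, if_true, Bool.false_eq_true, if_false]
  split_ifs <;> simp [zmod_two_add_self]

/-- A cycle mod 2 in a forest is zero. -/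
theorem IsForest.eq_zero {Z : Set E} (hZ : G.IsForest Z) {a : E → ZMod 2}
    (ha : ∀ v, G.boundary a v = 0) (haZ : ∀ e, a e ≠ 0 → e ∈ Z) : a = 0 := by
  classical
  by_contra hne
  obtain ⟨e, he⟩ := Function.ne_iff.1 hne
  -- A dart of the support has a continuation in the support: otherwise the reversed dart would be
  -- the only contribution to the boundary at its end. Hence a nonzero cycle supports a loop.
  obtain ⟨α, h1, h2, h3⟩ := exists_cycle_of_forall_exists (R := G.Adj)
    {d : E × Bool | a d.1 ≠ 0} ⟨(e, true), he⟩ (by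
    intro d hd
    by_contra! hcon
    have h1 := ha (G.dtgt d)
    rw [boundary_eq_sum_darts, Finset.sum_eq_single (d.1, !d.2)] at h1
    · rw [if_pos (dsrc_drev d)] at h1
      exact hd h1
    · intro d' _ hd'
      split_ifs with h
      · by_contra h4
        exact hcon d' h4 ⟨h.symm, hd'⟩
      · rfl
    · simp)
  obtain ⟨d, hd, hd'⟩ := hZ α ⟨h1, h2⟩
  exact hd' (haZ _ (h3 d hd))

end Boundary

/-! ### Collapsing forests of length zero -/

/-- The collapse of a forest of length zero. -/
structure ForestCollapse (G : Gr V E) (G' : Gr V' E') (ℓ : E → ℝ) (ℓ' : E' → ℝ) where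
  vmap : V → V'
  emap : E → Option (E' × Bool)
  collapsed : ∀ e, emap e = none → vmap (G.src e) = vmap (G.tgt e) ∧ ℓ e = 0
  mapped : ∀ e d, emap e = some d → vmap (G.src e) = G'.dsrc d ∧
    vmap (G.tgt e) = G'.dtgt d ∧ ℓ e = ℓ' d.1
  bij : ∀ e', ∃! e, ∃ b, emap e = some (e', b)
  fiber : ∀ u v, vmap u = vmap v → ∃ w, G.IsPath u v w ∧ ∀ d ∈ w, emap d.1 = none
  forest : G.IsForest {e | emap e = none}

namespace ForestCollapse

variable {ℓ : E → ℝ} {ℓ' : E' → ℝ} (κ : ForestCollapse G G' ℓ ℓ')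

/-- The image of a dart. -/
def pushDart (d : E × Bool) : List (E' × Bool) :=
  (κ.emap d.1).toList.map fun d' => (d'.1, d'.2 == d.2)

/-- The image of a path. -/
def push (w : List (E × Bool)) : List (E' × Bool) := w.flatMap κ.pushDart

@[simp] theorem push_nil : κ.push [] = [] := rfl

@[simp] theorem push_cons (d : E × Bool) (w : List (E × Bool)) :
    κ.push (d :: w) = κ.pushDart d ++ κ.push w := rfl

@[simp] theorem push_append (w w' : List (E × Bool)) :
    κ.push (w ++ w') = κ.push w ++ κ.push w' := by simp [push]

theorem pushDart_none {d : E × Bool} (h : κ.emap d.1 = none) : κ.pushDart d = [] := by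
  simp [pushDart, h]

theorem pushDart_some {d : E × Bool} {d' : E' × Bool} (h : κ.emap d.1 = some d') :
    κ.pushDart d = [(d'.1, d'.2 == d.2)] := by
  simp [pushDart, h]

theorem push_collapsed {w : List (E × Bool)} (h : ∀ d ∈ w, κ.emap d.1 = none) :
    κ.push w = [] := by
  simp only [push, List.flatMap_eq_nil_iff]
  exact fun d hd => κ.pushDart_none (h d hd)

theorem isPath_pushDart (d : E × Bool) :
    G'.IsPath (κ.vmap (G.dsrc d)) (κ.vmap (G.dtgt d)) (κ.pushDart d) := by
  cases h : κ.emap d.1 with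
  | none =>
    rw [κ.pushDart_none h, isPath_nil]
    have := (κ.collapsed _ h).1
    rcases d with ⟨e, _ | _⟩
    · exact this.symm
    · exact this
  | some d' =>
    rw [κ.pushDart_some h]
    obtain ⟨h1, h2, -⟩ := κ.mapped _ _ h
    rcases d with ⟨e, _ | _⟩ <;> rcases d' with ⟨e', _ | _⟩ <;>
      simp_all [isPath_cons, isPath_nil, dsrc, dtgt]

theorem isPath_push {u v : V} {w : List (E × Bool)} (h : G.IsPath u v w) :
    G'.IsPath (κ.vmap u) (κ.vmap v) (κ.push w) := by
  induction w generalizing u with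
  | nil => rw [isPath_nil.1 h]; exact rfl
  | cons d w ih =>
    rw [← h.1]
    exact (κ.isPath_pushDart d).append (ih h.2)

theorem pathWeight_push (w : List (E × Bool)) : pathWeight ℓ' (κ.push w) = pathWeight ℓ w := by
  induction w with
  | nil => rfl
  | cons d w ih =>
    rw [push_cons, pathWeight_append, ih, pathWeight_cons]
    congr 1
    cases h : κ.emap d.1 with
    | none => rw [κ.pushDart_none h, (κ.collapsed _ h).2]; rfl
    | some d' => rw [κ.pushDart_some h, (κ.mapped _ _ h).2.2]; simp

/-- The pull back of a cochain. -/
def pull (c : E' → ZMod 2) (e : E) : ZMod 2 := (κ.emap e).elim 0 fun d => c d.1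

theorem pull_none (c : E' → ZMod 2) {e : E} (h : κ.emap e = none) : κ.pull c e = 0 := by
  simp [pull, h]

theorem pull_some (c : E' → ZMod 2) {e : E} {d : E' × Bool} (h : κ.emap e = some d) :
    κ.pull c e = c d.1 := by
  simp [pull, h]

theorem cochainSum_push (c : E' → ZMod 2) (w : List (E × Bool)) :
    cochainSum c (κ.push w) = cochainSum (κ.pull c) w := by
  induction w with
  | nil => rfl
  | cons d w ih =>
    rw [push_cons, cochainSum_append, ih, cochainSum_cons]
    congr 1
    cases h : κ.emap d.1 with
    | none => rw [κ.pushDart_none h, κ.pull_none c h]; rfl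
    | some d' => rw [κ.pushDart_some h, κ.pull_some c h]; simp

/-- The edge over an edge of the collapsed graph. -/
def pre (e' : E') : E := (κ.bij e').choose

theorem emap_pre (e' : E') : ∃ b, κ.emap (κ.pre e') = some (e', b) :=
  (κ.bij e').choose_spec.1

theorem eq_pre {e : E} {d : E' × Bool} (h : κ.emap e = some d) : e = κ.pre d.1 :=
  (κ.bij d.1).choose_spec.2 e ⟨d.2, h⟩

theorem pathClass_push (w : List (E × Bool)) (e' : E') :
    pathClass (κ.push w) e' = pathClass w (κ.pre e') := by
  classical
  rw [pathClass, cochainSum_push, pathClass]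
  congr 1
  ext e
  cases h : κ.emap e with
  | none =>
    rw [κ.pull_none _ h, Pi.single_eq_of_ne]
    rintro rfl
    obtain ⟨b, hb⟩ := κ.emap_pre e'
    rw [h] at hb
    exact absurd hb (by simp)
  | some d =>
    rw [κ.pull_some _ h]
    by_cases h1 : d.1 = e'
    · subst h1
      rw [← κ.eq_pre h]; simp
    · rw [Pi.single_eq_of_ne h1, Pi.single_eq_of_ne]
      rintro rfl
      obtain ⟨b, hb⟩ := κ.emap_pre e'
      rw [h] at hb
      exact h1 (by simpa using congrArg Prod.fst (Option.some.inj hb))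

/-- Each dart of the collapsed graph is the image of a dart. -/
theorem exists_dart (d' : E' × Bool) : ∃ d : E × Bool, κ.pushDart d = [d'] ∧
    κ.vmap (G.dsrc d) = G'.dsrc d' ∧ κ.vmap (G.dtgt d) = G'.dtgt d' ∧ d.1 = κ.pre d'.1 := by
  obtain ⟨b, hb⟩ := κ.emap_pre d'.1
  have h1 : κ.pushDart (κ.pre d'.1, b == d'.2) = [d'] := by
    rw [κ.pushDart_some (d := (κ.pre d'.1, b == d'.2)) hb]
    rcases d' with ⟨e', b'⟩
    cases b <;> cases b' <;> rfl
  have h2 := κ.isPath_pushDart (κ.pre d'.1, b == d'.2)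
  rw [h1] at h2
  exact ⟨_, h1, h2.1.symm, h2.2.symm, rfl⟩

/-- Consecutive edges lift to edges whose ends lie in a common fibre, and fibres are connected by
collapsed edges. -/
theorem exists_lift {u v : V} {w' : List (E' × Bool)}
    (h : G'.IsPath (κ.vmap u) (κ.vmap v) w') : ∃ w, G.IsPath u v w ∧ κ.push w = w' := by
  induction w' generalizing u with
  | nil =>
    obtain ⟨w, h1, h2⟩ := κ.fiber u v h
    exact ⟨w, h1, κ.push_collapsed h2⟩
  | cons d' w' ih =>
    obtain ⟨d, h1, h2, h3, -⟩ := κ.exists_dart d'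
    obtain ⟨w₁, h4, h5⟩ := κ.fiber u (G.dsrc d) (by rw [h2, h.1])
    obtain ⟨w₂, h6, h7⟩ := ih (u := G.dtgt d) (by rw [h3]; exact h.2)
    exact ⟨w₁ ++ d :: w₂, h4.append ⟨rfl, h6⟩, by
      rw [push_append, push_cons, κ.push_collapsed h5, h1, h7]; rfl⟩

variable [Fintype E] [Fintype E']

omit [Fintype E'] in
-- The sum of the two cycles is supported on the collapsed forest, so it vanishes. This is the
-- injectivity on first homology.
theorem eq_of_pre_eq {a b : E → ZMod 2} (ha : ∀ v, G.boundary a v = 0)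
    (hb : ∀ v, G.boundary b v = 0) (h : ∀ e', a (κ.pre e') = b (κ.pre e')) : a = b := by
  have h1 : a + b = 0 := by
    refine κ.forest.eq_zero (fun v => by rw [boundary_add, ha, hb, add_zero]) fun e he => ?_
    cases h2 : κ.emap e with
    | none => exact h2
    | some d =>
      refine absurd ?_ he
      rw [κ.eq_pre h2, Pi.add_apply, h, zmod_two_add_self]
  ext e
  have h2 := congrFun h1 e
  simp only [Pi.add_apply, Pi.zero_apply] at h2
  generalize a e = x at *
  generalize b e = y at *
  revert x y
  decide

omit [Fintype E'] in
/-- The pushed forward class of a loop in a nonzero class is nonzero, and contains a loop that is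
at most as long. -/
theorem exists_push_loop (hℓ' : ∀ e, 0 ≤ ℓ' e) {α : Cycle (E × Bool)} (hα : G.IsLoop α)
    (hne : loopClass α ≠ 0) : (fun e' => loopClass α (κ.pre e')) ≠ 0 ∧
      ∃ β, G'.IsLoop β ∧ loopClass β = (fun e' => loopClass α (κ.pre e')) ∧
        weight ℓ' β ≤ weight ℓ α := by
  have hb := hα.boundary
  obtain ⟨v, w, rfl, -, h2, -⟩ := hα.exists_path
  rw [loopClass_coe] at hb hne ⊢
  have h3 : (fun e' => pathClass w (κ.pre e')) = pathClass (κ.push w) := by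
    ext e'; rw [pathClass_push]
  have h4 : (fun e' => pathClass w (κ.pre e')) ≠ 0 := fun h5 =>
    hne (κ.eq_of_pre_eq hb (fun v => by simp [Gr.boundary]) fun e' => congrFun h5 e')
  refine ⟨h4, ?_⟩
  rw [h3] at h4 ⊢
  obtain ⟨β, h5, h6, h7⟩ := (κ.isPath_push h2).exists_loop h4 hℓ'
  exact ⟨β, h5, h6, by rw [weight_coe, ← κ.pathWeight_push]; exact h7⟩

omit [Fintype E] [Fintype E'] in
/-- A loop in a nonzero class of the collapsed graph comes from a loop that is at most as long. -/
theorem exists_lift_loop (hℓ : ∀ e, 0 ≤ ℓ e) {β : Cycle (E' × Bool)} (hβ : G'.IsLoop β)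
    (hne : loopClass β ≠ 0) : ∃ α, G.IsLoop α ∧ (fun e' => loopClass α (κ.pre e')) = loopClass β ∧
      loopClass α ≠ 0 ∧ weight ℓ α ≤ weight ℓ' β := by
  obtain ⟨v', w', rfl, hw', h2, -⟩ := hβ.exists_path
  rw [loopClass_coe] at hne ⊢
  obtain ⟨v, hv⟩ : ∃ v, κ.vmap v = v' := by
    cases w' with
    | nil => exact absurd rfl hw'
    | cons d' w' =>
      obtain ⟨d, -, h3, -⟩ := κ.exists_dart d'
      exact ⟨_, h3.trans h2.1⟩
  subst hv
  obtain ⟨w, h3, rfl⟩ := κ.exists_lift h2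
  have h4 : pathClass w ≠ 0 := by
    intro h4
    apply hne
    ext e'
    rw [pathClass_push, h4]; rfl
  obtain ⟨α, h5, h6, h7⟩ := h3.exists_loop h4 hℓ
  refine ⟨α, h5, ?_, by rw [h6]; exact h4, by rw [weight_coe, κ.pathWeight_push]; exact h7⟩
  ext e'
  rw [h6, pathClass_push]

omit [Fintype E] [Fintype E'] in
include κ in
theorem nonneg (hℓ' : ∀ e, 0 ≤ ℓ' e) (e : E) : 0 ≤ ℓ e := by
  cases h : κ.emap e with
  | none => rw [(κ.collapsed e h).2]
  | some d => rw [(κ.mapped e d h).2.2]; exact hℓ' _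

omit [Fintype E'] in
-- Pushing down or lifting a loop preserves its length but may spoil immersion; tightening repairs
-- this without increasing the length, so each infimum bounds the other.
theorem classLength_push (hℓ' : ∀ e, 0 ≤ ℓ' e) {α : Cycle (E × Bool)} (hα : G.IsLoop α)
    (hne : loopClass α ≠ 0) :
    G.classLength ℓ (loopClass α) = G'.classLength ℓ' fun e' => loopClass α (κ.pre e') := by
  have hℓ := κ.nonneg hℓ'
  obtain ⟨h0, β, h1, h2, -⟩ := κ.exists_push_loop hℓ' hα hne
  apply le_antisymm
  · refine le_csInf ⟨_, β, h1, h2, rfl⟩ ?_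
    rintro r ⟨β', h3, h4, rfl⟩
    obtain ⟨α', h5, h6, -, h7⟩ := κ.exists_lift_loop hℓ h3 (by rw [h4]; exact h0)
    rw [h4] at h6
    rw [κ.eq_of_pre_eq hα.boundary h5.boundary fun e' => (congrFun h6 e').symm]
    exact (classLength_le_weight hℓ h5).trans h7
  · refine le_csInf ⟨_, α, hα, rfl, rfl⟩ ?_
    rintro r ⟨α', h3, h4, rfl⟩
    obtain ⟨-, β', h5, h6, h7⟩ := κ.exists_push_loop hℓ' h3 (by rw [h4]; exact hne)
    rw [h4] at h6
    rw [← h6]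
    exact (classLength_le_weight hℓ' h5).trans h7

include κ in
-- It suffices to match the nonzero terms. Their classes contain loops, because a class without
-- loops has length `sInf ∅ = 0` and `log 0 = 0`; so only classes of loops have to be pushed and
-- lifted.
theorem sum_log_classLength (hℓ' : ∀ e, 0 ≤ ℓ' e) [Fintype (E → ZMod 2)]
    [Fintype (E' → ZMod 2)]
    [DecidablePred fun a : E → ZMod 2 => G.boundary a = 0 ∧ a ≠ 0]
    [DecidablePred fun a : E' → ZMod 2 => G'.boundary a = 0 ∧ a ≠ 0] :
    ∑ a : E → ZMod 2 with (G.boundary a = 0 ∧ a ≠ 0), Real.log (G.classLength ℓ a) =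
      ∑ a : E' → ZMod 2 with (G'.boundary a = 0 ∧ a ≠ 0), Real.log (G'.classLength ℓ' a) := by
  have hex : ∀ a : E → ZMod 2, Real.log (G.classLength ℓ a) ≠ 0 →
      ∃ α, G.IsLoop α ∧ loopClass α = a := by
    intro a ha
    by_contra! h
    exact ha (by rw [classLength_of_minMults_eq_empty (minMults_eq_empty_iff.2 h), Real.log_zero])
  have hex' : ∀ a : E' → ZMod 2, Real.log (G'.classLength ℓ' a) ≠ 0 →
      ∃ α, G'.IsLoop α ∧ loopClass α = a := by
    intro a ha
    by_contra! h
    exact ha (by rw [classLength_of_minMults_eq_empty (minMults_eq_empty_iff.2 h), Real.log_zero])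
  refine Finset.sum_bij_ne_zero (fun a _ _ e' => a (κ.pre e')) ?_ ?_ ?_ ?_
  · intro a ha ha'
    rw [Finset.mem_filter] at ha ⊢
    obtain ⟨α, h1, rfl⟩ := hex a ha'
    obtain ⟨h2, β, h3, h4, -⟩ := κ.exists_push_loop hℓ' h1 ha.2.2
    exact ⟨Finset.mem_univ _, by rw [← h4]; ext v; exact h3.boundary v, h2⟩
  · intro a ha _ b hb _ hab
    rw [Finset.mem_filter] at ha hb
    exact κ.eq_of_pre_eq (congrFun ha.2.1) (congrFun hb.2.1) (congrFun hab)
  · intro b hb hb'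
    rw [Finset.mem_filter] at hb
    obtain ⟨β, h1, rfl⟩ := hex' b hb'
    obtain ⟨α, h2, h3, h4, -⟩ := κ.exists_lift_loop (κ.nonneg hℓ') h1 hb.2.2
    refine ⟨loopClass α, ?_, ?_, h3⟩
    · rw [Finset.mem_filter]
      exact ⟨Finset.mem_univ _, by ext v; exact h2.boundary v, h4⟩
    · rw [κ.classLength_push hℓ' h2 h4, h3]
      exact hb'
  · intro a ha ha'
    rw [Finset.mem_filter] at ha
    obtain ⟨α, h1, rfl⟩ := hex a ha'
    rw [κ.classLength_push hℓ' h1 ha.2.2]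

omit [Fintype E] [Fintype E']

/-! ### Collapses and double covers -/

/-- The collapse of a double cover induced by a collapse of the graph. -/
def cover (c : E → ZMod 2) (c' : E' → ZMod 2) (f : V → ZMod 2)
    (h : ∀ e, c e = κ.pull c' e + (f (G.src e) + f (G.tgt e))) :
    ForestCollapse (G.cover c) (G'.cover c') (lift ℓ) (lift ℓ') where
  -- The cochains `c` and `κ.pull c'` differ by the coboundary of `f`, so exchanging the sheets over
  -- the vertices with `f v = 1` identifies their covers.
  vmap v := (κ.vmap v.1, v.2 + f v.1)
  -- The sheet of a lifted edge is recorded at its initial vertex. If `d` reverses the orientation,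
  -- that vertex is the image of the terminal one, whence the additional `c e.1`.
  emap e := (κ.emap e.1).map fun d =>
    ((d.1, if d.2 then e.2 + f (G.src e.1) else e.2 + c e.1 + f (G.tgt e.1)), d.2)
  collapsed := by
    rintro ⟨e, i⟩ he
    rw [Option.map_eq_none_iff] at he
    obtain ⟨h1, h2⟩ := κ.collapsed e he
    refine ⟨?_, h2⟩
    have h3 := h e
    rw [κ.pull_none _ he] at h3
    simp only [Gr.cover, h1, h3]
    congr 1
    generalize f (G.src e) = x
    generalize f (G.tgt e) = y
    generalize i = i
    revert i x y; decide
  mapped := by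
    rintro ⟨e, i⟩ d he
    rw [Option.map_eq_some_iff] at he
    obtain ⟨⟨e', b⟩, h1, rfl⟩ := he
    obtain ⟨h2, h3, h4⟩ := κ.mapped _ _ h1
    have h5 := h e
    rw [κ.pull_some _ h1] at h5
    refine ⟨?_, ?_, h4⟩ <;>
    · cases b <;> simp only [Gr.cover, dsrc, dtgt, h2, h3, h5, if_true, Bool.false_eq_true,
        if_false] <;> congr 1 <;>
      · generalize f (G.src e) = x
        generalize f (G.tgt e) = y
        generalize c' e' = z
        generalize i = i
        revert i x y z; decide
  bij := by
    rintro ⟨e', j⟩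
    obtain ⟨b, hb⟩ := κ.emap_pre e'
    refine ⟨(κ.pre e', if b then j + f (G.src (κ.pre e'))
      else j + c (κ.pre e') + f (G.tgt (κ.pre e'))), ⟨b, ?_⟩, ?_⟩
    · simp only [hb, Option.map_some, Option.some.injEq, Prod.mk.injEq, true_and, and_true]
      cases b <;> simp only [if_true, Bool.false_eq_true, if_false]
      · generalize f (G.tgt (κ.pre e')) = y
        generalize c (κ.pre e') = z
        revert j y z; decide
      · generalize f (G.src (κ.pre e')) = y
        revert j y; decide
    · rintro ⟨e, i⟩ ⟨b', hb'⟩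
      rw [Option.map_eq_some_iff] at hb'
      obtain ⟨⟨e'', b''⟩, h1, h2⟩ := hb'
      simp only [Prod.mk.injEq] at h2
      obtain ⟨⟨rfl, rfl⟩, rfl⟩ := h2
      have h3 := κ.eq_pre h1
      simp only at h3
      subst h3
      rw [hb] at h1
      simp only [Option.some.injEq, Prod.mk.injEq, true_and] at h1
      subst h1
      congr 1
      cases b <;> simp only [if_true, Bool.false_eq_true, if_false]
      · generalize f (G.tgt (κ.pre e'')) = y
        generalize c (κ.pre e'') = z
        revert i y z; decide
      · generalize f (G.src (κ.pre e'')) = y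
        revert i y; decide
  fiber := by
    have key : ∀ (w : List (E × Bool)) (u v : V) (i : ZMod 2), G.IsPath u v w →
        (∀ d ∈ w, κ.emap d.1 = none) → ∃ w', (G.cover c).IsPath (u, i) (v, i + f u + f v) w' ∧
          ∀ d ∈ w', κ.emap d.1.1 = none := by
      intro w
      induction w with
      | nil =>
        intro u v i hp _
        rw [isPath_nil] at hp
        subst hp
        refine ⟨[], ?_, by simp⟩
        rw [isPath_nil, add_assoc, zmod_two_add_self, add_zero]
      | cons d w ih =>
        intro u v i hp hd
        have h1 := h d.1
        rw [κ.pull_none _ (hd d (by simp))] at h1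
        obtain ⟨w', h2, h3⟩ := ih _ v (i + f u + f (G.dtgt d)) hp.2
          fun d' hd' => hd d' (List.mem_cons_of_mem _ hd')
        refine ⟨((d.1, if d.2 then i else i + f u + f (G.dtgt d)), d.2) :: w', ⟨?_, ?_⟩, ?_⟩
        · rw [← hp.1]
          rcases d with ⟨e, _ | _⟩
          · simp only [dsrc, dtgt, Gr.cover, Bool.false_eq_true, if_false, h1]
            congr 1
            generalize f (G.src e) = x
            generalize f (G.tgt e) = y
            generalize i = i
            revert i x y; decide
          · simp only [dsrc, Gr.cover, if_true]
        · convert h2 using 1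
          · rcases d with ⟨e, _ | _⟩
            · simp only [dtgt, Gr.cover, Bool.false_eq_true, if_false]
            · simp only [dtgt, Gr.cover, if_true, h1, ← hp.1, dsrc]
              congr 1
              ring
          · congr 1
            generalize f (G.dtgt d) = x
            generalize f u = y
            generalize f v = z
            generalize i = i
            revert i x y z; decide
        · intro d' hd'
          rcases List.mem_cons.1 hd' with rfl | hd'
          · exact hd d (by simp)
          · exact h3 d' hd'
    rintro ⟨u, i⟩ ⟨v, j⟩ huv
    obtain ⟨h1, h2⟩ := Prod.mk.inj huv
    obtain ⟨w, h3, h4⟩ := κ.fiber u v h1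
    obtain ⟨w', h5, h6⟩ := key w u v i h3 h4
    refine ⟨w', ?_, fun d hd => by rw [Option.map_eq_none_iff]; exact h6 d hd⟩
    have h7 : i + f u + f v = j := by
      rw [show i + f u = j + f v from h2, add_assoc, zmod_two_add_self, add_zero]
    rwa [h7] at h5
  forest := by
    intro α hα
    obtain ⟨d, h1, h2⟩ := κ.forest _ hα.proj
    obtain ⟨d', h3, rfl⟩ := Cycle.mem_map.1 h1
    refine ⟨d', h3, fun h4 => h2 ?_⟩
    exact Option.map_eq_none_iff.1 h4

theorem pull_add (x y : E' → ZMod 2) : κ.pull (x + y) = κ.pull x + κ.pull y := by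
  ext e
  cases h : κ.emap e <;> simp [pull, h]

theorem pull_coboundary (f : V' → ZMod 2) :
    κ.pull (G'.coboundary f) = G.coboundary (f ∘ κ.vmap) := by
  ext e
  cases h : κ.emap e with
  | none =>
    rw [κ.pull_none _ h]
    simp [coboundary, (κ.collapsed e h).1]
  | some d =>
    rw [κ.pull_some _ h]
    obtain ⟨h1, h2, -⟩ := κ.mapped e d h
    rcases d with ⟨e', _ | _⟩
    · simp only [coboundary, LinearMap.coe_mk, AddHom.coe_mk, Function.comp_apply, h1, h2, dsrc,
        dtgt, Bool.false_eq_true, if_false, zmod_two_sub, add_comm]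
    · simp only [coboundary, LinearMap.coe_mk, AddHom.coe_mk, Function.comp_apply, h1, h2, dsrc,
        dtgt, if_true]

/-- A cochain that is a coboundary after pulling back is a coboundary. -/
theorem mem_range_of_pull {x : E' → ZMod 2}
    (h : κ.pull x ∈ LinearMap.range G.coboundary) : x ∈ LinearMap.range G'.coboundary := by
  classical
  obtain ⟨f, hf⟩ := h
  have h0 : ∀ d : E × Bool, κ.pull x d.1 = f (G.dsrc d) + f (G.dtgt d) := by
    intro d
    rw [← hf]
    rcases d with ⟨e, _ | _⟩ <;> simp [coboundary, dsrc, dtgt, zmod_two_sub, add_comm]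
  have h1 : ∀ (w : List (E × Bool)) (u v : V), G.IsPath u v w →
      (∀ d ∈ w, κ.emap d.1 = none) → f u = f v := by
    intro w
    induction w with
    | nil => intro u v h _; rw [isPath_nil.1 h]
    | cons d w ih =>
      intro u v h hd
      rw [← ih _ v h.2 fun d' hd' => hd d' (List.mem_cons_of_mem _ hd'), ← h.1]
      have h2 := h0 d
      rw [κ.pull_none _ (hd d (by simp))] at h2
      generalize f (G.dsrc d) = p at *
      generalize f (G.dtgt d) = q at *
      revert p q; decide
  have h2 : ∀ u v, κ.vmap u = κ.vmap v → f u = f v := by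
    intro u v huv
    obtain ⟨w, h3, h4⟩ := κ.fiber u v huv
    exact h1 w u v h3 h4
  refine ⟨fun v' => if hv : ∃ v, κ.vmap v = v' then f hv.choose else 0, ?_⟩
  have h3 : ∀ v, (if hv : ∃ u, κ.vmap u = κ.vmap v then f hv.choose else 0) = f v := by
    intro v
    have hv : ∃ u, κ.vmap u = κ.vmap v := ⟨v, rfl⟩
    rw [dif_pos hv]
    exact h2 _ _ hv.choose_spec
  ext e'
  obtain ⟨d, h4, h5, h6, h7⟩ := κ.exists_dart (e', true)
  have h8 : G'.src e' = κ.vmap (G.dsrc d) := by rw [h5]; rfl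
  have h9 : G'.tgt e' = κ.vmap (G.dtgt d) := by rw [h6]; rfl
  simp only [coboundary, LinearMap.coe_mk, AddHom.coe_mk, h8, h9, h3]
  obtain ⟨b, hb⟩ := κ.emap_pre e'
  have h10 := h0 d
  rw [h7, κ.pull_some _ hb] at h10
  rw [h10, zmod_two_sub, add_comm]

/-- Each cochain is cohomologous to a pull back. -/
theorem exists_pull (c : E → ZMod 2) :
    ∃ x : E' → ZMod 2, κ.pull x + c ∈ LinearMap.range G.coboundary := by
  have h1 : ∀ v, ∃ u, κ.vmap u = κ.vmap v := fun v => ⟨v, rfl⟩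
  -- `r v'` picks a base vertex of the tree over `v'`; as a function on `V` it exists also over an
  -- empty fibre.
  have h2 : ∀ v' : V', ∃ r : V → V, ∀ v, κ.vmap v = v' → ∀ u, κ.vmap u = v' → r u = r v ∧
      κ.vmap (r v) = v' := by
    intro v'
    by_cases h : ∃ u, κ.vmap u = v'
    · obtain ⟨u, hu⟩ := h
      exact ⟨fun _ => u, fun v _ u' _ => ⟨rfl, hu⟩⟩
    · exact ⟨id, fun v hv => absurd ⟨v, hv⟩ h⟩
  choose r hr using h2
  have h3 : ∀ v, ∃ w, G.IsPath (r (κ.vmap v) v) v w ∧ ∀ d ∈ w, κ.emap d.1 = none := fun v =>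
    κ.fiber _ _ (hr _ v rfl v rfl).2
  choose p hp1 hp2 using h3
  -- Integrating `c` inside the trees from their base vertices gives a primitive of `c` on the
  -- forest. Adding its coboundary kills `c` on collapsed edges, so the result is a pull back.
  set f : V → ZMod 2 := fun v => cochainSum c (p v) with hf
  have h4 : ∀ e, κ.emap e = none → c e = f (G.src e) + f (G.tgt e) := by
    intro e he
    have h5 : r (κ.vmap (G.src e)) (G.src e) = r (κ.vmap (G.tgt e)) (G.tgt e) := by
      rw [(κ.collapsed e he).1]
      exact (hr _ _ rfl _ (κ.collapsed e he).1).1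
    have h6 := hp1 (G.tgt e)
    have h7 := (hp1 (G.src e)).append (isPath_singleton (G := G) (e, true))
    rw [h5] at h7
    have h8 := h7.append h6.invRev
    have h9 := κ.forest.mk_eq_one h8 (by
      intro d hd
      simp only [List.mem_append, List.mem_singleton, FreeGroup.invRev, List.mem_reverse,
        List.mem_map] at hd
      rcases hd with (hd | rfl) | ⟨d', hd', rfl⟩
      · exact hp2 _ d hd
      · exact he
      · exact hp2 _ d' hd')
    have h10 := cochainSum_eq_zero c h9
    have h11 : cochainSum c (FreeGroup.invRev (p (G.tgt e))) = f (G.tgt e) := by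
      simp [cochainSum, FreeGroup.invRev, List.sum_reverse, Function.comp_def, hf]
    rw [cochainSum_append, cochainSum_append, h11] at h10
    simp only [cochainSum_cons, cochainSum_nil, add_zero] at h10
    change f (G.src e) + c e + f (G.tgt e) = 0 at h10
    clear h11
    generalize f (G.src e) = x at *
    generalize f (G.tgt e) = y at *
    generalize c e = z at *
    revert x y z; decide
  refine ⟨fun e' => c (κ.pre e') + f (G.src (κ.pre e')) + f (G.tgt (κ.pre e')), f, ?_⟩
  ext e
  simp only [coboundary, LinearMap.coe_mk, AddHom.coe_mk, Pi.add_apply]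
  cases h : κ.emap e with
  | none =>
    rw [κ.pull_none _ h, h4 e h, zero_add, zmod_two_sub, add_comm]
  | some d =>
    rw [κ.pull_some _ h, ← κ.eq_pre h]
    generalize f (G.src e) = x at *
    generalize f (G.tgt e) = y at *
    generalize c e = z at *
    revert x y z; decide

theorem mk_pull_eq_iff {x y : E' → ZMod 2} :
    (Submodule.Quotient.mk (κ.pull x) : G.Coh) = Submodule.Quotient.mk (κ.pull y) ↔
      (Submodule.Quotient.mk x : G'.Coh) = Submodule.Quotient.mk y := by
  have h1 : κ.pull x - κ.pull y = κ.pull (x + y) := by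
    rw [pull_add]; ext; exact zmod_two_sub _ _
  have h2 : x - y = x + y := by ext; exact zmod_two_sub _ _
  rw [Submodule.Quotient.eq, Submodule.Quotient.eq, h1, h2]
  refine ⟨κ.mem_range_of_pull, ?_⟩
  rintro ⟨f, hf⟩
  exact ⟨f ∘ κ.vmap, by rw [← hf, pull_coboundary]⟩

include κ in
/-- The potential does not change when a forest of length zero is collapsed. -/
theorem psi_eq (n : ℕ) [Fintype V] [Fintype E] [Fintype V'] [Fintype E'] (hℓ' : ∀ e, 0 ≤ ℓ' e) :
    G.psi n ℓ = G'.psi n ℓ' := by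
  classical
  unfold psi
  congr 1
  unfold coverSum
  symm
  have hout : ∀ c : G.Coh, (Submodule.Quotient.mk (Quotient.out c) : G.Coh) = c :=
    fun c => Quotient.out_eq c
  have hout' : ∀ c : G'.Coh, (Submodule.Quotient.mk (Quotient.out c) : G'.Coh) = c :=
    fun c => Quotient.out_eq c
  have h0 : (Submodule.Quotient.mk (κ.pull 0) : G.Coh) = 0 := by
    have : κ.pull 0 = 0 := by ext e; cases h : κ.emap e <;> simp [pull, h]
    rw [this]; rfl
  refine Finset.sum_bij (fun c _ => Submodule.Quotient.mk (κ.pull (Quotient.out c))) ?_ ?_ ?_ ?_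
  · intro c hc
    rw [Finset.mem_filter] at hc ⊢
    refine ⟨Finset.mem_univ _, fun h => hc.2 ?_⟩
    rw [← h0, κ.mk_pull_eq_iff] at h
    rw [← hout' c, h]; rfl
  · intro c _ c' _ h
    rw [κ.mk_pull_eq_iff] at h
    rw [← hout' c, h, hout']
  · intro c hc
    rw [Finset.mem_filter] at hc
    obtain ⟨x, hx⟩ := κ.exists_pull (Quotient.out c)
    have h1 : (Submodule.Quotient.mk (κ.pull x) : G.Coh) = c := by
      rw [← hout c, Submodule.Quotient.eq]
      convert hx using 1
      ext; exact zmod_two_sub _ _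
    have h2 : (Submodule.Quotient.mk (κ.pull (Quotient.out
        (Submodule.Quotient.mk x : G'.Coh))) : G.Coh) = c := by
      rw [← h1, κ.mk_pull_eq_iff, hout']
    refine ⟨Submodule.Quotient.mk x, ?_, h2⟩
    rw [Finset.mem_filter]
    refine ⟨Finset.mem_univ _, fun h => hc.2 ?_⟩
    rw [← h1, ← h0, κ.mk_pull_eq_iff, h]; rfl
  · intro c hc
    symm
    have h1 : (Submodule.Quotient.mk (Quotient.out (Submodule.Quotient.mk
        (κ.pull (Quotient.out c)) : G.Coh)) : G.Coh) =
        Submodule.Quotient.mk (κ.pull (Quotient.out c)) := hout _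
    rw [Submodule.Quotient.eq] at h1
    obtain ⟨f, hf⟩ := h1
    -- The cochain chosen for the pulled back class differs from the pull back by the coboundary of
    -- `f`, which is the datum needed to collapse the cover.
    refine (κ.cover _ (Quotient.out c) f fun e => ?_).sum_log_classLength fun e => hℓ' e.1
    have h2 := congrFun hf e
    simp only [coboundary, LinearMap.coe_mk, AddHom.coe_mk, Pi.sub_apply] at h2
    have h3 : ∀ x y z u : ZMod 2, y - x = u - z → u = z + (x + y) := by decide
    exact h3 _ _ _ _ h2

end ForestCollapse

end Gr

/-- The underlying collapse of graphs of a collapse of marked graphs. -/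
def Collapse.toForestCollapse {n : ℕ} {X Y : MarkedMetricGraph n} (κ : Collapse X Y) :
    Gr.ForestCollapse X.G Y.G X.ℓ Y.ℓ where
  vmap := κ.vmap
  emap := κ.emap
  collapsed := κ.collapsed
  mapped := κ.mapped
  bij := κ.bij
  fiber := κ.fiber
  forest := fun α hα => by
    obtain ⟨d, h1, h2⟩ := X.isMetric.forest α hα
    exact ⟨d, h1, fun h => h2 (κ.collapsed _ h).2⟩

theorem Psi_pt {n : ℕ} (X : MarkedMetricGraph n) : Psi X.pt = X.G.psi n X.ℓ := by
  let F : OuterSpace n → ℝ := Quot.lift (fun X : MarkedMetricGraph n => X.G.psi n X.ℓ) (by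
    rintro X Y ⟨κ⟩
    exact κ.toForestCollapse.psi_eq n Y.isMetric.nonneg)
  exact congrArg F (Quot.out_eq X.pt)

end

end OuterSp

/-! ### Homotopy classes and lengths of paths between points; composition of Lipschitz maps -/

namespace OuterSp

noncomputable section

namespace Gr

variable {V E : Type*} {G : Gr V E}

/-! ### Paths between points of a graph -/

theorem mk_singleton_true (e : E) : FreeGroup.mk [(e, true)] = FreeGroup.of e := rfl

theorem mk_singleton_false (e : E) : FreeGroup.mk [(e, false)] = (FreeGroup.of e)⁻¹ := rfl

theorem mk_cons (d : E × Bool) (w : List (E × Bool)) :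
    FreeGroup.mk (d :: w) = FreeGroup.mk [d] * FreeGroup.mk w := by simp

theorem mk_append (w w' : List (E × Bool)) :
    FreeGroup.mk (w ++ w') = FreeGroup.mk w * FreeGroup.mk w' := by simp

theorem mk_nil : FreeGroup.mk ([] : List (E × Bool)) = 1 := FreeGroup.one_eq_mk.symm

theorem legWord_cross (p : Point E) (b : Bool) :
    (legWord p b)⁻¹ * legWord p (!b) = FreeGroup.mk [(p.edge, !b)] := by
  cases b
  · simp [legWord, mk_singleton_true]
  · simp [legWord, mk_singleton_false]

theorem isPath_cross (p : Point E) (b : Bool) :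
    G.IsPath (G.legEnd p b) (G.legEnd p !b) [(p.edge, !b)] := by
  cases b <;> exact ⟨rfl, rfl⟩

theorem legLength_add (ℓ : E → ℝ) (p : Point E) (b : Bool) :
    legLength ℓ p b + legLength ℓ p (!b) = ℓ p.edge := by
  cases b <;> simp [legLength] <;> ring

theorem legLength_nonneg {ℓ : E → ℝ} (hℓ : ∀ e, 0 ≤ ℓ e) (p : Point E) (b : Bool) :
    0 ≤ legLength ℓ p b := by
  have h1 := p.mem.1
  have h2 := p.mem.2
  refine mul_nonneg ?_ (hℓ _)
  split_ifs <;> linarith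

/-- The path inside the edge of `p` from its initial vertex to one of its ends. -/
theorem exists_isPath_legWord (p : Point E) (b : Bool) :
    ∃ w, G.IsPath (G.src p.edge) (G.legEnd p b) w ∧ legWord p b = FreeGroup.mk w := by
  cases b
  · exact ⟨[], rfl, mk_nil.symm⟩
  · exact ⟨[(p.edge, true)], ⟨rfl, rfl⟩, rfl⟩

variable (G) in
/-- There is a path from `p` to `q` of length at most `L` in the homotopy class `g`. -/
def Reach (ℓ : E → ℝ) (p q : Point E) (g : FreeGroup E) (L : ℝ) : Prop :=
  ∃ L' ≤ L, G.HasPath ℓ p q g L'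

section Reach

variable {ℓ : E → ℝ} {p q r : Point E} {g g' : FreeGroup E} {L L' : ℝ}

theorem HasPath.reach (h : G.HasPath ℓ p q g L) : G.Reach ℓ p q g L := ⟨L, le_rfl, h⟩

theorem Reach.mono (h : G.Reach ℓ p q g L) (hL : L ≤ L') : G.Reach ℓ p q g L' := by
  obtain ⟨K, h1, h2⟩ := h
  exact ⟨K, h1.trans hL, h2⟩

theorem reach_edge (h : p.edge = q.edge) : G.Reach ℓ p q 1 (|p.pos - q.pos| * ℓ p.edge) :=
  HasPath.reach (Or.inl ⟨h, rfl, rfl⟩)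

theorem reach_refl (p : Point E) : G.Reach ℓ p p 1 0 := by simpa using reach_edge (G := G) rfl

theorem reach_legs {b b' : Bool} {w : List (E × Bool)}
    (h : G.IsPath (G.legEnd p b) (G.legEnd q b') w) :
    G.Reach ℓ p q (legWord p b * FreeGroup.mk w * (legWord q b')⁻¹)
      (legLength ℓ p b + pathWeight ℓ w + legLength ℓ q b') :=
  HasPath.reach (Or.inr ⟨b, b', w, h, rfl, rfl⟩)

theorem HasPath.nonneg (hℓ : ∀ e, 0 ≤ ℓ e) (h : G.HasPath ℓ p q g L) : 0 ≤ L := by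
  rcases h with ⟨-, -, rfl⟩ | ⟨b, b', w, -, -, rfl⟩
  · exact mul_nonneg (abs_nonneg _) (hℓ _)
  · have h1 := legLength_nonneg hℓ p b
    have h2 := legLength_nonneg hℓ q b'
    have h3 : 0 ≤ (w.map fun d => ℓ d.1).sum := pathWeight_nonneg hℓ w
    linarith

theorem HasPath.symm (h : G.HasPath ℓ p q g L) : G.HasPath ℓ q p g⁻¹ L := by
  rcases h with ⟨h1, rfl, rfl⟩ | ⟨b, b', w, h1, rfl, rfl⟩
  · exact Or.inl ⟨h1.symm, inv_one, by rw [abs_sub_comm, h1]⟩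
  · refine Or.inr ⟨b', b, FreeGroup.invRev w, h1.invRev, ?_, ?_⟩
    · rw [← FreeGroup.inv_mk]; group
    · have := pathWeight_invRev ℓ w
      unfold pathWeight at this
      rw [this]; ring

theorem Reach.symm (h : G.Reach ℓ p q g L) : G.Reach ℓ q p g⁻¹ L := by
  obtain ⟨K, h1, h2⟩ := h
  exact ⟨K, h1, h2.symm⟩

theorem legLength_le (hℓ : ∀ e, 0 ≤ ℓ e) (h : p.edge = q.edge) (b : Bool) :
    legLength ℓ p b ≤ |p.pos - q.pos| * ℓ p.edge + legLength ℓ q b := by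
  have h1 := abs_le.1 (le_refl |p.pos - q.pos|)
  unfold legLength
  rw [← h, ← add_mul]
  refine mul_le_mul_of_nonneg_right ?_ (hℓ _)
  split_ifs <;> linarith

theorem legEnd_congr (h : p.edge = q.edge) (b : Bool) : G.legEnd p b = G.legEnd q b := by
  simp [legEnd, h]

theorem legWord_congr (h : p.edge = q.edge) (b : Bool) : legWord p b = legWord q b := by
  simp [legWord, h]

/-- Classes multiply because they are recorded between initial vertices. If the second path leaves
`q` through the end by which the first entered, the detour to `q` is dropped, so lengths only
satisfy an inequality; otherwise the two legs at `q` make up its whole edge. -/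
theorem Reach.trans (hℓ : ∀ e, 0 ≤ ℓ e) (h : G.Reach ℓ p q g L) (h' : G.Reach ℓ q r g' L') :
    G.Reach ℓ p r (g * g') (L + L') := by
  obtain ⟨K, hK, h⟩ := h
  obtain ⟨K', hK', h'⟩ := h'
  suffices G.Reach ℓ p r (g * g') (K + K') from this.mono (by linarith)
  rcases h with ⟨h1, rfl, rfl⟩ | ⟨b, b', w, h1, rfl, rfl⟩
  · rcases h' with ⟨h2, rfl, rfl⟩ | ⟨c, c', w', h2, rfl, rfl⟩
    · rw [one_mul]
      refine (reach_edge (h1.trans h2)).mono ?_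
      rw [← h1, ← add_mul]
      exact mul_le_mul_of_nonneg_right (abs_sub_le _ _ _) (hℓ _)
    · rw [← legEnd_congr h1] at h2
      rw [one_mul, ← legWord_congr h1]
      refine (reach_legs h2).mono ?_
      have := legLength_le hℓ h1 c
      unfold pathWeight
      linarith
  · rcases h' with ⟨h2, rfl, rfl⟩ | ⟨c, c', w', h2, rfl, rfl⟩
    · rw [legEnd_congr h2] at h1
      rw [mul_one, legWord_congr h2]
      refine (reach_legs h1).mono ?_
      have := legLength_le hℓ h2.symm b'
      rw [abs_sub_comm, ← h2] at this
      unfold pathWeight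
      linarith
    · by_cases hbc : c = b'
      · subst hbc
        have h3 := reach_legs (ℓ := ℓ) (h1.append h2)
        rw [mk_append] at h3
        have e : legWord p b * (FreeGroup.mk w * FreeGroup.mk w') * (legWord r c')⁻¹ =
            legWord p b * FreeGroup.mk w * (legWord q c)⁻¹ *
              (legWord q c * FreeGroup.mk w' * (legWord r c')⁻¹) := by group
        rw [e] at h3
        refine h3.mono ?_
        have := legLength_nonneg hℓ q c
        rw [pathWeight_append]
        unfold pathWeight
        linarith
      · have hc : c = !b' := by cases b' <;> cases c <;> simp_all
        subst hc
        have h3 := reach_legs (ℓ := ℓ) ((h1.append (isPath_cross q b')).append h2)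
        rw [mk_append, mk_append, ← legWord_cross] at h3
        have e : legWord p b * (FreeGroup.mk w * ((legWord q b')⁻¹ * legWord q (!b')) *
              FreeGroup.mk w') * (legWord r c')⁻¹ =
            legWord p b * FreeGroup.mk w * (legWord q b')⁻¹ *
              (legWord q (!b') * FreeGroup.mk w' * (legWord r c')⁻¹) := by group
        rw [e] at h3
        refine h3.mono ?_
        have := legLength_add ℓ q b'
        rw [pathWeight_append, pathWeight_append, pathWeight_cons, pathWeight_nil]
        unfold pathWeight
        linarith

theorem HasPath.exists_isPath (h : G.HasPath ℓ p q g L) :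
    ∃ w, G.IsPath (G.src p.edge) (G.src q.edge) w ∧ g = FreeGroup.mk w := by
  rcases h with ⟨h1, rfl, -⟩ | ⟨b, b', w, h1, rfl, -⟩
  · exact ⟨[], by rw [isPath_nil, h1], mk_nil.symm⟩
  · obtain ⟨u, h2, h3⟩ := exists_isPath_legWord (G := G) p b
    obtain ⟨u', h4, h5⟩ := exists_isPath_legWord (G := G) q b'
    refine ⟨u ++ w ++ FreeGroup.invRev u', (h2.append h1).append h4.invRev, ?_⟩
    rw [mk_append, mk_append, h3, h5, FreeGroup.inv_mk]

/-! ### Parametrizing paths by arc length -/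

variable (G) in
/-- A path from `p` to `q` in the class `g`, parametrized by arc length. -/
def Trace (ℓ : E → ℝ) (p q : Point E) (g : FreeGroup E) (L : ℝ) : Prop :=
  ∃ (x : ℝ → Point E) (h : ℝ → FreeGroup E), G.Reach ℓ p (x 0) (h 0) 0 ∧
    G.Reach ℓ (x L) q ((h L)⁻¹ * g) 0 ∧
    ∀ s t, 0 ≤ s → s ≤ t → t ≤ L → G.Reach ℓ (x s) (x t) ((h s)⁻¹ * h t) (t - s)

theorem Reach.trace_zero (h : G.Reach ℓ p q g 0) : G.Trace ℓ p q g 0 := by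
  refine ⟨fun _ => p, fun _ => 1, reach_refl p, by simpa using h, ?_⟩
  intro s t h1 h2 h3
  simpa using (reach_refl p).mono (by linarith : (0 : ℝ) ≤ t - s)

theorem Trace.trans (hℓ : ∀ e, 0 ≤ ℓ e) (hL : 0 ≤ L) (hL' : 0 ≤ L') (h : G.Trace ℓ p q g L)
    (h' : G.Trace ℓ q r g' L') : G.Trace ℓ p r (g * g') (L + L') := by
  obtain ⟨x, k, h1, h2, h3⟩ := h
  obtain ⟨y, l, h4, h5, h6⟩ := h'
  have hmid : ∀ s t, 0 ≤ s → s ≤ L → 0 ≤ t → t ≤ L' →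
      G.Reach ℓ (x s) (y t) ((k s)⁻¹ * (g * l t)) (L - s + t) := by
    intro s t hs hs' ht ht'
    have := ((h3 s L hs hs' le_rfl).trans hℓ h2).trans hℓ (h4.trans hℓ (h6 0 t le_rfl ht ht'))
    convert this using 1
    · group
    · ring
  refine ⟨fun s => if s ≤ L then x s else y (s - L), fun s => if s ≤ L then k s else g * l (s - L),
    ?_, ?_, ?_⟩
  · simpa [hL] using h1
  -- When `L' = 0` the parameter `L + L'` still falls in the first branch, so the end point is
  -- reached through `q`.
  · by_cases h0 : L' = 0
    · subst h0
      simp only [add_zero, le_refl, if_true]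
      have := (h2.trans hℓ h4).trans hℓ h5
      convert this using 1
      · group
      · ring
    · have h7 : ¬ (L + L' ≤ L) := by
        have := lt_of_le_of_ne hL' (Ne.symm h0)
        linarith
      simp only [h7, if_false, add_sub_cancel_left]
      convert h5 using 1
      group
  · intro s t hs hst ht
    by_cases h7 : t ≤ L
    · have h8 : s ≤ L := hst.trans h7
      simp only [h7, h8, if_true]
      exact h3 s t hs hst h7
    · by_cases h8 : s ≤ L
      · simp only [h7, h8, if_true, if_false]
        have := hmid s (t - L) hs h8 (by linarith) (by linarith)
        convert this using 1
        ring
      · simp only [h7, h8, if_false]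
        have := h6 (s - L) (t - L) (by linarith) (by linarith) (by linarith)
        convert this using 1
        · group
        · ring

theorem trace_edge (hℓ : ∀ e, 0 ≤ ℓ e) (h : p.edge = q.edge) :
    G.Trace ℓ p q 1 (|p.pos - q.pos| * ℓ p.edge) := by
  set L := |p.pos - q.pos| * ℓ p.edge with hL
  have hL0 : 0 ≤ L := mul_nonneg (abs_nonneg _) (hℓ _)
  rcases hL0.eq_or_lt with h0 | h0
  · rw [← h0]
    apply Reach.trace_zero
    rw [h0]
    exact reach_edge h
  have hx : ∀ s : ℝ, ∃ x : Point E, x.edge = p.edge ∧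
      (s ∈ Icc 0 L → x.pos = p.pos + (q.pos - p.pos) * (s / L)) := by
    intro s
    by_cases hs : s ∈ Icc 0 L
    · have h1 : 0 ≤ s / L := div_nonneg hs.1 hL0
      have h2 : s / L ≤ 1 := (div_le_one h0).2 hs.2
      refine ⟨⟨p.edge, p.pos + (q.pos - p.pos) * (s / L), ?_⟩, rfl, fun _ => rfl⟩
      have h3 := p.mem
      have h4 := q.mem
      have := (convex_Icc (0 : ℝ) 1) h3 h4 (sub_nonneg.2 h2) h1 (by ring)
      convert this using 1
      simp only [smul_eq_mul]; ring
    · exact ⟨p, rfl, fun h => absurd h hs⟩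
  choose x hx1 hx2 using hx
  refine ⟨x, fun _ => 1, ?_, ?_, ?_⟩
  · refine (reach_edge (hx1 0).symm).mono ?_
    rw [hx2 0 ⟨le_rfl, hL0⟩]; simp
  · rw [mul_one, inv_one]
    refine (reach_edge ((hx1 L).trans h)).mono ?_
    rw [hx2 L ⟨hL0, le_rfl⟩, div_self h0.ne']; simp
  · intro s t h1 h2 h3
    rw [mul_one, inv_one]
    refine (reach_edge ((hx1 s).trans (hx1 t).symm)).mono ?_
    rw [hx2 s ⟨h1, h2.trans h3⟩, hx2 t ⟨h1.trans h2, h3⟩, hx1 s]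
    have e : p.pos + (q.pos - p.pos) * (s / L) - (p.pos + (q.pos - p.pos) * (t / L)) =
        (p.pos - q.pos) * ((t - s) / L) := by ring
    rw [e, abs_mul, abs_of_nonneg (div_nonneg (sub_nonneg.2 h2) hL0), mul_right_comm, ← hL,
      mul_div_cancel₀ _ h0.ne']

/-- An end of an edge, as a point. -/
def endPt (e : E) (b : Bool) : Point E where
  edge := e
  pos := if b then 1 else 0
  mem := by split_ifs <;> simp

@[simp] theorem legLength_endPt (ℓ : E → ℝ) (e : E) (b : Bool) :
    legLength ℓ (endPt e b) b = 0 := by cases b <;> simp [legLength, endPt]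

theorem legEnd_endPt (d : E × Bool) (p : Point E) (hp : p.edge = d.1) :
    G.legEnd p d.2 = G.dtgt d := by
  rcases d with ⟨e, _ | _⟩ <;> simp_all [legEnd, dtgt]

theorem legEnd_endPt_not (d : E × Bool) (p : Point E) (hp : p.edge = d.1) :
    G.legEnd p (!d.2) = G.dsrc d := by
  rcases d with ⟨e, _ | _⟩ <;> simp_all [legEnd, dsrc]

theorem trace_path (hℓ : ∀ e, 0 ≤ ℓ e) (w : List (E × Bool)) (e e' : E) (b b' : Bool)
    (h : G.IsPath (G.legEnd (endPt e b) b) (G.legEnd (endPt e' b') b') w) :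
    G.Trace ℓ (endPt e b) (endPt e' b')
      (legWord (endPt e b) b * FreeGroup.mk w * (legWord (endPt e' b') b')⁻¹)
      (pathWeight ℓ w) := by
  induction w generalizing e b with
  | nil =>
    apply Reach.trace_zero
    simpa using reach_legs (ℓ := ℓ) h
  | cons d w ih =>
    have h1 : G.Trace ℓ (endPt e b) (endPt d.1 !d.2)
        (legWord (endPt e b) b * (legWord (endPt d.1 !d.2) !d.2)⁻¹) 0 := by
      apply Reach.trace_zero
      have h2 : G.IsPath (G.legEnd (endPt e b) b) (G.legEnd (endPt d.1 !d.2) !d.2) [] := by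
        rw [isPath_nil, ← h.1, legEnd_endPt_not d _ rfl]
      simpa [mk_nil] using reach_legs (ℓ := ℓ) h2
    have h2 : G.Trace ℓ (endPt d.1 !d.2) (endPt d.1 d.2) 1 (ℓ d.1) := by
      have := trace_edge (G := G) (p := endPt d.1 !d.2) (q := endPt d.1 d.2) hℓ rfl
      convert this using 1
      cases d.2 <;> simp [endPt]
    have h3 := ih d.1 d.2 (by rw [legEnd_endPt d _ rfl]; exact h.2)
    have h4 := (h1.trans hℓ le_rfl (hℓ _) h2).trans hℓ (by simpa using hℓ d.1)
      (pathWeight_nonneg hℓ w) h3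
    have e1 := legWord_cross (endPt d.1 !d.2) (!d.2)
    rw [Bool.not_not] at e1
    rw [legWord_congr (p := endPt d.1 d.2) (q := endPt d.1 !d.2) rfl d.2] at h4
    convert h4 using 1
    · rw [mk_cons]
      have e2 : FreeGroup.mk [d] = (legWord (endPt d.1 !d.2) !d.2)⁻¹ *
        legWord (endPt d.1 !d.2) d.2 := e1.symm
      rw [e2]
      group
    · simp

theorem HasPath.trace (hℓ : ∀ e, 0 ≤ ℓ e) (h : G.HasPath ℓ p q g L) : G.Trace ℓ p q g L := by
  rcases h with ⟨h1, rfl, rfl⟩ | ⟨b, b', w, h1, rfl, rfl⟩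
  · exact trace_edge hℓ h1
  · have h2 : ∀ (p : Point E) (b : Bool), G.Trace ℓ p (endPt p.edge b) 1 (legLength ℓ p b) := by
      intro p b
      have := trace_edge (G := G) (p := p) (q := endPt p.edge b) hℓ rfl
      convert this using 1
      unfold legLength
      congr 1
      have h3 := p.mem.1
      have h4 := p.mem.2
      cases b
      · simp [endPt, abs_of_nonneg h3]
      · simp only [endPt, if_true]; rw [abs_sub_comm, abs_of_nonneg (by linarith)]
    have h2' : ∀ (p : Point E) (b : Bool), G.Trace ℓ (endPt p.edge b) p 1 (legLength ℓ p b) := by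
      intro p b
      have := trace_edge (G := G) (p := endPt p.edge b) (q := p) hℓ rfl
      convert this using 1
      unfold legLength
      congr 1
      have h3 := p.mem.1
      have h4 := p.mem.2
      cases b
      · simp [endPt, abs_of_nonneg h3]
      · simp only [endPt, if_true]; rw [abs_of_nonneg (by linarith)]
    have h3 := trace_path (G := G) hℓ w p.edge q.edge b b'
      h1
    have h4 := ((h2 p b).trans hℓ (legLength_nonneg hℓ _ _) (pathWeight_nonneg hℓ w) h3).trans hℓ
      (add_nonneg (legLength_nonneg hℓ _ _) (pathWeight_nonneg hℓ w)) (legLength_nonneg hℓ _ _)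
      (h2' q b')
    rw [one_mul, mul_one] at h4
    exact h4

end Reach

/-- Changing a homomorphism on edges by a function of the vertices. -/
theorem lift_mk_conj {H : Type*} [Group H] (f f' : E → H) (k : V → H)
    (h : ∀ e, f' e = (k (G.src e))⁻¹ * f e * k (G.tgt e)) {u v : V} {w : List (E × Bool)}
    (hw : G.IsPath u v w) :
    FreeGroup.lift f' (FreeGroup.mk w) = (k u)⁻¹ * FreeGroup.lift f (FreeGroup.mk w) * k v := by
  induction w generalizing u with
  | nil => rw [isPath_nil.1 hw, mk_nil]; simp
  | cons d w ih =>
    rw [mk_cons, map_mul, map_mul, ih hw.2, ← hw.1]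
    have : FreeGroup.lift f' (FreeGroup.mk [d]) =
        (k (G.dsrc d))⁻¹ * FreeGroup.lift f (FreeGroup.mk [d]) * k (G.dtgt d) := by
      rcases d with ⟨e, _ | _⟩
      · rw [mk_singleton_false, map_inv, map_inv, FreeGroup.lift_apply_of, FreeGroup.lift_apply_of,
          h]
        simp only [dsrc, dtgt, Bool.false_eq_true, if_false]
        group
      · rw [mk_singleton_true, FreeGroup.lift_apply_of, FreeGroup.lift_apply_of, h]
        simp [dsrc, dtgt]
    rw [this]
    group

end Gr

/-! ### Composition of differences of markings -/

section Comp

open Gr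

variable {n : ℕ} {X Y Z : MarkedMetricGraph n}

theorem DiffOfMarkings.len_nonneg (φ : DiffOfMarkings X Y) (e : X.E) : 0 ≤ φ.len e :=
  (φ.path e).nonneg Y.isMetric.nonneg

theorem DiffOfMarkings.reach_path (φ : DiffOfMarkings X Y) {lam : ℝ}
    (hφ : ∀ e, φ.len e ≤ lam * X.ℓ e) {u v : X.V} {w : List (X.E × Bool)}
    (hw : X.G.IsPath u v w) :
    Y.G.Reach Y.ℓ (φ.vert u) (φ.vert v) (FreeGroup.lift φ.cls (FreeGroup.mk w))
      (lam * pathWeight X.ℓ w) := by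
  induction w generalizing u with
  | nil =>
    rw [isPath_nil.1 hw, mk_nil, map_one, pathWeight_nil, mul_zero]
    exact reach_refl _
  | cons d w ih =>
    rw [mk_cons, map_mul, pathWeight_cons, mul_add]
    refine Reach.trans Y.isMetric.nonneg ?_ (ih hw.2)
    rw [← hw.1]
    refine Reach.mono ?_ (hφ d.1)
    rcases d with ⟨e, _ | _⟩
    · rw [mk_singleton_false, map_inv, FreeGroup.lift_apply_of]
      exact (φ.path e).reach.symm
    · rw [mk_singleton_true, FreeGroup.lift_apply_of]
      exact (φ.path e).reach

/-- A difference of markings extends to the points of the graph. -/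
theorem DiffOfMarkings.exists_extension (φ : DiffOfMarkings X Y) {lam : ℝ}
    (hφ : ∀ e, φ.len e ≤ lam * X.ℓ e) :
    ∃ (x : Point X.E → Point Y.E) (h : Point X.E → FreeGroup Y.E),
      (∀ p, ∃ w, Y.G.IsPath (Y.G.src (φ.vert (X.G.src p.edge)).edge) (Y.G.src (x p).edge) w ∧
        h p = FreeGroup.mk w) ∧
      ∀ p q g L, X.G.HasPath X.ℓ p q g L →
        Y.G.Reach Y.ℓ (x p) (x q) ((h p)⁻¹ * FreeGroup.lift φ.cls g * h q) (lam * L) := by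
  have hY := Y.isMetric.nonneg
  -- `x e s` is the point at arc length `s` on the image of `e`. A point `p` goes to parameter
  -- `p.pos * φ.len p.edge`, and `h` records the class of the part of the image already run through.
  choose x h h1 h2 h3 using fun e => (φ.path e).trace hY
  have hmem : ∀ p : Point X.E, 0 ≤ p.pos * φ.len p.edge ∧ p.pos * φ.len p.edge ≤ φ.len p.edge :=
    fun p => ⟨mul_nonneg p.mem.1 (φ.len_nonneg _),
      mul_le_of_le_one_left (φ.len_nonneg _) p.mem.2⟩
  have h4 : ∀ p : Point X.E, Y.G.Reach Y.ℓ (φ.vert (X.G.src p.edge))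
      (x p.edge (p.pos * φ.len p.edge)) (h p.edge (p.pos * φ.len p.edge))
      (p.pos * φ.len p.edge) := by
    intro p
    have := (h1 p.edge).trans hY (h3 p.edge 0 _ le_rfl (hmem p).1 (hmem p).2)
    convert this using 1
    · group
    · ring
  have h5 : ∀ p : Point X.E, Y.G.Reach Y.ℓ (x p.edge (p.pos * φ.len p.edge))
      (φ.vert (X.G.tgt p.edge)) ((h p.edge (p.pos * φ.len p.edge))⁻¹ * φ.cls p.edge)
      ((1 - p.pos) * φ.len p.edge) := by
    intro p
    have := (h3 p.edge _ _ (hmem p).1 (hmem p).2 le_rfl).trans hY (h2 p.edge)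
    convert this using 1
    · group
    · ring
  have hleg : ∀ (p : Point X.E) (b : Bool), Y.G.Reach Y.ℓ (x p.edge (p.pos * φ.len p.edge))
      (φ.vert (X.G.legEnd p b))
      ((h p.edge (p.pos * φ.len p.edge))⁻¹ * FreeGroup.lift φ.cls (legWord p b))
      (lam * legLength X.ℓ p b) := by
    intro p b
    cases b
    · have := (h4 p).symm
      simp only [legEnd, legWord, legLength, Bool.false_eq_true, if_false, map_one, mul_one]
      refine this.mono ?_
      have := mul_le_mul_of_nonneg_left (hφ p.edge) p.mem.1
      linarith
    · have := h5 p
      simp only [legEnd, legWord, legLength, if_true, FreeGroup.lift_apply_of]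
      refine this.mono ?_
      have := mul_le_mul_of_nonneg_left (hφ p.edge) (sub_nonneg.2 p.mem.2)
      linarith
  refine ⟨fun p => x p.edge (p.pos * φ.len p.edge), fun p => h p.edge (p.pos * φ.len p.edge),
    fun p => ?_, ?_⟩
  · obtain ⟨L, -, hL⟩ := h4 p
    exact hL.exists_isPath
  · rintro p q g L (⟨hpq, rfl, rfl⟩ | ⟨b, b', w, hw, rfl, rfl⟩)
    · have hle : ∀ p q : Point X.E, p.edge = q.edge → p.pos ≤ q.pos →
          Y.G.Reach Y.ℓ (x p.edge (p.pos * φ.len p.edge)) (x q.edge (q.pos * φ.len q.edge))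
            ((h p.edge (p.pos * φ.len p.edge))⁻¹ * FreeGroup.lift φ.cls 1 *
              h q.edge (q.pos * φ.len q.edge)) (lam * (|p.pos - q.pos| * X.ℓ p.edge)) := by
        intro p q hpq hle
        have h6 := h3 p.edge _ _ (hmem p).1
          (mul_le_mul_of_nonneg_right hle (φ.len_nonneg p.edge))
          (by rw [hpq]; exact (hmem q).2)
        rw [map_one, mul_one, ← hpq]
        refine h6.mono ?_
        rw [abs_sub_comm, abs_of_nonneg (sub_nonneg.2 hle)]
        have := mul_le_mul_of_nonneg_left (hφ p.edge) (sub_nonneg.2 hle)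
        linarith
      rcases le_total p.pos q.pos with hle' | hle'
      · exact hle p q hpq hle'
      · have := (hle q p hpq.symm hle').symm
        rw [abs_sub_comm, ← hpq] at this
        simp only [← hpq]
        convert this using 1
        simp only [map_one, mul_one, mul_inv_rev, inv_inv]
    · have h6 := ((hleg p b).trans hY (φ.reach_path hφ hw)).trans hY (hleg q b').symm
      convert h6 using 1
      · simp only [map_mul, map_inv]
        group
      · unfold pathWeight; ring

/-- There is a difference of markings all of whose slopes are at most `exp r`. -/
def LipMap (X Y : MarkedMetricGraph n) (r : ℝ) : Prop :=
  ∃ φ : DiffOfMarkings X Y, ∀ e, φ.len e ≤ Real.exp r * X.ℓ e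

theorem LipMap.mono {r r' : ℝ} (h : LipMap X Y r) (hr : r ≤ r') : LipMap X Y r' := by
  obtain ⟨φ, hφ⟩ := h
  exact ⟨φ, fun e => (hφ e).trans (mul_le_mul_of_nonneg_right (Real.exp_le_exp.2 hr)
    (X.isMetric.nonneg e))⟩

/-- The first map sends vertices to interior points of edges, so the second is applied through its
extension to points. The words `k` of that extension change edge classes by a function of the
vertices, which amounts to a change of base path in the marking. -/
theorem LipMap.trans {r r' : ℝ} (h : LipMap X Y r) (h' : LipMap Y Z r') :
    LipMap X Z (r + r') := by
  obtain ⟨φ, hφ⟩ := h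
  obtain ⟨ψ, hψ⟩ := h'
  obtain ⟨x, k, h1, h2⟩ := ψ.exists_extension hψ
  choose L hL hL' using fun e => h2 _ _ _ _ (φ.path e)
  refine ⟨⟨fun v => x (φ.vert v), _, L, hL', ?_⟩, fun e => (hL e).trans ?_⟩
  · obtain ⟨u, hu, hu'⟩ := φ.homotopic
    obtain ⟨v, hv, hv'⟩ := ψ.homotopic
    obtain ⟨w, hw, hw'⟩ := h1 (φ.vert X.base)
    obtain ⟨L', -, hL'⟩ := ψ.reach_path hψ hu
    obtain ⟨y, hy, hy'⟩ := hL'.exists_isPath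
    refine ⟨v ++ y ++ w, (hv.append hy).append hw, fun g => ?_⟩
    obtain ⟨z, hz, hz'⟩ := (X.mark g).2
    have h3 := lift_mk_conj (G := X.G) (fun e => FreeGroup.lift ψ.cls (φ.cls e))
      (fun e => (k (φ.vert (X.G.src e)))⁻¹ * FreeGroup.lift ψ.cls (φ.cls e) *
        k (φ.vert (X.G.tgt e))) (fun v => k (φ.vert v)) (fun e => rfl) hz
    have h4 : FreeGroup.lift (fun e => FreeGroup.lift ψ.cls (φ.cls e)) =
        (FreeGroup.lift ψ.cls).comp (FreeGroup.lift φ.cls) := by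
      ext e; simp
    rw [hz', h3, h4, MonoidHom.comp_apply, ← hz', hu' g]
    simp only [map_mul, map_inv]
    rw [hv' g, hy', hw', mk_append, mk_append]
    group
  · rw [Real.exp_add, mul_comm (Real.exp r), mul_assoc]
    exact mul_le_mul_of_nonneg_left (hφ e) (Real.exp_pos _).le

end Comp

end

end OuterSp

/-! ### Lipschitz distance on representatives, and its lower bound by stretch factors of loops -/

namespace OuterSp

noncomputable section

namespace Gr

variable {V E V' E' : Type*} {G : Gr V E} {G' : Gr V' E'}

theorem IsForest.mk_eq_mk {Z : Set E} (hZ : G.IsForest Z) {u v : V} {w w' : List (E × Bool)}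
    (h : G.IsPath u v w) (hw : ∀ d ∈ w, d.1 ∈ Z) (h' : G.IsPath u v w')
    (hw' : ∀ d ∈ w', d.1 ∈ Z) : FreeGroup.mk w = FreeGroup.mk w' := by
  have h1 := hZ.mk_eq_one (h.append h'.invRev) (by
    intro d hd
    simp only [List.mem_append, FreeGroup.invRev, List.mem_reverse, List.mem_map] at hd
    rcases hd with hd | ⟨d', hd', rfl⟩
    · exact hw d hd
    · exact hw' d' hd')
  rw [mk_append, ← FreeGroup.inv_mk] at h1
  exact mul_inv_eq_one.1 h1

/-- Replacing the edges of a path by paths. -/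
theorem IsPath.exists_subst (f : E → List (E' × Bool)) (m : V → V')
    (hf : ∀ e, G'.IsPath (m (G.src e)) (m (G.tgt e)) (f e)) {u v : V} {w : List (E × Bool)}
    (hw : G.IsPath u v w) : ∃ w', G'.IsPath (m u) (m v) w' ∧
      FreeGroup.lift (fun e => FreeGroup.mk (f e)) (FreeGroup.mk w) = FreeGroup.mk w' := by
  induction w generalizing u with
  | nil => exact ⟨[], by rw [isPath_nil.1 hw]; exact rfl, by rw [mk_nil, mk_nil, map_one]⟩
  | cons d w ih =>
    obtain ⟨w', h1, h2⟩ := ih hw.2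
    have h3 : ∃ x, G'.IsPath (m (G.dsrc d)) (m (G.dtgt d)) x ∧
        FreeGroup.lift (fun e => FreeGroup.mk (f e)) (FreeGroup.mk [d]) = FreeGroup.mk x := by
      rcases d with ⟨e, _ | _⟩
      · refine ⟨_, (hf e).invRev, ?_⟩
        rw [mk_singleton_false, map_inv, FreeGroup.lift_apply_of, FreeGroup.inv_mk]
      · exact ⟨_, hf e, by rw [mk_singleton_true, FreeGroup.lift_apply_of]⟩
    obtain ⟨x, h4, h5⟩ := h3
    refine ⟨x ++ w', ?_, by rw [mk_cons, map_mul, h5, h2, mk_append]⟩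
    rw [← hw.1]
    exact h4.append h1

namespace ForestCollapse

variable {ℓ : E → ℝ} {ℓ' : E' → ℝ} (κ : ForestCollapse G G' ℓ ℓ')

/-- A homotopy inverse of the collapse: choose a vertex in each fibre and join the lifted edges to
the chosen vertices inside the forest, which adds no length. The paths `k` are the tracks of a
homotopy from the identity to the round trip; uniqueness of homotopy classes in a forest makes the
last identity hold. -/
theorem exists_section (hs : ∀ y, ∃ d, G'.dsrc d = y) :
    ∃ (s : V' → V) (f : E' → List (E × Bool)) (k : V → List (E × Bool)),
      (∀ e, G.IsPath (s (G'.src e)) (s (G'.tgt e)) (f e)) ∧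
      (∀ e, pathWeight ℓ (f e) = ℓ' e) ∧
      (∀ v, G.IsPath v (s (κ.vmap v)) (k v)) ∧
      ∀ e, FreeGroup.lift (fun e' => FreeGroup.mk (f e')) (FreeGroup.mk (κ.emap e).toList) =
        (FreeGroup.mk (k (G.src e)))⁻¹ * FreeGroup.of e * FreeGroup.mk (k (G.tgt e)) := by
  have hsurj : ∀ y, ∃ v, κ.vmap v = y := by
    intro y
    obtain ⟨d', rfl⟩ := hs y
    obtain ⟨d, -, h, -⟩ := κ.exists_dart d'
    exact ⟨_, h⟩
  choose s hs using hsurj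
  choose d hd1 hd2 hd3 hd4 using fun e' : E' => κ.exists_dart (e', true)
  choose a ha1 ha2 using fun e' => κ.fiber (s (G'.src e')) (G.dsrc (d e'))
    (by rw [hs, hd2]; rfl)
  choose b hb1 hb2 using fun e' => κ.fiber (G.dtgt (d e')) (s (G'.tgt e'))
    (by rw [hs, hd3]; rfl)
  choose k hk1 hk2 using fun v => κ.fiber v (s (κ.vmap v)) (by rw [hs])
  refine ⟨s, fun e' => a e' ++ d e' :: b e', k, fun e' => (ha1 e').append ⟨rfl, hb1 e'⟩, ?_, hk1,
    ?_⟩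
  · intro e'
    have h1 : pathWeight ℓ (a e') = 0 :=
      pathWeight_eq_zero fun x hx => (κ.collapsed _ (ha2 e' x hx)).2
    have h2 : pathWeight ℓ (b e') = 0 :=
      pathWeight_eq_zero fun x hx => (κ.collapsed _ (hb2 e' x hx)).2
    have h3 := κ.pathWeight_push [d e']
    rw [push_cons, hd1] at h3
    simp only [push_nil, List.append_nil, pathWeight_cons, pathWeight_nil, add_zero] at h3
    rw [pathWeight_append, pathWeight_cons, h1, h2, h3]
    ring
  · have key : ∀ e', FreeGroup.mk (a e' ++ d e' :: b e') =
        (FreeGroup.mk (k (G.dsrc (d e'))))⁻¹ * FreeGroup.mk [d e'] *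
          FreeGroup.mk (k (G.dtgt (d e'))) := by
      intro e'
      have h1 : FreeGroup.mk (a e') = (FreeGroup.mk (k (G.dsrc (d e'))))⁻¹ := by
        rw [← mul_eq_one_iff_eq_inv, ← mk_append]
        have h2 := (ha1 e').append (hk1 (G.dsrc (d e')))
        rw [hd2] at h2
        refine κ.forest.mk_eq_one h2 fun x hx => ?_
        rcases List.mem_append.1 hx with hx | hx
        · exact ha2 _ x hx
        · exact hk2 _ x hx
      have h2 : FreeGroup.mk (b e') = FreeGroup.mk (k (G.dtgt (d e'))) := by
        refine κ.forest.mk_eq_mk (hb1 e') (hb2 e') ?_ (hk2 _)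
        have := hk1 (G.dtgt (d e'))
        rw [hd3] at this
        exact this
      rw [mk_append, mk_cons, h1, h2, mul_assoc]
    intro e
    cases h : κ.emap e with
    | none =>
      obtain ⟨h1, -⟩ := κ.collapsed e h
      have h2 := hk1 (G.src e)
      have h3 := hk1 (G.tgt e)
      rw [← h1] at h3
      have h4 := κ.forest.mk_eq_mk h2 (hk2 _) (show G.IsPath (G.src e) _
        ((e, true) :: k (G.tgt e)) from ⟨rfl, h3⟩) (by
          intro x hx
          rcases List.mem_cons.1 hx with rfl | hx
          · exact h
          · exact hk2 _ x hx)
      rw [mk_cons, mk_singleton_true] at h4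
      rw [Option.toList_none, mk_nil, map_one, h4]
      group
    | some d' =>
      have h1 : (d d'.1).1 = e := by rw [hd4, ← κ.eq_pre h]
      have h2 : (d d'.1).2 = d'.2 := by
        have h3 := hd1 d'.1
        rw [κ.pushDart_some (d := d d'.1) (by rw [h1]; exact h)] at h3
        simp only [List.cons.injEq, Prod.mk.injEq, true_and, and_true] at h3
        revert h3
        generalize (d d'.1).2 = x
        generalize d'.2 = y
        revert x y; decide
      have h3 : d d'.1 = (e, d'.2) := Prod.ext h1 h2
      have h4 := key d'.1
      rw [h3] at h4
      rcases d' with ⟨e', _ | _⟩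
      · rw [Option.toList_some, mk_singleton_false, map_inv, FreeGroup.lift_apply_of]
        simp only at h4 h3 ⊢
        rw [h3, h4, mk_singleton_false]
        simp only [dsrc, dtgt, Bool.false_eq_true, if_false]
        group
      · rw [Option.toList_some, mk_singleton_true, FreeGroup.lift_apply_of]
        simp only at h4 h3 ⊢
        rw [h3, h4, mk_singleton_true]
        simp [dsrc, dtgt]

end ForestCollapse

/-! ### Weighted word length -/

open Classical in
/-- The weight of the reduced word of an element of the free group on the edges. -/
def wordWeight (ℓ : E → ℝ) (g : FreeGroup E) : ℝ := pathWeight ℓ g.toWord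

section WordWeight

variable {ℓ : E → ℝ} (hℓ : ∀ e, 0 ≤ ℓ e)
include hℓ

theorem wordWeight_mk_le (w : List (E × Bool)) :
    wordWeight ℓ (FreeGroup.mk w) ≤ pathWeight ℓ w := by
  classical
  refine pathWeight_sublist hℓ ?_
  rw [FreeGroup.toWord_mk]
  exact FreeGroup.reduce.red.sublist

theorem wordWeight_mul_le (g h : FreeGroup E) :
    wordWeight ℓ (g * h) ≤ wordWeight ℓ g + wordWeight ℓ h := by
  classical
  have := pathWeight_sublist hℓ (FreeGroup.toWord_mul_sublist g h)
  rw [pathWeight_append] at this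
  unfold wordWeight
  convert this

omit hℓ in
theorem wordWeight_inv (g : FreeGroup E) : wordWeight ℓ g⁻¹ = wordWeight ℓ g := by
  classical
  unfold wordWeight
  rw [FreeGroup.toWord_inv, pathWeight_invRev]

omit hℓ in
theorem wordWeight_pow {w : List (E × Bool)} (h : FreeGroup.IsCyclicallyReduced w) (k : ℕ) :
    wordWeight ℓ (FreeGroup.mk w ^ k) = k * pathWeight ℓ w := by
  classical
  unfold wordWeight
  rw [FreeGroup.toWord_pow, FreeGroup.toWord_mk, h.isReduced.reduce_eq,
    ((h.flatten_replicate k).isReduced).reduce_eq]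
  induction k with
  | zero => simp
  | succ k ih =>
    rw [List.replicate_succ, List.flatten_cons, pathWeight_append, ih]
    push_cast
    ring

/-- The weight of a cyclically reduced word is at most the growth rate of the weights of the
powers of its conjugates. -/
theorem pathWeight_le_of_pow {w : List (E × Bool)} (h : FreeGroup.IsCyclicallyReduced w)
    (g : FreeGroup E) {L C : ℝ}
    (hL : ∀ k : ℕ, wordWeight ℓ ((g * FreeGroup.mk w * g⁻¹) ^ k) ≤ k * L + C) :
    pathWeight ℓ w ≤ L := by
  by_contra! hlt
  -- For this `k` the excess `k * (pathWeight ℓ w - L)` beats `C` and the cost of undoing the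
  -- conjugation by `g`.
  obtain ⟨k, hk⟩ := exists_nat_gt ((C + 2 * wordWeight ℓ g) / (pathWeight ℓ w - L))
  rw [div_lt_iff₀ (by linarith)] at hk
  have h1 := hL k
  have h2 : FreeGroup.mk w ^ k = g⁻¹ * (g * FreeGroup.mk w * g⁻¹) ^ k * g := by
    rw [conj_pow]; group
  have h3 := wordWeight_pow (ℓ := ℓ) h k
  rw [h2] at h3
  have h4 := wordWeight_mul_le hℓ (g⁻¹ * (g * FreeGroup.mk w * g⁻¹) ^ k) g
  have h5 := wordWeight_mul_le hℓ g⁻¹ ((g * FreeGroup.mk w * g⁻¹) ^ k)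
  rw [wordWeight_inv] at h5
  linarith

/-- The recorded class is based at the initial vertex of the edge of `p` rather than at `p`; moving
the base point costs at most the edge at each end. -/
theorem Reach.wordWeight_le {p : Point E} {g : FreeGroup E} {L : ℝ}
    (h : G.Reach ℓ p p g L) : wordWeight ℓ g ≤ L + 2 * ℓ p.edge := by
  have h0 : wordWeight ℓ (1 : FreeGroup E) = 0 := by
    classical
    simp [wordWeight]
  have hleg : ∀ b, wordWeight ℓ (legWord p b) ≤ ℓ p.edge := by
    intro b
    cases b
    · simp only [legWord, Bool.false_eq_true, if_false, h0]
      exact hℓ _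
    · have := wordWeight_mk_le hℓ [(p.edge, true)]
      simpa [legWord, mk_singleton_true] using this
  obtain ⟨K, hK, h⟩ := h
  have h1 := h.nonneg hℓ
  have h6 := hℓ p.edge
  rcases h with ⟨-, rfl, -⟩ | ⟨b, b', w, -, rfl, rfl⟩
  · rw [h0]; linarith
  · have h2 := wordWeight_mul_le hℓ (legWord p b * FreeGroup.mk w) (legWord p b')⁻¹
    have h3 := wordWeight_mul_le hℓ (legWord p b) (FreeGroup.mk w)
    have h4 := wordWeight_mk_le hℓ w
    rw [wordWeight_inv] at h2
    have h5 := hleg b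
    have h7 := hleg b'
    have h8 := legLength_nonneg hℓ p b
    have h9 := legLength_nonneg hℓ p b'
    unfold pathWeight at h4
    linarith

end WordWeight

end Gr

/-! ### Constructing differences of markings -/

section Lip

open Gr

variable {n : ℕ} {X Y Z : MarkedMetricGraph n}

/-- A map that sends vertices to vertices. -/
theorem LipMap.of_vertexMap {r : ℝ} (m : X.V → Y.V) (f : X.E → List (Y.E × Bool))
    (hf : ∀ e, Y.G.IsPath (m (X.G.src e)) (m (X.G.tgt e)) (f e))
    (hlen : ∀ e, pathWeight Y.ℓ (f e) ≤ Real.exp r * X.ℓ e)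
    (hmark : ∃ u, Y.G.IsPath Y.base (m X.base) u ∧ ∀ g : FreeGroup (Fin n),
      FreeGroup.lift (fun e => FreeGroup.mk (f e)) (X.mark g : FreeGroup X.E) =
        (FreeGroup.mk u)⁻¹ * (Y.mark g : FreeGroup Y.E) * FreeGroup.mk u) : LipMap X Y r := by
  -- Points live on edges, so a vertex is represented as the initial end of a chosen dart; `k` is
  -- the resulting correction of homotopy classes.
  choose δ hδ using Y.admissible.exists_dart
  set P : Y.V → Point Y.E := fun y => endPt (δ y).1 (!(δ y).2) with hP
  have hP1 : ∀ y, Y.G.legEnd (P y) (!(δ y).2) = y := fun y => by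
    rw [legEnd_endPt_not (δ y) _ rfl, hδ]
  set k : Y.V → FreeGroup Y.E := fun y => legWord (P y) (!(δ y).2) with hk
  refine ⟨⟨fun v => P (m v), fun e => k (m (X.G.src e)) * FreeGroup.mk (f e) *
    (k (m (X.G.tgt e)))⁻¹, fun e => pathWeight Y.ℓ (f e), fun e => ?_, ?_⟩, hlen⟩
  · refine Or.inr ⟨_, _, f e, ?_, rfl, ?_⟩
    · rw [hP1, hP1]; exact hf e
    · rw [legLength_endPt, legLength_endPt, zero_add, add_zero]; rfl
  · obtain ⟨u, hu1, hu2⟩ := hmark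
    obtain ⟨v, hv1, hv2⟩ := exists_isPath_legWord (G := Y.G) (P (m X.base)) (!(δ (m X.base)).2)
    rw [hP1] at hv1
    change k (m X.base) = _ at hv2
    refine ⟨u ++ FreeGroup.invRev v, hu1.append hv1.invRev, fun g => ?_⟩
    obtain ⟨z, hz, hz'⟩ := (X.mark g).2
    have h3 := lift_mk_conj (G := X.G) (fun e => FreeGroup.mk (f e))
      (fun e => k (m (X.G.src e)) * FreeGroup.mk (f e) * (k (m (X.G.tgt e)))⁻¹)
      (fun v => (k (m v))⁻¹) (fun e => by rw [inv_inv]) hz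
    rw [hz', h3, ← hz', hu2 g, mk_append, ← FreeGroup.inv_mk, ← hv2]
    group

theorem Collapse.lipMap (κ : Collapse X Y) : LipMap X Y 0 := by
  have h : ∀ e, κ.toForestCollapse.pushDart (e, true) = (κ.emap e).toList := fun e => by
    simp [ForestCollapse.pushDart, toForestCollapse]
  refine LipMap.of_vertexMap κ.vmap (fun e => (κ.emap e).toList) (fun e => ?_) (fun e => ?_)
    κ.marking
  · rw [← h]
    exact κ.toForestCollapse.isPath_pushDart (e, true)
  · have h1 := κ.toForestCollapse.pathWeight_push [(e, true)]
    simp only [ForestCollapse.push_cons, ForestCollapse.push_nil, List.append_nil, h,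
      pathWeight_cons, pathWeight_nil, add_zero] at h1
    rw [h1, Real.exp_zero, one_mul]

theorem Collapse.lipMap_symm (κ : Collapse X Y) : LipMap Y X 0 := by
  obtain ⟨s, f, k, h1, h2, h3, h4⟩ :=
    κ.toForestCollapse.exists_section Y.admissible.exists_dart
  refine LipMap.of_vertexMap s f h1 (fun e => by rw [h2, Real.exp_zero, one_mul]) ?_
  obtain ⟨u, hu1, hu2⟩ := κ.marking
  obtain ⟨w, hw1, hw2⟩ := hu1.exists_subst f s h1
  refine ⟨k X.base ++ FreeGroup.invRev w, (h3 _).append hw1.invRev, fun g => ?_⟩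
  obtain ⟨z, hz, hz'⟩ := (X.mark g).2
  have h5 := lift_mk_conj (G := X.G) FreeGroup.of
    (fun e => FreeGroup.lift (fun e' => FreeGroup.mk (f e')) (FreeGroup.mk (κ.emap e).toList))
    (fun v => FreeGroup.mk (k v)) h4 hz
  have h6 : FreeGroup.lift (fun e => FreeGroup.lift (fun e' => FreeGroup.mk (f e'))
      (FreeGroup.mk (κ.emap e).toList)) =
      (FreeGroup.lift (fun e' => FreeGroup.mk (f e'))).comp
        (FreeGroup.lift fun e => FreeGroup.mk (κ.emap e).toList) := by
    ext e; simp
  rw [h6, MonoidHom.comp_apply, ← hz', hu2 g, map_mul, map_mul, map_inv, hw2] at h5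
  rw [FreeGroup.lift_of_eq_id, MonoidHom.id_apply] at h5
  rw [mk_append, ← FreeGroup.inv_mk]
  generalize FreeGroup.mk w = a at *
  generalize FreeGroup.mk (k X.base) = b at *
  generalize (X.mark g : FreeGroup X.E) = c at *
  generalize FreeGroup.lift (fun e' => FreeGroup.mk (f e')) (Y.mark g : FreeGroup Y.E) = t at *
  have h7 : t = a * (a⁻¹ * t * a) * a⁻¹ := by group
  rw [h7, h5]
  group

theorem lipMap_refl (X : MarkedMetricGraph n) : LipMap X X 0 := by
  refine LipMap.of_vertexMap id (fun e => [(e, true)]) (fun e => ⟨rfl, rfl⟩) (fun e => ?_)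
    ⟨[], rfl, fun g => ?_⟩
  · simp
  · rw [mk_nil, inv_one, one_mul, mul_one]
    exact DFunLike.congr_fun (FreeGroup.lift_of_eq_id X.E) (X.mark g : FreeGroup X.E)

/-- A collapse and its homotopy inverse both have slope at most `1`, and such maps compose along a
chain of collapses. -/
theorem lipMap_of_pt_eq (h : X.pt = Y.pt) : LipMap X Y 0 := by
  have key : ∀ X Y : MarkedMetricGraph n,
      Relation.EqvGen (fun X Y : MarkedMetricGraph n => Nonempty (Collapse X Y)) X Y →
        LipMap X Y 0 ∧ LipMap Y X 0 := by
    intro X Y h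
    induction h with
    | rel X Y h => obtain ⟨κ⟩ := h; exact ⟨κ.lipMap, κ.lipMap_symm⟩
    | refl X => exact ⟨lipMap_refl X, lipMap_refl X⟩
    | symm X Y _ ih => exact ih.symm
    | trans X Y Z _ _ h1 h2 =>
      exact ⟨by simpa using h1.1.trans h2.1, by simpa using h2.2.trans h1.2⟩
  exact (key X Y (Quot.eqvGen_exact h)).1

theorem lipDist_pt (X Y : MarkedMetricGraph n) : lipDist X.pt Y.pt = sInf {r | LipMap X Y r} := by
  unfold lipDist
  congr 1
  ext r
  constructor
  · rintro ⟨X', Y', h1, h2, h⟩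
    have h' : LipMap X' Y' r := h
    simpa using ((lipMap_of_pt_eq h1.symm).trans h').trans (lipMap_of_pt_eq h2)
  · rintro h
    exact ⟨X, Y, rfl, rfl, h⟩

/-! ### Lipschitz maps stretch loops by at most their largest slope -/

/-- The image of the `k`-th power of `w` is closed at one fixed point and has length at most `k`
times `exp r * pathWeight X.ℓ w`. The error of passing to reduced words does not depend on `k`, so
comparing growth rates gives the sharp constant. -/
theorem LipMap.pathWeight_le {r : ℝ} (h : LipMap X Y r) {v : X.V} {w : List (X.E × Bool)}
    (hw : X.G.IsPath v v w) {u : List (X.E × Bool)} (g : FreeGroup (Fin n))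
    (hg : (X.mark g : FreeGroup X.E) = FreeGroup.mk u * FreeGroup.mk w * (FreeGroup.mk u)⁻¹)
    {a : List (Y.E × Bool)} (ha : FreeGroup.IsCyclicallyReduced a) {y : FreeGroup Y.E}
    (hy : (Y.mark g : FreeGroup Y.E) = y * FreeGroup.mk a * y⁻¹) :
    pathWeight Y.ℓ a ≤ Real.exp r * pathWeight X.ℓ w := by
  obtain ⟨φ, hφ⟩ := h
  obtain ⟨x, -, hx⟩ := φ.homotopic
  have h1 := hx g
  rw [hg, hy] at h1
  simp only [map_mul, map_inv] at h1
  set b := FreeGroup.lift φ.cls (FreeGroup.mk u) with hb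
  set c := (FreeGroup.mk x)⁻¹ with hc
  have h2 : FreeGroup.lift φ.cls (FreeGroup.mk w) =
      (b⁻¹ * c * y) * FreeGroup.mk a * (b⁻¹ * c * y)⁻¹ := by
    have h3 : FreeGroup.lift φ.cls (FreeGroup.mk w) =
        b⁻¹ * (b * FreeGroup.lift φ.cls (FreeGroup.mk w) * b⁻¹) * b := by group
    rw [h3, h1]
    have h4 : FreeGroup.mk x = c⁻¹ := by rw [hc, inv_inv]
    rw [h4]
    group
  refine pathWeight_le_of_pow Y.isMetric.nonneg ha (b⁻¹ * c * y)
    (C := 2 * Y.ℓ (φ.vert v).edge) fun k => ?_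
  rw [← h2]
  have h3 : ∀ k : ℕ, ∃ w', X.G.IsPath v v w' ∧ FreeGroup.mk w' = FreeGroup.mk w ^ k ∧
      pathWeight X.ℓ w' = k * pathWeight X.ℓ w := by
    intro k
    induction k with
    | zero => exact ⟨[], rfl, by rw [mk_nil, pow_zero], by simp⟩
    | succ k ih =>
      obtain ⟨w', h4, h5, h6⟩ := ih
      refine ⟨w' ++ w, h4.append hw, by rw [mk_append, h5, pow_succ], ?_⟩
      rw [pathWeight_append, h6]
      push_cast
      ring
  obtain ⟨w', h4, h5, h6⟩ := h3 k
  have h7 := (φ.reach_path hφ h4).wordWeight_le Y.isMetric.nonneg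
  rw [h5, h6, map_pow] at h7
  linarith

/-- Each closed path represents a conjugacy class. -/
theorem MarkedGraph.exists_mark (M : MarkedGraph n) {v : M.V} {w : List (M.E × Bool)}
    (hw : M.G.IsPath v v w) : ∃ (u : List (M.E × Bool)) (g : FreeGroup (Fin n)),
      (M.mark g : FreeGroup M.E) = FreeGroup.mk u * FreeGroup.mk w * (FreeGroup.mk u)⁻¹ := by
  obtain ⟨u, hu⟩ := M.admissible.connected M.base v
  refine ⟨u, M.mark.symm ⟨_, u ++ w ++ FreeGroup.invRev u, (hu.append hw).append hu.invRev, rfl⟩,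
    ?_⟩
  rw [MulEquiv.apply_symm_apply]
  change FreeGroup.mk (u ++ w ++ FreeGroup.invRev u) = _
  rw [mk_append, mk_append, FreeGroup.inv_mk]

/-- Needed for the infimum to be meaningful: one loop of `Y`, compared with any closed path of `X`
in the same conjugacy class, bounds all slopes from below. -/
theorem bddBelow_lipMap (X Y : MarkedMetricGraph n) : BddBelow {r | LipMap X Y r} := by
  obtain ⟨α, hα⟩ := Y.admissible.exists_loop
  have hpos := Y.isMetric.weight_pos hα
  obtain ⟨v, a, rfl, -, h1, h2⟩ := hα.exists_path
  rw [weight_coe] at hpos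
  obtain ⟨u, g, hg⟩ := Y.toMarkedGraph.exists_mark h1
  obtain ⟨w, hw, hw'⟩ := (X.mark g).2
  refine ⟨Real.log (pathWeight Y.ℓ a / pathWeight X.ℓ w), fun r hr => ?_⟩
  have h3 := LipMap.pathWeight_le hr hw (u := []) g (by rw [hw', mk_nil]; simp) h2 hg
  have h4 : 0 < pathWeight X.ℓ w := by
    by_contra! h
    have := mul_nonpos_of_nonneg_of_nonpos (Real.exp_pos r).le h
    linarith
  rw [Real.log_le_iff_le_exp (div_pos hpos h4), div_le_iff₀ h4]
  exact h3

theorem LipMap.lipDist_le {r : ℝ} (h : LipMap X Y r) : lipDist X.pt Y.pt ≤ r := by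
  rw [lipDist_pt]
  exact csInf_le (bddBelow_lipMap X Y) h

/-- The map `h` only guarantees that the infimum is over a nonempty set; `r` does not enter the
bound. -/
theorem log_div_le_lipDist (M : MarkedGraph n) {ℓ ℓ' : M.E → ℝ} (hℓ : M.G.IsMetric ℓ)
    (hℓ' : M.G.IsMetric ℓ') {r : ℝ} (h : LipMap ⟨M, ℓ, hℓ⟩ ⟨M, ℓ', hℓ'⟩ r)
    {α : Cycle (M.E × Bool)} (hα : M.G.IsLoop α) :
    Real.log (weight ℓ' α / weight ℓ α) ≤ lipDist (MarkedMetricGraph.pt ⟨M, ℓ, hℓ⟩)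
      (MarkedMetricGraph.pt ⟨M, ℓ', hℓ'⟩) := by
  rw [lipDist_pt]
  refine le_csInf ⟨r, h⟩ fun r hr => ?_
  have h1 := hℓ.weight_pos hα
  have h2 := hℓ'.weight_pos hα
  obtain ⟨v, a, rfl, -, h3, h4⟩ := hα.exists_path
  obtain ⟨u, g, hg⟩ := M.exists_mark h3
  have h5 := LipMap.pathWeight_le hr h3 (u := u) g hg h4 hg
  rw [Real.log_le_iff_le_exp (div_pos h2 h1), div_le_iff₀ h1, weight_coe, weight_coe]
  exact h5

end Lip

end

end OuterSp

/-! ### Optimal maps between nearby metrics -/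

namespace OuterSp

noncomputable section

namespace Gr

variable {V E : Type*} {G : Gr V E}

/-! ### Potentials on darts -/

/-- If `c` is nonnegative on the loops, there are infinitesimal displacements of the vertices, given
by the displacements `f d` away from the darts `d`, that change no edge length by more than `c`. -/
theorem IsAdmissible.exists_potential [Fintype E] (hG : G.IsAdmissible) (c : E → ℝ) {κ : ℝ}
    (hκ : ∀ e, |c e| ≤ κ) (hc : ∀ α, G.IsLoop α → 0 ≤ weight c α) :
    ∃ f : E × Bool → ℝ, (∀ d d', G.dsrc d = G.dsrc d' → d ≠ d' → 0 ≤ f d + f d') ∧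
      (∀ d, f d + f (d.1, !d.2) ≤ c d.1) ∧ ∀ d, |f d| ≤ Fintype.card (E × Bool) * κ := by
  set N : ℝ := Fintype.card (E × Bool) * κ with hN
  have hcyc : ∀ α : Cycle (E × Bool), α.Chain G.Adj →
      0 ≤ (α.toMultiset.map fun d => c d.1).sum := by
    intro α hα
    by_cases h : α = Cycle.nil
    · subst h; simp
    · exact hc α ⟨h, hα⟩
  have hlow : ∀ d l, (d :: l).IsChain G.Adj → -N ≤ pathWeight c (d :: l) := fun d l h =>
    walk_sum_ge (R := G.Adj) (fun d => c d.1) (fun d => hκ d.1) hcyc d l h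
  -- Weights of immersed walks that start with `d`; their infimum `m d` is finite because no loop
  -- has negative weight.
  set S : E × Bool → Set ℝ := fun d => {x | ∃ l, (d :: l).IsChain G.Adj ∧ x = pathWeight c (d :: l)}
    with hS
  have hbdd : ∀ d, BddBelow (S d) := fun d => ⟨-N, by rintro x ⟨l, h, rfl⟩; exact hlow d l h⟩
  have hne : ∀ d, (S d).Nonempty := fun d => ⟨_, [], List.isChain_singleton _, rfl⟩
  set m : E × Bool → ℝ := fun d => sInf (S d) with hm
  have hmlow : ∀ d, -N ≤ m d := fun d => le_csInf (hne d) (by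
    rintro x ⟨l, h, rfl⟩; exact hlow d l h)
  have hmup : ∀ d, m d ≤ N := by
    intro d
    have h1 : m d ≤ c d.1 := csInf_le (hbdd d) ⟨[], List.isChain_singleton _, by simp⟩
    have h2 := (abs_le.1 (hκ d.1)).2
    have h3 : 0 ≤ κ := (abs_nonneg _).trans (hκ d.1)
    have h4 : (1 : ℝ) ≤ Fintype.card (E × Bool) := by
      exact_mod_cast Fintype.card_pos_iff.2 ⟨d⟩
    nlinarith
  have hstep : ∀ d d', G.Adj d d' → m d - c d.1 ≤ m d' := by
    intro d d' h
    refine le_csInf (hne d') ?_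
    rintro x ⟨l, hl, rfl⟩
    have h1 : m d ≤ pathWeight c (d :: d' :: l) :=
      csInf_le (hbdd d) ⟨_, List.isChain_cons_cons.2 ⟨h, hl⟩, rfl⟩
    rw [pathWeight_cons] at h1
    linarith
  set x : E × Bool → ℝ := fun d => ⨅ d' : {d' // G.dsrc d' = G.dsrc d ∧ d' ≠ d}, m d' with hx
  have hne' : ∀ d, Nonempty {d' // G.dsrc d' = G.dsrc d ∧ d' ≠ d} := by
    intro d
    obtain ⟨d', h⟩ := hG.exists_dart_ne d
    exact ⟨⟨d', h⟩⟩
  have hxle : ∀ d d', G.dsrc d' = G.dsrc d → d' ≠ d → x d ≤ m d' := fun d d' h1 h2 =>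
    ciInf_le (Finite.bddBelow_range _) (⟨d', h1, h2⟩ : {d' // G.dsrc d' = G.dsrc d ∧ d' ≠ d})
  have hxge : ∀ d b, (∀ d', G.dsrc d' = G.dsrc d → d' ≠ d → b ≤ m d') → b ≤ x d := by
    intro d b h
    have := hne' d
    exact le_ciInf fun d' => h d' d'.2.1 d'.2.2
  -- Here `x d` is the least `m` among the other darts at the same vertex. So `x d ≤ m d'` for
  -- these, which gives the vertex inequality. A walk along `d` continues by any dart except the
  -- reverse of `d`, so `m d - c d.1 ≤ x (d.1, !d.2)`; adding this to the same inequality for the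
  -- reverse gives the edge inequality.
  refine ⟨fun d => (m d - x d) / 2, ?_, ?_, ?_⟩
  · intro d d' h1 h2
    have h3 := hxle d d' h1.symm h2.symm
    have h4 := hxle d' d h1 h2
    simp only
    linarith
  · intro d
    have key : ∀ d : E × Bool, m d - c d.1 ≤ x (d.1, !d.2) := by
      intro d
      refine hxge _ _ fun d' h1 h2 => hstep d d' ⟨?_, h2⟩
      rw [h1, dsrc_drev]
    have h1 := key d
    have h2 := key (d.1, !d.2)
    simp only [Bool.not_not] at h2
    simp only
    linarith
  · intro d
    have h1 := hmlow d
    have h2 := hmup d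
    have h3 : -N ≤ x d := hxge _ _ fun d' _ _ => hmlow d'
    have h4 : x d ≤ N := by
      obtain ⟨d', h⟩ := hG.exists_dart_ne d
      exact (hxle d d' h.1 h.2).trans (hmup d')
    rw [abs_le]
    constructor <;> simp only <;> linarith

/-- `u` and `v` are joined by a path in `Z`. -/
def Joined (G : Gr V E) (Z : Set E) (u v : V) : Prop := ∃ w, G.IsPath u v w ∧ ∀ d ∈ w, d.1 ∈ Z

theorem joined_equivalence (Z : Set E) : Equivalence (G.Joined Z) where
  refl v := ⟨[], rfl, by simp⟩
  symm := by
    rintro u v ⟨w, h1, h2⟩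
    refine ⟨_, h1.invRev, fun d hd => ?_⟩
    simp only [FreeGroup.invRev, List.mem_reverse, List.mem_map] at hd
    obtain ⟨d', hd', rfl⟩ := hd
    exact h2 d' hd'
  trans := by
    rintro u v x ⟨w, h1, h2⟩ ⟨w', h3, h4⟩
    refine ⟨_, h1.append h3, fun d hd => ?_⟩
    rcases List.mem_append.1 hd with hd | hd
    · exact h2 d hd
    · exact h4 d hd

theorem IsAdmissible.exists_dart_notMem [Finite E] (hG : G.IsAdmissible) {Z : Set E}
    (hZ : G.IsForest Z) (u : V) : ∃ d : E × Bool, d.1 ∉ Z ∧ G.Joined Z u (G.dsrc d) := by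
  obtain ⟨α, hα⟩ := hG.exists_loop
  obtain ⟨d, -, hd⟩ := hZ α hα
  obtain ⟨w, hw⟩ := hG.connected u (G.dsrc d)
  induction w generalizing u with
  | nil => exact ⟨d, hd, [], hw, by simp⟩
  | cons d' w ih =>
    by_cases h : d'.1 ∈ Z
    · obtain ⟨x, h1, h2⟩ := ih _ hw.2
      refine ⟨x, h1, (joined_equivalence Z).trans ⟨[d'], ⟨hw.1, rfl⟩, ?_⟩ h2⟩
      simpa using h
    · exact ⟨d', h, [], hw.1.symm, by simp⟩

/-- The inequality between the displacements at a vertex passes to the vertices obtained by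
collapsing a forest on which `c` vanishes. -/
theorem add_nonneg_of_joined {Z : Set E} (f : E × Bool → ℝ)
    (h1 : ∀ d d', G.dsrc d = G.dsrc d' → d ≠ d' → 0 ≤ f d + f d')
    (h2 : ∀ d : E × Bool, d.1 ∈ Z → f d + f (d.1, !d.2) ≤ 0) {d d' : E × Bool}
    (hd : d.1 ∉ Z) (hd' : d'.1 ∉ Z) (hne : d ≠ d') (h : G.Joined Z (G.dsrc d) (G.dsrc d')) :
    0 ≤ f d + f d' := by
  classical
  -- Along a reduced path, with `z'` the reverse of its first dart `z`: `f d + f d' = (f d + f z) -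
  -- (f z + f z') + (f z' + f d')`, where the first bracket is nonnegative, the second nonpositive,
  -- and the third is the induction hypothesis.
  have key : ∀ (w : List (E × Bool)) (d : E × Bool), G.IsPath (G.dsrc d) (G.dsrc d') w →
      w.IsChain G.Adj → (∀ z ∈ w, z.1 ∈ Z) → (∀ z ∈ w.head?, z ≠ d) → (w = [] → d ≠ d') →
      0 ≤ f d + f d' := by
    intro w
    induction w with
    | nil => intro d hp _ _ _ hn; exact h1 d d' hp (hn rfl)
    | cons z w ih =>
      intro d hp hc hz hh _
      have hzZ := hz z (by simp)
      have h3 := h1 d z hp.1.symm (hh z (by simp)).symm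
      have h4 := h2 z hzZ
      have h5 := ih (z.1, !z.2) (by rw [dsrc_drev]; exact hp.2) hc.tail
        (fun y hy => hz y (List.mem_cons_of_mem _ hy)) (by
          intro y hy
          cases w with
          | nil => simp at hy
          | cons a w =>
            simp only [List.head?_cons, Option.mem_def, Option.some.injEq] at hy
            subst hy
            exact (List.isChain_cons_cons.1 hc).1.2) (by
          rintro - rfl
          exact hd' hzZ)
      linarith
  obtain ⟨w, hw, hwZ⟩ := h
  have hred : FreeGroup.Red w (FreeGroup.reduce w) := FreeGroup.reduce.red
  have h3 := hw.red hred
  have h4 : FreeGroup.IsReduced (FreeGroup.reduce w) := by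
    rw [FreeGroup.isReduced_iff_reduce_eq, FreeGroup.reduce.idem]
  have h5 : ∀ z ∈ FreeGroup.reduce w, z.1 ∈ Z := fun z hz => hwZ z (hred.sublist.subset hz)
  refine key _ d h3 (h3.isChain h4) h5 ?_ fun _ => hne
  rintro z hz rfl
  exact hd (h5 z (List.mem_of_mem_head? hz))

/-- The point on the edge of `d` at distance `s` from the initial vertex of `d`. -/
theorem exists_point (ℓ : E → ℝ) (d : E × Bool) {s : ℝ} (hs : 0 ≤ s) (hsd : s ≤ ℓ d.1)
    (hpos : 0 < ℓ d.1) : ∃ p : Point E, p.edge = d.1 ∧ legLength ℓ p (!d.2) = s := by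
  have h1 : 0 ≤ s / ℓ d.1 := div_nonneg hs hpos.le
  have h2 : s / ℓ d.1 ≤ 1 := (div_le_one hpos).2 hsd
  rcases d with ⟨e, _ | _⟩
  · refine ⟨⟨e, 1 - s / ℓ e, by linarith, by linarith⟩, rfl, ?_⟩
    simp only [legLength, Bool.not_false, if_true, sub_sub_cancel]
    exact div_mul_cancel₀ _ hpos.ne'
  · refine ⟨⟨e, s / ℓ e, h1, h2⟩, rfl, ?_⟩
    simp only [legLength, Bool.not_true, Bool.false_eq_true, if_false]
    exact div_mul_cancel₀ _ hpos.ne'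

theorem reach_midpoint {ℓ : E → ℝ} {p m : Point E} (h : p.edge = m.edge) (hm : m.pos = 1 / 2)
    (b : Bool) (hpos : 0 < ℓ p.edge) (hp : legLength ℓ p b ≤ ℓ p.edge / 2) :
    G.Reach ℓ p m 1 (ℓ p.edge / 2 - legLength ℓ p b) := by
  refine (reach_edge h).mono ?_
  rw [hm]
  unfold legLength at hp ⊢
  have h1 : (if b then 1 - p.pos else p.pos) ≤ 1 / 2 := le_of_mul_le_mul_right (by linarith) hpos
  cases b
  · simp only [Bool.false_eq_true, if_false] at h1 ⊢
    rw [abs_sub_comm, abs_of_nonneg (by linarith)]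
    linarith
  · simp only [if_true] at h1 ⊢
    rw [abs_of_nonneg (by linarith)]
    linarith

end Gr

section Displacement

open Gr

variable {n : ℕ}

/-- Two nearby metrics on a marked graph: there is a difference of markings whose slopes are at
most the largest stretch factor of a loop. -/
theorem lipMap_of_close (M : MarkedGraph n) (Z : Set M.E) {ℓ ℓ' : M.E → ℝ} (hℓ : M.G.IsMetric ℓ)
    (hℓ' : M.G.IsMetric ℓ') (hZ : ∀ e ∈ Z, ℓ e = 0 ∧ ℓ' e = 0) {r κ : ℝ}
    (hr : ∀ α, M.G.IsLoop α → weight ℓ' α ≤ Real.exp r * weight ℓ α)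
    (hκ : ∀ e, |Real.exp r * ℓ e - ℓ' e| ≤ κ)
    (hsmall : ∀ e ∉ Z, 0 < ℓ' e ∧ Fintype.card (M.E × Bool) * κ ≤ ℓ' e / 2) :
    LipMap ⟨M, ℓ, hℓ⟩ ⟨M, ℓ', hℓ'⟩ r := by
  classical
  set c : M.E → ℝ := fun e => Real.exp r * ℓ e - ℓ' e with hc
  have hcw : ∀ α, M.G.IsLoop α → 0 ≤ weight c α := by
    intro α hα
    have h1 : c = (Real.exp r • ℓ) + (-1 : ℝ) • ℓ' := by
      ext e; simp [hc, sub_eq_add_neg]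
    have h2 : weight (Real.exp r • ℓ) α = Real.exp r * weight ℓ α := by
      have := weight_add_smul 0 ℓ (Real.exp r) α
      rw [zero_add] at this
      rw [this]; simp [weight]
    rw [h1, weight_add_smul, h2]
    linarith [hr α hα]
  obtain ⟨f, hf1, hf2, hf3⟩ := M.admissible.exists_potential c hκ hcw
  have hfor : M.G.IsForest Z := fun α hα => by
    obtain ⟨d, h1, h2⟩ := hℓ.forest α hα
    exact ⟨d, h1, fun h => h2 (hZ _ h).1⟩
  have hf2Z : ∀ d : M.E × Bool, d.1 ∈ Z → f d + f (d.1, !d.2) ≤ 0 := by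
    intro d hd
    refine (hf2 d).trans ?_
    simp [hc, hZ _ hd]
  -- the dart along which the vertices of a component of the forest are moved
  have hcomp : ∀ u, ∃ d : M.E × Bool, d.1 ∉ Z ∧ M.G.Joined Z u (M.G.dsrc d) ∧
      ∀ d', d'.1 ∉ Z → M.G.Joined Z u (M.G.dsrc d') → f d ≤ f d' := by
    intro u
    obtain ⟨d₀, h1, h2⟩ := M.admissible.exists_dart_notMem hfor u
    obtain ⟨d, hd, hmin⟩ := Finset.exists_min_image
      (Finset.univ.filter fun d : M.E × Bool => d.1 ∉ Z ∧ M.G.Joined Z u (M.G.dsrc d)) f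
      ⟨d₀, by simp [h1, h2]⟩
    simp only [Finset.mem_filter, Finset.mem_univ, true_and] at hd hmin
    exact ⟨d, hd.1, hd.2, fun d' h3 h4 => hmin d' ⟨h3, h4⟩⟩
  -- The dart is chosen once per component of `Z`, so that both ends of an edge of `Z` move to the
  -- same point.
  let S : Setoid M.V := ⟨M.G.Joined Z, joined_equivalence Z⟩
  choose δ₀ hδ₀ using fun y : Quotient S => hcomp y.out
  set δ : M.V → M.E × Bool := fun u => δ₀ (Quotient.mk S u) with hδ
  have hout : ∀ u, M.G.Joined Z u (Quotient.mk S u).out := fun u =>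
    (joined_equivalence Z).symm (Quotient.exact (Quotient.out_eq (Quotient.mk S u)))
  have hδ1 : ∀ u, (δ u).1 ∉ Z := fun u => (hδ₀ _).1
  have hδ2 : ∀ u, M.G.Joined Z u (M.G.dsrc (δ u)) := fun u =>
    (joined_equivalence Z).trans (hout u) (hδ₀ _).2.1
  have hδ3 : ∀ u d', d'.1 ∉ Z → M.G.Joined Z u (M.G.dsrc d') → f (δ u) ≤ f d' :=
    fun u d' h1 h2 => (hδ₀ _).2.2 d' h1
      ((joined_equivalence Z).trans ((joined_equivalence Z).symm (hout u)) h2)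
  have hδ4 : ∀ u v, M.G.Joined Z u v → δ u = δ v := fun u v h => by
    simp only [hδ]
    rw [show Quotient.mk S u = Quotient.mk S v from Quotient.sound h]
  -- The distance by which the component is moved along its chosen dart. By the smallness of `κ` it
  -- does not pass the midpoint.
  set s : M.E × Bool → ℝ := fun d => max 0 (-f d) with hs
  have hs0 : ∀ d, 0 ≤ s d := fun d => le_max_left _ _
  have hs1 : ∀ d : M.E × Bool, d.1 ∉ Z → s d ≤ ℓ' d.1 / 2 := by
    intro d hd
    obtain ⟨h1, h2⟩ := hsmall _ hd
    refine max_le (by linarith) ?_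
    have := (abs_le.1 (hf3 d)).1
    linarith
  have hP : ∀ d : M.E × Bool, ∃ p : Point M.E, d.1 ∉ Z →
      p.edge = d.1 ∧ legLength ℓ' p (!d.2) = s d := by
    intro d
    by_cases hd : d.1 ∈ Z
    · exact ⟨endPt d.1 true, fun h => absurd hd h⟩
    · have h1 := (hsmall _ hd).1
      obtain ⟨p, hp⟩ := exists_point ℓ' d (hs0 d) (by linarith [hs1 d hd]) h1
      exact ⟨p, fun _ => hp⟩
  choose P hP using hP
  choose z hz1 hz2 using hδ2
  set q : M.V → FreeGroup M.E := fun u =>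
    FreeGroup.mk (z u) * (legWord (P (δ u)) (!(δ u).2))⁻¹ with hq
  let mid : M.E → Point M.E := fun e => ⟨e, 1 / 2, by norm_num, by norm_num⟩
  -- The distance from the moved vertex to the midpoint of `d` is at most `ℓ' d.1 / 2 + f d`. If `d`
  -- is the chosen dart, moving shortens it by at least `-f d`. Otherwise it grows by `s (δ u) ≤ f
  -- d`, because `f (δ u)` is minimal and `0 ≤ f (δ u) + f d`. The two halves of an edge then sum to
  -- at most `ℓ' e + c e = exp r * ℓ e`.
  have hhalf : ∀ d : M.E × Bool, d.1 ∉ Z → M.G.Reach ℓ' (P (δ (M.G.dsrc d))) (mid d.1)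
      ((q (M.G.dsrc d))⁻¹ * (legWord (mid d.1) (!d.2))⁻¹) (ℓ' d.1 / 2 + f d) := by
    intro d hd
    set u := M.G.dsrc d with hu
    obtain ⟨hp1, hp2⟩ := hP (δ u) (hδ1 u)
    by_cases h : δ u = d
    · have h1 : FreeGroup.mk (z u) = 1 := by
        refine hfor.mk_eq_one (v := u) ?_ (hz2 u)
        have := hz1 u
        rwa [h] at this
      rw [h] at hp1 hp2
      have h2 : (q u)⁻¹ * (legWord (mid d.1) (!d.2))⁻¹ = 1 := by
        simp only [hq, h1, h]
        rw [legWord_congr (p := mid d.1) (q := P d) (by rw [hp1])]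
        group
      rw [h2, h]
      refine (reach_midpoint (b := !d.2) (by rw [hp1]) rfl
        (by rw [hp1]; exact (hsmall _ hd).1) (by rw [hp2, hp1]; exact hs1 d hd)).mono ?_
      rw [hp2, hp1]
      have := le_max_right 0 (-f d)
      simp only [hs]
      linarith
    · have h3 : M.G.IsPath (M.G.legEnd (P (δ u)) (!(δ u).2)) (M.G.legEnd (mid d.1) (!d.2))
          (FreeGroup.invRev (z u)) := by
        rw [legEnd_endPt_not (δ u) _ hp1, legEnd_endPt_not d _ rfl]
        exact (hz1 u).invRev
      have h4 := reach_legs (ℓ := ℓ') h3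
      have h5 : pathWeight ℓ' (FreeGroup.invRev (z u)) = 0 := by
        rw [pathWeight_invRev]
        exact pathWeight_eq_zero fun d hd => (hZ _ (hz2 u d hd)).2
      have h6 : legLength ℓ' (mid d.1) (!d.2) = ℓ' d.1 / 2 := by
        simp only [legLength, mid]
        split_ifs <;> ring
      rw [hp2, h5, h6, ← FreeGroup.inv_mk] at h4
      have h7 : (q u)⁻¹ = legWord (P (δ u)) (!(δ u).2) * (FreeGroup.mk (z u))⁻¹ := by
        simp only [hq]; group
      rw [h7]
      refine h4.mono ?_
      have h8 := hδ3 u d hd ⟨[], rfl, by simp⟩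
      have h9 := add_nonneg_of_joined f hf1 hf2Z (hδ1 u) hd h
        ((joined_equivalence Z).symm ⟨z u, hz1 u, hz2 u⟩)
      have h10 : s (δ u) ≤ f d := max_le (by linarith) (by linarith)
      linarith
  have hpath : ∀ e, M.G.Reach ℓ' (P (δ (M.G.src e))) (P (δ (M.G.tgt e)))
      ((q (M.G.src e))⁻¹ * FreeGroup.of e * q (M.G.tgt e)) (Real.exp r * ℓ e) := by
    intro e
    by_cases he : e ∈ Z
    · have h1 : M.G.Joined Z (M.G.src e) (M.G.tgt e) :=
        ⟨[(e, true)], ⟨rfl, rfl⟩, by simpa using he⟩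
      have h2 := hδ4 _ _ h1
      have h3 : FreeGroup.mk (z (M.G.src e)) = FreeGroup.mk ((e, true) :: z (M.G.tgt e)) := by
        refine hfor.mk_eq_mk (hz1 _) (hz2 _) ⟨rfl, ?_⟩ ?_
        · rw [h2]; exact hz1 _
        · intro d hd
          rcases List.mem_cons.1 hd with rfl | hd
          · exact he
          · exact hz2 _ d hd
      have h4 : (q (M.G.src e))⁻¹ * FreeGroup.of e * q (M.G.tgt e) = 1 := by
        simp only [hq, h2]
        rw [h3, mk_cons, mk_singleton_true]
        group
      rw [h4, h2, (hZ e he).1, mul_zero]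
      exact reach_refl _
    · have h1 := hhalf (e, true) he
      have h2 := hhalf (e, false) he
      have h3 := h1.trans hℓ'.nonneg h2.symm
      have h4 := hf2 (e, true)
      simp only [hc, Bool.not_true] at h4
      have h5 : (q (M.G.src e))⁻¹ * FreeGroup.of e * q (M.G.tgt e) =
          (q (M.G.src e))⁻¹ * 1⁻¹ * ((q (M.G.tgt e))⁻¹ * (FreeGroup.of e)⁻¹)⁻¹ := by group
      rw [h5]
      exact h3.mono (by linarith)
  choose L hL hL' using hpath
  refine ⟨⟨fun u => P (δ u), fun e => (q (M.G.src e))⁻¹ * FreeGroup.of e * q (M.G.tgt e), L, hL',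
    ?_⟩, hL⟩
  obtain ⟨v, hv1, hv2⟩ := exists_isPath_legWord (G := M.G) (P (δ M.base)) (!(δ M.base).2)
  rw [legEnd_endPt_not (δ M.base) _ (hP _ (hδ1 _)).1] at hv1
  refine ⟨z M.base ++ FreeGroup.invRev v, (hz1 _).append hv1.invRev, fun g => ?_⟩
  obtain ⟨w, hw, hw'⟩ := (M.mark g).2
  have h3 := lift_mk_conj (G := M.G) FreeGroup.of
    (fun e => (q (M.G.src e))⁻¹ * FreeGroup.of e * q (M.G.tgt e)) q (fun e => rfl) hw
  rw [FreeGroup.lift_of_apply, ← hw'] at h3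
  rw [h3, mk_append, ← FreeGroup.inv_mk, ← hv2]

end Displacement

end

end OuterSp

/-! ### The distance along a segment compared with the integral of the Lipschitz norm -/

namespace OuterSp

noncomputable section

namespace Gr

variable {V E : Type*} {G : Gr V E}

/-! ### The Lipschitz norm is a maximum over finitely many loops -/

theorem finite_nodup_loops [Finite E] (G : Gr V E) : {α | G.IsLoop α ∧ α.Nodup}.Finite := by
  classical
  have := Fintype.ofFinite E
  exact (Set.finite_coe_iff.1 (inferInstance : Finite {α : Cycle (E × Bool) // α.Nodup})).subset
    fun α h => h.2

/-- The loops that cross no edge twice in the same direction. -/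
def simpleLoops [Finite E] (G : Gr V E) : Finset (Cycle (E × Bool)) := G.finite_nodup_loops.toFinset

theorem mem_simpleLoops [Finite E] {α : Cycle (E × Bool)} :
    α ∈ G.simpleLoops ↔ G.IsLoop α ∧ α.Nodup := by simp [simpleLoops]

theorem weight_nonneg_of_simpleLoops [Finite E] (c : E → ℝ)
    (h : ∀ α ∈ G.simpleLoops, 0 ≤ weight c α) {α : Cycle (E × Bool)} (hα : G.IsLoop α) :
    0 ≤ weight c α := by
  refine cycle_sum_nonneg (R := G.Adj) (fun d => c d.1) (fun β h1 h2 => ?_) α hα.2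
  by_cases h3 : β = Cycle.nil
  · subst h3; simp
  · exact h β (mem_simpleLoops.2 ⟨⟨h3, h2⟩, h1⟩)

/-- Without simple loops the constant weight `-1` would vacuously be nonnegative on all loops. -/
theorem IsAdmissible.simpleLoops_nonempty [Finite E] (hG : G.IsAdmissible) :
    G.simpleLoops.Nonempty := by
  by_contra h
  rw [Finset.not_nonempty_iff_eq_empty] at h
  obtain ⟨α, hα⟩ := hG.exists_loop
  have h1 := weight_nonneg_of_simpleLoops (G := G) (fun _ => -1) (by simp [h]) hα
  obtain ⟨v, w, rfl, hw, -⟩ := hα.exists_path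
  rw [weight_coe] at h1
  cases w with
  | nil => exact hw rfl
  | cons d w =>
    rw [pathWeight_cons] at h1
    have h2 : ∀ w : List (E × Bool), pathWeight (fun _ : E => (-1 : ℝ)) w ≤ 0 := by
      intro w
      induction w with
      | nil => simp
      | cons d w ih =>
        rw [pathWeight_cons]
        linarith
    have h3 := h2 w
    linarith

theorem weight_sub_smul (ℓ τ : E → ℝ) (x : ℝ) (α : Cycle (E × Bool)) :
    weight (fun e => x * ℓ e - τ e) α = x * weight ℓ α - weight τ α := by
  have h1 : (fun e => x * ℓ e - τ e) = (x • ℓ) + (-1 : ℝ) • τ := by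
    ext e; simp [sub_eq_add_neg]
  have h2 : weight (x • ℓ) α = x * weight ℓ α := by
    have := weight_add_smul 0 ℓ x α
    rw [zero_add] at this
    rw [this]; simp [weight]
  rw [h1, weight_add_smul, h2]
  ring

/-- With `N` the maximum over simple loops, `N * ℓ - τ` is nonnegative on simple loops and hence on
all loops. -/
theorem isGreatest_normL [Finite E] (hne : G.simpleLoops.Nonempty) {ℓ : E → ℝ}
    (hpos : ∀ α, G.IsLoop α → 0 < weight ℓ α) (τ : E → ℝ) :
    IsGreatest {r | ∃ α, G.IsLoop α ∧ r = weight τ α / weight ℓ α}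
      (G.simpleLoops.sup' hne fun α => weight τ α / weight ℓ α) := by
  constructor
  · obtain ⟨α, h1, h2⟩ := Finset.exists_mem_eq_sup' hne fun α => weight τ α / weight ℓ α
    exact ⟨α, (mem_simpleLoops.1 h1).1, h2⟩
  · rintro r ⟨α, hα, rfl⟩
    set N := G.simpleLoops.sup' hne fun α => weight τ α / weight ℓ α with hN
    have h1 := weight_nonneg_of_simpleLoops (G := G) (fun e => N * ℓ e - τ e) (fun β hβ => by
      rw [weight_sub_smul, sub_nonneg, ← div_le_iff₀ (hpos β (mem_simpleLoops.1 hβ).1)]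
      exact Finset.le_sup' (fun α => weight τ α / weight ℓ α) hβ) hα
    rw [weight_sub_smul, sub_nonneg] at h1
    rwa [div_le_iff₀ (hpos α hα)]

theorem normL_eq_sup' [Finite E] (hne : G.simpleLoops.Nonempty) {ℓ : E → ℝ}
    (hpos : ∀ α, G.IsLoop α → 0 < weight ℓ α) (τ : E → ℝ) :
    G.normL ℓ τ = G.simpleLoops.sup' hne fun α => weight τ α / weight ℓ α :=
  (isGreatest_normL hne hpos τ).csSup_eq

theorem div_le_normL [Finite E] (hne : G.simpleLoops.Nonempty) {ℓ : E → ℝ}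
    (hpos : ∀ α, G.IsLoop α → 0 < weight ℓ α) (τ : E → ℝ) {α : Cycle (E × Bool)}
    (hα : G.IsLoop α) : weight τ α / weight ℓ α ≤ G.normL ℓ τ := by
  rw [normL_eq_sup' hne hpos]
  exact (isGreatest_normL hne hpos τ).2 ⟨α, hα, rfl⟩

section Segment

variable [Finite E] {ℓ τ : E → ℝ} {a b : ℝ}

omit [Finite E] in
theorem continuousOn_rate (hpos : ∀ t ∈ Icc a b, ∀ α, G.IsLoop α → 0 < weight (ℓ + t • τ) α)
    {α : Cycle (E × Bool)} (hα : G.IsLoop α) :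
    ContinuousOn (fun t : ℝ => weight τ α / weight (ℓ + t • τ) α) (Icc a b) := by
  refine continuousOn_const.div ?_ fun t ht => (hpos t ht α hα).ne'
  simp only [weight_add_smul]
  fun_prop

theorem continuousOn_normL (hG : G.IsAdmissible)
    (hpos : ∀ t ∈ Icc a b, ∀ α, G.IsLoop α → 0 < weight (ℓ + t • τ) α) :
    ContinuousOn (fun t : ℝ => G.normL (ℓ + t • τ) τ) (Icc a b) := by
  have h1 : ContinuousOn (fun t : ℝ => G.simpleLoops.sup' hG.simpleLoops_nonempty fun α =>
      weight τ α / weight (ℓ + t • τ) α) (Icc a b) :=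
    ContinuousOn.finset_sup'_apply _ fun α hα => continuousOn_rate hpos (mem_simpleLoops.1 hα).1
  exact h1.congr fun t ht => normL_eq_sup' _ (hpos t ht) τ

omit [Finite E] in
/-- The logarithmic stretch of a loop along a segment. -/
theorem log_div_eq_integral (hpos : ∀ t ∈ Icc a b, ∀ α, G.IsLoop α → 0 < weight (ℓ + t • τ) α)
    {α : Cycle (E × Bool)} (hα : G.IsLoop α) {s t : ℝ} (hs : s ∈ Icc a b) (ht : t ∈ Icc a b) :
    Real.log (weight (ℓ + t • τ) α / weight (ℓ + s • τ) α) =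
      ∫ x in s..t, weight τ α / weight (ℓ + x • τ) α := by
  have hsub : uIcc s t ⊆ Icc a b := Set.ordConnected_Icc.uIcc_subset hs ht
  rw [intervalIntegral.integral_eq_sub_of_hasDerivAt
    (f := fun x => Real.log (weight (ℓ + x • τ) α)), Real.log_div (hpos t ht α hα).ne'
    (hpos s hs α hα).ne']
  · intro x hx
    have h1 : HasDerivAt (fun x : ℝ => weight (ℓ + x • τ) α) (weight τ α) x := by
      simp only [weight_add_smul]
      simpa using ((hasDerivAt_id x).mul_const (weight τ α)).const_add (weight ℓ α)
    exact h1.log (hpos x (hsub hx) α hα).ne'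
  · exact ((continuousOn_rate hpos hα).mono hsub).intervalIntegrable

end Segment

end Gr

/-! ### Segments in a simplex -/

section Segment

open Gr Filter Topology

variable {n : ℕ} (M : MarkedGraph n) {ℓ τ : M.E → ℝ} {a b : ℝ}

theorem weight_pos_segment (h : ∀ t ∈ Icc a b, M.G.IsMetric (ℓ + t • τ)) :
    ∀ t ∈ Icc a b, ∀ α, M.G.IsLoop α → 0 < weight (ℓ + t • τ) α :=
  fun t ht _ hα => (h t ht).weight_pos hα

theorem normL_integrable (h : ∀ t ∈ Icc a b, M.G.IsMetric (ℓ + t • τ)) {s t : ℝ}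
    (hs : s ∈ Icc a b) (ht : t ∈ Icc a b) :
    IntervalIntegrable (fun t : ℝ => M.G.normL (ℓ + t • τ) τ) MeasureTheory.volume s t :=
  ((continuousOn_normL M.admissible (weight_pos_segment M h)).mono
    (Set.ordConnected_Icc.uIcc_subset hs ht)).intervalIntegrable

theorem weight_le_exp_integral (h : ∀ t ∈ Icc a b, M.G.IsMetric (ℓ + t • τ)) {s t : ℝ}
    (hs : s ∈ Icc a b) (ht : t ∈ Icc a b) (hst : s ≤ t) {α : Cycle (M.E × Bool)}
    (hα : M.G.IsLoop α) : weight (ℓ + t • τ) α ≤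
      Real.exp (∫ x in s..t, M.G.normL (ℓ + x • τ) τ) * weight (ℓ + s • τ) α := by
  have hpos := weight_pos_segment M h
  rw [← div_le_iff₀ (hpos s hs α hα), ← Real.log_le_iff_le_exp
    (div_pos (hpos t ht α hα) (hpos s hs α hα)), log_div_eq_integral hpos hα hs ht]
  have hsub : uIcc s t ⊆ Icc a b := Set.ordConnected_Icc.uIcc_subset hs ht
  refine intervalIntegral.integral_mono_on hst
    ((continuousOn_rate hpos hα).mono hsub).intervalIntegrable (normL_integrable M h hs ht) ?_
  intro x hx
  rw [← uIcc_of_le hst] at hx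
  exact div_le_normL M.admissible.simpleLoops_nonempty (hpos x (hsub hx)) τ hα

/-- Short steps in the interior of a segment. -/
theorem exists_lipMap_short (h : ∀ t ∈ Icc a b, M.G.IsMetric (ℓ + t • τ)) {a' b' : ℝ}
    (ha : a < a') (hab : a' ≤ b') (hb : b' < b) : ∃ h₀ > 0, ∀ s t (hs : s ∈ Icc a b)
      (ht : t ∈ Icc a b), a' ≤ s → s ≤ t → t ≤ b' → t - s ≤ h₀ →
      LipMap ⟨M, ℓ + s • τ, h s hs⟩ ⟨M, ℓ + t • τ, h t ht⟩
        (∫ x in s..t, M.G.normL (ℓ + x • τ) τ) := by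
  have hnn : ∀ t ∈ Icc a b, ∀ e, 0 ≤ (ℓ + t • τ) e := fun t ht => (h t ht).nonneg
  have ha' : a' ∈ Ioo a b := ⟨ha, hab.trans_lt hb⟩
  have hb' : b' ∈ Ioo a b := ⟨ha.trans_le hab, hb⟩
  set Z : Set M.E := {e | ℓ e = 0 ∧ τ e = 0} with hZ
  have hZpos : ∀ e ∉ Z, ∀ t ∈ Ioo a b, 0 < (ℓ + t • τ) e := by
    intro e he t ht
    refine lt_of_le_of_ne (hnn t (Ioo_subset_Icc_self ht) e) fun h0 => he ?_
    have h1 := eq_zero_of_mem_Ioo hnn ht h0.symm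
    refine ⟨?_, h1⟩
    simpa [h1] using h0.symm
  obtain ⟨μ, hμ0, hμ⟩ : ∃ μ > 0, ∀ e ∉ Z, μ ≤ (ℓ + a' • τ) e ∧ μ ≤ (ℓ + b' • τ) e := by
    have : ∀ᶠ μ in 𝓝[>] (0 : ℝ), ∀ e, e ∉ Z → μ ≤ (ℓ + a' • τ) e ∧ μ ≤ (ℓ + b' • τ) e := by
      rw [eventually_all]
      intro e
      by_cases he : e ∈ Z
      · exact Eventually.of_forall fun μ h => absurd he h
      · have h1 := hZpos e he a' ha'
        have h2 := hZpos e he b' hb'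
        filter_upwards [Ioo_mem_nhdsGT h1, Ioo_mem_nhdsGT h2] with μ h3 h4 _
        exact ⟨h3.2.le, h4.2.le⟩
    obtain ⟨μ, h1, h2⟩ := (this.and self_mem_nhdsWithin).exists
    exact ⟨μ, h2, h1⟩
  -- Edge lengths are affine in `t`, so a lower bound at `a'` and `b'` holds in between.
  have hμ' : ∀ e ∉ Z, ∀ t, a' ≤ t → t ≤ b' → μ ≤ (ℓ + t • τ) e := by
    intro e he t h1 h2
    obtain ⟨h3, h4⟩ := hμ e he
    simp only [Pi.add_apply, Pi.smul_apply, smul_eq_mul] at h3 h4 ⊢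
    rcases le_total 0 (τ e) with h5 | h5
    · have := mul_le_mul_of_nonneg_right h1 h5
      linarith
    · have := mul_le_mul_of_nonpos_right h2 h5
      linarith
  obtain ⟨B, hB⟩ := isCompact_Icc.exists_bound_of_continuousOn
    (continuousOn_normL M.admissible (weight_pos_segment M h))
  have hB0 : 0 ≤ B := (norm_nonneg _).trans (hB a' (Ioo_subset_Icc_self ha'))
  set T : ℝ := ∑ e, |τ e| with hT
  have hTe : ∀ e, |τ e| ≤ T := fun e =>
    Finset.single_le_sum (f := fun e => |τ e|) (fun e _ => abs_nonneg _) (Finset.mem_univ e)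
  have hT0 : 0 ≤ T := Finset.sum_nonneg fun e _ => abs_nonneg _
  set C : ℝ := ((Fintype.card (M.E × Bool) : ℕ) : ℝ) with hC
  -- The first condition gives `|r| < 1`, hence `|exp r - 1| ≤ 2 * |r|`. Then `(2 * B + T) * h₀`
  -- bounds the change `|exp r * ℓ - ℓ'|` of edge lengths, and the second condition is the smallness
  -- required by `lipMap_of_close`.
  obtain ⟨h₀, hh₀, hh1, hh2⟩ : ∃ h₀ > 0, B * h₀ < 1 ∧ C * ((2 * B + T) * h₀) < μ / 2 := by
    have h1 : Tendsto (fun x : ℝ => B * x) (𝓝[>] 0) (𝓝 (B * 0)) :=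
      ((by fun_prop : Continuous fun x : ℝ => B * x).tendsto 0).mono_left nhdsWithin_le_nhds
    have h2 : Tendsto (fun x : ℝ => C * ((2 * B + T) * x)) (𝓝[>] 0) (𝓝 (C * ((2 * B + T) * 0))) :=
      ((by fun_prop : Continuous fun x : ℝ => C * ((2 * B + T) * x)).tendsto 0).mono_left
        nhdsWithin_le_nhds
    obtain ⟨x, h3, h4, h5⟩ := ((h1.eventually_lt_const (u := 1) (by simp)).and
      ((h2.eventually_lt_const (u := μ / 2) (by simpa using hμ0)).and self_mem_nhdsWithin)).exists
    exact ⟨x, h5, h3, h4⟩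
  refine ⟨h₀, hh₀, fun s t hs ht has hst htb hle => ?_⟩
  set r := ∫ x in s..t, M.G.normL (ℓ + x • τ) τ with hr
  have hr1 : |r| ≤ B * (t - s) := by
    have := intervalIntegral.norm_integral_le_of_norm_le_const (a := s) (b := t)
      (f := fun x => M.G.normL (ℓ + x • τ) τ) (C := B) (fun x hx => hB x (by
        rw [uIoc_of_le hst] at hx
        exact ⟨hs.1.trans hx.1.le, hx.2.trans ht.2⟩))
    rwa [abs_of_nonneg (sub_nonneg.2 hst)] at this
  have hr2 : B * (t - s) ≤ B * h₀ := mul_le_mul_of_nonneg_left hle hB0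
  have hexp : |Real.exp r - 1| ≤ 2 * (B * (t - s)) := by
    have := Real.abs_exp_sub_one_le (x := r) (by linarith)
    linarith
  refine lipMap_of_close M Z (h s hs) (h t ht) ?_ (κ := (2 * B + T) * h₀)
    (fun α hα => weight_le_exp_integral M h hs ht hst hα) ?_ ?_
  · rintro e ⟨h1, h2⟩
    simp [h1, h2]
  · intro e
    have h1 := (h s hs).mem_Icc e
    have h2 : Real.exp r * (ℓ + s • τ) e - (ℓ + t • τ) e =
        (Real.exp r - 1) * (ℓ + s • τ) e - (t - s) * τ e := by
      simp only [Pi.add_apply, Pi.smul_apply, smul_eq_mul]; ring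
    rw [h2]
    have h3 : |(Real.exp r - 1) * (ℓ + s • τ) e| ≤ 2 * (B * (t - s)) := by
      rw [abs_mul, abs_of_nonneg h1.1]
      exact (mul_le_of_le_one_right (abs_nonneg _) h1.2).trans hexp
    have h4 : |(t - s) * τ e| ≤ (t - s) * T := by
      rw [abs_mul, abs_of_nonneg (sub_nonneg.2 hst)]
      exact mul_le_mul_of_nonneg_left (hTe e) (sub_nonneg.2 hst)
    have h5 := abs_sub ((Real.exp r - 1) * (ℓ + s • τ) e) ((t - s) * τ e)
    have h6 : (t - s) * T ≤ h₀ * T := mul_le_mul_of_nonneg_right hle hT0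
    linarith
  · intro e he
    have h1 := hμ' e he t (has.trans hst) htb
    exact ⟨hμ0.trans_le h1, by linarith⟩

theorem lipMap_interior (h : ∀ t ∈ Icc a b, M.G.IsMetric (ℓ + t • τ)) {s t : ℝ}
    (hs : s ∈ Icc a b) (ht : t ∈ Icc a b) (has : a < s) (hst : s ≤ t) (htb : t < b) :
    LipMap ⟨M, ℓ + s • τ, h s hs⟩ ⟨M, ℓ + t • τ, h t ht⟩
      (∫ x in s..t, M.G.normL (ℓ + x • τ) τ) := by
  obtain ⟨h₀, hh₀, key⟩ := exists_lipMap_short M h has hst htb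
  have hstep : ∀ (k : ℕ) (u : ℝ) (hu : u ∈ Icc a b), s ≤ u → u ≤ t → u - s ≤ k * h₀ →
      LipMap ⟨M, ℓ + s • τ, h s hs⟩ ⟨M, ℓ + u • τ, h u hu⟩
        (∫ x in s..u, M.G.normL (ℓ + x • τ) τ) := by
    intro k
    induction k with
    | zero =>
      intro u hu h1 h2 h3
      exact key s u hs hu le_rfl h1 h2 (by simp at h3; linarith)
    | succ k ih =>
      intro u hu h1 h2 h3
      push_cast at h3
      have hv1 : s ≤ max s (u - h₀) := le_max_left _ _
      have hv2 : max s (u - h₀) ≤ u := max_le h1 (by linarith)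
      have hv : max s (u - h₀) ∈ Icc a b := ⟨hs.1.trans hv1, hv2.trans hu.2⟩
      have h4 := ih _ hv hv1 (hv2.trans h2) (by
        have : (0 : ℝ) ≤ k * h₀ := by positivity
        rw [sub_le_iff_le_add]
        exact max_le (by linarith) (by linarith))
      have h5 := key _ u hv hu hv1 hv2 h2 (by linarith [le_max_right s (u - h₀)])
      have h6 := h4.trans h5
      rwa [intervalIntegral.integral_add_adjacent_intervals (normL_integrable M h hs hv)
        (normL_integrable M h hv hu)] at h6
  obtain ⟨k, hk⟩ := exists_nat_ge ((t - s) / h₀)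
  exact hstep k t ht hst le_rfl ((div_le_iff₀ hh₀).1 hk)

/-- The edges of length zero are collapsed. -/
theorem lipMap_retract {ℓ ℓ' : M.E → ℝ} (hℓ : M.G.IsMetric ℓ) (hℓ' : M.G.IsMetric ℓ') {r : ℝ}
    (m : M.V → M.V) (k : M.V → List (M.E × Bool))
    (hk : ∀ v, M.G.IsPath v (m v) (k v)) (hk' : ∀ v, ∀ d ∈ k v, ℓ d.1 = 0)
    (hm : ∀ e, ℓ e = 0 → m (M.G.src e) = m (M.G.tgt e))
    (hr : ∀ e, ℓ e ≠ 0 → pathWeight ℓ' (k (M.G.src e)) + ℓ' e + pathWeight ℓ' (k (M.G.tgt e)) ≤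
      Real.exp r * ℓ e) : LipMap ⟨M, ℓ, hℓ⟩ ⟨M, ℓ', hℓ'⟩ r := by
  classical
  refine LipMap.of_vertexMap m (fun e => if ℓ e = 0 then [] else
    FreeGroup.invRev (k (M.G.src e)) ++ (e, true) :: k (M.G.tgt e)) (fun e => ?_) (fun e => ?_)
    ⟨k M.base, hk _, fun g => ?_⟩
  · by_cases he : ℓ e = 0
    · simp only [he, if_true]; exact hm e he
    · simp only [he, if_false]
      exact (hk _).invRev.append ⟨rfl, hk _⟩
  · by_cases he : ℓ e = 0
    · simp [he]
    · simp only [he, if_false, pathWeight_append, pathWeight_invRev, pathWeight_cons]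
      have := hr e he
      linarith
  · obtain ⟨w, hw, hw'⟩ := (M.mark g).2
    have h3 := lift_mk_conj (G := M.G) FreeGroup.of
      (fun e => FreeGroup.mk (if ℓ e = 0 then [] else
        FreeGroup.invRev (k (M.G.src e)) ++ (e, true) :: k (M.G.tgt e)))
      (fun v => FreeGroup.mk (k v)) (fun e => ?_) hw
    · rw [FreeGroup.lift_of_apply, ← hw'] at h3
      exact h3
    · by_cases he : ℓ e = 0
      · simp only [he, if_true]
        have h4 := hℓ.isForest.mk_eq_mk (hk (M.G.src e)) (hk' _)
          (show M.G.IsPath _ _ ((e, true) :: k (M.G.tgt e)) from ⟨rfl, hm e he ▸ hk _⟩) (by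
            intro d hd
            rcases List.mem_cons.1 hd with rfl | hd
            · exact he
            · exact hk' _ d hd)
        rw [h4, mk_cons, mk_singleton_true, mk_nil]
        group
      · simp only [he, if_false]
        rw [mk_append, mk_cons, mk_singleton_true, ← FreeGroup.inv_mk, mul_assoc]

/-- Edges of length zero at time `a` may be longer afterwards, yet must go to paths of length zero.
So each component of the zero set is retracted to one vertex, and the detours this adds to the other
edges are short for `t` near `a`. -/
theorem eventually_lipMap_left (h : ∀ t ∈ Icc a b, M.G.IsMetric (ℓ + t • τ)) (hab : a < b) {ε : ℝ}
    (hε : 0 < ε) : ∀ᶠ t in 𝓝[>] a, ∀ ht : t ∈ Icc a b,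
      LipMap ⟨M, ℓ + a • τ, h a (left_mem_Icc.2 hab.le)⟩ ⟨M, ℓ + t • τ, h t ht⟩ ε := by
  have ha := h a (left_mem_Icc.2 hab.le)
  let S : Setoid M.V := ⟨_, joined_equivalence (G := M.G) {e | (ℓ + a • τ) e = 0}⟩
  set m : M.V → M.V := fun v => (Quotient.mk S v).out with hm
  have hmv : ∀ v, M.G.Joined {e | (ℓ + a • τ) e = 0} v (m v) := fun v =>
    S.symm (Quotient.exact (Quotient.out_eq (Quotient.mk S v)))
  choose k hk hk' using hmv
  have hev : ∀ᶠ t in 𝓝[>] a, ∀ e, (ℓ + a • τ) e ≠ 0 →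
      pathWeight (ℓ + t • τ) (k (M.G.src e)) + (ℓ + t • τ) e +
        pathWeight (ℓ + t • τ) (k (M.G.tgt e)) ≤ Real.exp ε * (ℓ + a • τ) e := by
    rw [eventually_all]
    intro e
    by_cases he : (ℓ + a • τ) e = 0
    · exact Eventually.of_forall fun t h => absurd he h
    have hpos : 0 < (ℓ + a • τ) e := lt_of_le_of_ne (ha.nonneg e) (Ne.symm he)
    have h1 : ∀ w : List (M.E × Bool), ∀ t : ℝ,
        pathWeight (ℓ + t • τ) w = pathWeight ℓ w + t * pathWeight τ w := fun w t => by
      rw [← weight_coe, weight_add_smul, weight_coe, weight_coe]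
    have h2 : Continuous fun t : ℝ => pathWeight (ℓ + t • τ) (k (M.G.src e)) + (ℓ + t • τ) e +
        pathWeight (ℓ + t • τ) (k (M.G.tgt e)) := by
      simp only [h1, Pi.add_apply, Pi.smul_apply, smul_eq_mul]
      fun_prop
    have h3 := (h2.tendsto a).mono_left (nhdsWithin_le_nhds (s := Ioi a))
    rw [pathWeight_eq_zero (hk' _), pathWeight_eq_zero (hk' _), zero_add, add_zero] at h3
    have h4 : (ℓ + a • τ) e < Real.exp ε * (ℓ + a • τ) e := by
      have := Real.one_lt_exp_iff.2 hε
      nlinarith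
    filter_upwards [h3.eventually_lt_const h4] with t ht _ using ht.le
  filter_upwards [hev] with t ht ht'
  refine lipMap_retract M ha (h t ht') m k hk hk' (fun e he => ?_) ht
  simp only [hm]
  rw [show Quotient.mk S (M.G.src e) = Quotient.mk S (M.G.tgt e) from
    Quotient.sound ⟨[(e, true)], ⟨rfl, rfl⟩, by simpa using he⟩]

/-- At the other end the identity works: edges that shrink to length zero impose no condition, and
the ratios of the others tend to `1`. -/
theorem eventually_lipMap_right (h : ∀ t ∈ Icc a b, M.G.IsMetric (ℓ + t • τ)) (hab : a < b)
    {ε : ℝ} (hε : 0 < ε) : ∀ᶠ t in 𝓝[<] b, ∀ ht : t ∈ Icc a b,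
      LipMap ⟨M, ℓ + t • τ, h t ht⟩ ⟨M, ℓ + b • τ, h b (right_mem_Icc.2 hab.le)⟩ ε := by
  have hb := h b (right_mem_Icc.2 hab.le)
  have hev : ∀ᶠ t in 𝓝[<] b, ∀ e, (ℓ + b • τ) e ≠ 0 →
      (ℓ + b • τ) e ≤ Real.exp ε * (ℓ + t • τ) e := by
    rw [eventually_all]
    intro e
    by_cases he : (ℓ + b • τ) e = 0
    · exact Eventually.of_forall fun t h => absurd he h
    have hpos : 0 < (ℓ + b • τ) e := lt_of_le_of_ne (hb.nonneg e) (Ne.symm he)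
    have h2 : Continuous fun t : ℝ => Real.exp ε * (ℓ + t • τ) e := by
      simp only [Pi.add_apply, Pi.smul_apply, smul_eq_mul]
      fun_prop
    have h4 : (ℓ + b • τ) e < Real.exp ε * (ℓ + b • τ) e := by
      have := Real.one_lt_exp_iff.2 hε
      nlinarith
    filter_upwards [((h2.tendsto b).mono_left
      (nhdsWithin_le_nhds (s := Iio b))).eventually_const_lt h4] with t ht _ using ht.le
  filter_upwards [hev] with t ht ht'
  refine LipMap.of_vertexMap id (fun e => [(e, true)]) (fun e => ⟨rfl, rfl⟩) (fun e => ?_)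
    ⟨[], rfl, fun g => ?_⟩
  · rw [pathWeight_cons, pathWeight_nil, add_zero]
    by_cases he : (ℓ + b • τ) e = 0
    · exact he.le.trans (mul_nonneg (Real.exp_pos _).le ((h t ht').nonneg e))
    · exact ht e he
  · rw [mk_nil, inv_one, one_mul, mul_one]
    exact DFunLike.congr_fun (FreeGroup.lift_of_eq_id M.E) (M.mark g : FreeGroup M.E)

theorem continuousOn_integral_normL (h : ∀ t ∈ Icc a b, M.G.IsMetric (ℓ + t • τ)) (hab : a ≤ b) :
    ContinuousOn (fun t => ∫ x in a..t, M.G.normL (ℓ + x • τ) τ) (Icc a b) := by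
  have h1 := normL_integrable M h (left_mem_Icc.2 hab) (right_mem_Icc.2 hab)
  have h2 := intervalIntegral.continuousOn_primitive_interval' h1 (left_mem_uIcc)
  rwa [uIcc_of_le hab] at h2

theorem integral_normL_sub (h : ∀ t ∈ Icc a b, M.G.IsMetric (ℓ + t • τ)) {s t : ℝ}
    (hs : s ∈ Icc a b) (ht : t ∈ Icc a b) :
    (∫ x in a..t, M.G.normL (ℓ + x • τ) τ) - (∫ x in a..s, M.G.normL (ℓ + x • τ) τ) =
      ∫ x in s..t, M.G.normL (ℓ + x • τ) τ := by
  have ha : a ∈ Icc a b := left_mem_Icc.2 (hs.1.trans hs.2)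
  exact intervalIntegral.integral_interval_sub_left (normL_integrable M h ha ht)
    (normL_integrable M h ha hs)

/-- The interior estimate is applied on a slightly smaller interval. Two end maps and two errors
from the continuity of the integral cost `ε / 4` each. -/
theorem lipMap_segment (h : ∀ t ∈ Icc a b, M.G.IsMetric (ℓ + t • τ)) {s t : ℝ}
    (hs : s ∈ Icc a b) (ht : t ∈ Icc a b) (hst : s ≤ t) {ε : ℝ} (hε : 0 < ε) :
    LipMap ⟨M, ℓ + s • τ, h s hs⟩ ⟨M, ℓ + t • τ, h t ht⟩
      ((∫ x in s..t, M.G.normL (ℓ + x • τ) τ) + ε) := by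
  rcases hst.eq_or_lt with rfl | hlt
  · exact (lipMap_refl _).mono (by simpa using hε.le)
  have hst' : ∀ u ∈ Icc s t, M.G.IsMetric (ℓ + u • τ) := fun u hu =>
    h u ⟨hs.1.trans hu.1, hu.2.trans ht.2⟩
  set F : ℝ → ℝ := fun u => ∫ x in s..u, M.G.normL (ℓ + x • τ) τ with hF
  have hc := continuousOn_integral_normL M hst' hst
  have hs' : s ∈ Icc s t := left_mem_Icc.2 hst
  have ht' : t ∈ Icc s t := right_mem_Icc.2 hst
  have hl : Tendsto F (𝓝[>] s) (𝓝 (F s)) :=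
    (hc s hs').mono_left (nhdsWithin_le_of_mem (Icc_mem_nhdsGT hlt))
  have hr : Tendsto F (𝓝[<] t) (𝓝 (F t)) :=
    (hc t ht').mono_left (nhdsWithin_le_of_mem (Icc_mem_nhdsLT hlt))
  have hε4 : 0 < ε / 4 := by linarith
  have hm1 : s < (s + t) / 2 := by linarith
  have hm2 : (s + t) / 2 < t := by linarith
  obtain ⟨u, ⟨hu1, hu2⟩, hu3⟩ := ((eventually_lipMap_left M hst' hlt hε4).and
    (hl.eventually_const_lt (u := F s - ε / 4) (by linarith))).and
    (Ioo_mem_nhdsGT hm1) |>.exists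
  obtain ⟨v, ⟨hv1, hv2⟩, hv3⟩ := ((eventually_lipMap_right M hst' hlt hε4).and
    (hr.eventually_lt_const (u := F t + ε / 4) (by linarith))).and
    (Ioo_mem_nhdsLT hm2) |>.exists
  have hu : u ∈ Icc s t := ⟨hu3.1.le, (hu3.2.trans hm2).le⟩
  have hv : v ∈ Icc s t := ⟨(hm1.trans hv3.1).le, hv3.2.le⟩
  have h1 := ((hu1 hu).trans (lipMap_interior M hst' hu hv hu3.1 (hu3.2.trans hv3.1).le
    hv3.2)).trans (hv1 hv)
  refine h1.mono ?_
  rw [← integral_normL_sub M hst' hu hv, ← integral_normL_sub M hst' hs' ht']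
  change ε / 4 + (F v - F u) + ε / 4 ≤ F t - F s + ε
  linarith

/-- On short steps, the distance is almost the integral of the norm. -/
theorem exists_integral_le_lipDist (h : ∀ t ∈ Icc a b, M.G.IsMetric (ℓ + t • τ)) {ε : ℝ}
    (hε : 0 < ε) : ∃ δ > 0, ∀ s t (hs : s ∈ Icc a b) (ht : t ∈ Icc a b), s ≤ t → t - s ≤ δ →
      (∫ x in s..t, M.G.normL (ℓ + x • τ) τ) - ε * (t - s) ≤
        lipDist (MarkedMetricGraph.pt ⟨M, ℓ + s • τ, h s hs⟩)
          (MarkedMetricGraph.pt ⟨M, ℓ + t • τ, h t ht⟩) := by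
  have hpos := weight_pos_segment M h
  have hne := M.admissible.simpleLoops_nonempty
  have hε2 : 0 < ε / 2 := by linarith
  have hu1 := isCompact_Icc.uniformContinuousOn_of_continuous
    (continuousOn_normL M.admissible hpos)
  rw [Metric.uniformContinuousOn_iff] at hu1
  obtain ⟨δ₁, hδ₁, hu1⟩ := hu1 (ε / 2) hε2
  have hu2 : ∃ δ > 0, ∀ α ∈ M.G.simpleLoops, ∀ x ∈ Icc a b, ∀ y ∈ Icc a b, dist x y < δ →
      dist (weight τ α / weight (ℓ + x • τ) α) (weight τ α / weight (ℓ + y • τ) α) < ε / 2 := by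
    have : ∀ᶠ δ in 𝓝[>] (0 : ℝ), ∀ α ∈ M.G.simpleLoops, ∀ x ∈ Icc a b, ∀ y ∈ Icc a b,
        dist x y < δ → dist (weight τ α / weight (ℓ + x • τ) α)
          (weight τ α / weight (ℓ + y • τ) α) < ε / 2 := by
      rw [Finset.eventually_all]
      intro α hα
      have h1 := isCompact_Icc.uniformContinuousOn_of_continuous
        (continuousOn_rate hpos (mem_simpleLoops.1 hα).1)
      rw [Metric.uniformContinuousOn_iff] at h1
      obtain ⟨δ, hδ, h1⟩ := h1 (ε / 2) hε2
      filter_upwards [Ioo_mem_nhdsGT hδ] with δ' hδ' x hx y hy hxy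
      exact h1 x hx y hy (hxy.trans hδ'.2)
    obtain ⟨δ, h1, h2⟩ := (this.and self_mem_nhdsWithin).exists
    exact ⟨δ, h2, h1⟩
  obtain ⟨δ₂, hδ₂, hu2⟩ := hu2
  have hδ : 0 < min δ₁ δ₂ := lt_min hδ₁ hδ₂
  refine ⟨min δ₁ δ₂ / 2, half_pos hδ, fun s t hs ht hst hle => ?_⟩
  -- A loop attaining the norm at time `s`. By uniform continuity of the norm and of the rates of
  -- the finitely many simple loops, its rate stays within `ε` of the norm on the step.
  obtain ⟨α, hα, hα'⟩ := Finset.exists_mem_eq_sup' hne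
    fun α => weight τ α / weight (ℓ + s • τ) α
  rw [← normL_eq_sup' hne (hpos s hs)] at hα'
  have hloop := (mem_simpleLoops.1 hα).1
  refine le_trans ?_ (log_div_le_lipDist M (h s hs) (h t ht)
    (lipMap_segment M h hs ht hst one_pos) hloop)
  rw [log_div_eq_integral hpos hloop hs ht]
  have hsub : uIcc s t ⊆ Icc a b := Set.ordConnected_Icc.uIcc_subset hs ht
  have hint : IntervalIntegrable (fun x => weight τ α / weight (ℓ + x • τ) α)
      MeasureTheory.volume s t := ((continuousOn_rate hpos hloop).mono hsub).intervalIntegrable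
  have h1 : ∫ x in s..t, M.G.normL (ℓ + x • τ) τ ≤
      ∫ x in s..t, (weight τ α / weight (ℓ + x • τ) α + ε) := by
    refine intervalIntegral.integral_mono_on hst (normL_integrable M h hs ht)
      (hint.add intervalIntegrable_const) fun x hx => ?_
    have hx' : x ∈ Icc a b := hsub (by rwa [uIcc_of_le hst])
    have hd : dist x s < min δ₁ δ₂ := by
      rw [Real.dist_eq, abs_of_nonneg (sub_nonneg.2 hx.1)]
      linarith [hx.2]
    have h2 := hu1 x hx' s hs (hd.trans_le (min_le_left _ _))
    have h3 := hu2 α hα x hx' s hs (hd.trans_le (min_le_right _ _))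
    rw [Real.dist_eq] at h2 h3
    rw [hα'] at h2
    linarith [(abs_lt.1 h2).2, (abs_lt.1 h3).1]
  rw [intervalIntegral.integral_add hint intervalIntegrable_const,
    intervalIntegral.integral_const, smul_eq_mul] at h1
  linarith

end Segment

end

end OuterSp

/-! ### Integration along segments and assembly over subdivisions -/

namespace OuterSp

noncomputable section

/-! ### The corrected norm along a segment -/

section Segment

open Gr

variable {n : ℕ} (M : MarkedGraph n) {ℓ τ : M.E → ℝ} {a b : ℝ}

theorem continuousOn_psi (h : ∀ t ∈ Icc a b, M.G.IsMetric (ℓ + t • τ)) :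
    ContinuousOn (fun t : ℝ => M.G.psi n (ℓ + t • τ)) (Icc a b) := by
  unfold psi coverSum
  refine ContinuousOn.mul continuousOn_const (continuousOn_finsetSum _ fun c _ =>
    continuousOn_finsetSum _ fun a _ => ?_)
  exact continuousOn_log_classLength (ℓ := lift ℓ) (τ := lift τ) a
    (fun t ht e => (h t ht).nonneg e.1)
    fun t ht => weight_lift_pos fun _ hα => (h t ht).weight_pos hα

theorem hasDerivWithinAt_psi_segment (h : ∀ t ∈ Icc a b, M.G.IsMetric (ℓ + t • τ)) {t : ℝ}
    (ht : t ∈ Ioo a b) : HasDerivWithinAt (fun t : ℝ => M.G.psi n (ℓ + t • τ))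
      (M.G.normN n (ℓ + t • τ) τ - M.G.normL (ℓ + t • τ) τ) (Ioi t) t := by
  have hm := h t (Ioo_subset_Icc_self ht)
  have h1 := hasDerivWithinAt_psi n (τ := τ) hm.nonneg
    (fun e he => (eq_zero_of_mem_Ioo (fun t ht => (h t ht).nonneg) ht he).ge)
    (fun _ hα => hm.weight_pos hα)
  have h2 : HasDerivWithinAt (fun x : ℝ => x - t) 1 (Ioi t) t :=
    ((hasDerivAt_id t).sub_const t).hasDerivWithinAt
  have h3 : MapsTo (fun x : ℝ => x - t) (Ioi t) (Ici 0) := fun x hx => by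
    have : t < x := hx
    exact sub_nonneg.2 this.le
  have h4 := HasDerivWithinAt.scomp_of_eq t h1 h2 h3 (by simp)
  rw [one_smul] at h4
  have h5 : (fun t : ℝ => M.G.psi n (ℓ + t • τ)) =
      (fun x : ℝ => M.G.psi n (ℓ + t • τ + x • τ)) ∘ fun x => x - t := by
    ext x
    simp only [Function.comp_apply, add_assoc, ← add_smul, add_sub_cancel]
  rw [h5]
  exact h4

theorem intervalIntegrable_normN (h : ∀ t ∈ Icc a b, M.G.IsMetric (ℓ + t • τ)) (hab : a ≤ b) :
    IntervalIntegrable (fun t : ℝ => M.G.normN n (ℓ + t • τ) τ) MeasureTheory.volume a b := by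
  unfold normN normWith coverSum
  refine (normL_integrable M h (left_mem_Icc.2 hab) (right_mem_Icc.2 hab)).add
    (IntervalIntegrable.const_mul (IntervalIntegrable.neg ?_) _)
  have hsum : ∀ {ι : Type _} (S : Finset ι) (f : ι → ℝ → ℝ),
      (∀ i, IntervalIntegrable (f i) MeasureTheory.volume a b) →
      IntervalIntegrable (fun t => ∑ i ∈ S, f i t) MeasureTheory.volume a b := fun S f hf => by
    rw [← Finset.sum_fn]
    exact IntervalIntegrable.sum S fun i _ => hf i
  refine hsum _ _ fun c => hsum _ _ fun a' => ?_
  exact intervalIntegrable_slope (ℓ := lift ℓ) (τ := lift τ) hab a'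
    (fun t ht e => (h t ht).nonneg e.1)
    fun t ht => weight_lift_pos fun _ hα => (h t ht).weight_pos hα

theorem normNMax_ae_eq_normN (h : ∀ t ∈ Icc a b, M.G.IsMetric (ℓ + t • τ)) (hab : a ≤ b) :
    ∀ᵐ t ∂MeasureTheory.volume.restrict (uIoc a b),
      M.G.normNMax n (ℓ + t • τ) τ = M.G.normN n (ℓ + t • τ) τ := by
  have key : ∀ (c : M.G.Coh) (a' : M.E × ZMod 2 → ZMod 2), ∃ S : Set ℝ, S.Countable ∧
      ∀ t ∈ Ioo a b \ S,
        sSup ((M.G.coverOf c).realizedValues (lift (ℓ + t • τ)) (lift τ) a') =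
        sInf ((M.G.coverOf c).realizedValues (lift (ℓ + t • τ)) (lift τ) a') :=
    fun c a' => sSup_realizedValues_eq_sInf (ℓ := lift ℓ) (τ := lift τ) a'
      (fun t ht e => (h t ht).nonneg e.1)
  choose S hS hS' using key
  have : Finite M.G.Coh := Quotient.finite _
  have hc : (⋃ c, ⋃ a', S c a').Countable := countable_iUnion fun c => countable_iUnion fun a' =>
    hS c a'
  rw [uIoc_of_le hab, MeasureTheory.Measure.restrict_congr_set
    (MeasureTheory.Ioo_ae_eq_Ioc (μ := MeasureTheory.volume) (a := a) (b := b)).symm]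
  filter_upwards [MeasureTheory.ae_restrict_mem measurableSet_Ioo,
    MeasureTheory.ae_restrict_of_ae (hc.ae_notMem MeasureTheory.volume)] with t ht ht'
  unfold normNMax normN normWith coverSum
  simp only [mem_iUnion, not_exists] at ht'
  simp only [hS' _ _ t ⟨ht, ht' _ _⟩]

/-- The potential may have corners along a segment, so the fundamental theorem of calculus is used
in the form for continuous functions with an integrable right derivative in the open interval. -/
theorem integral_normN (h : ∀ t ∈ Icc a b, M.G.IsMetric (ℓ + t • τ)) (hab : a ≤ b) :
    ∫ t in a..b, M.G.normN n (ℓ + t • τ) τ = (∫ t in a..b, M.G.normL (ℓ + t • τ) τ) +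
      (M.G.psi n (ℓ + b • τ) - M.G.psi n (ℓ + a • τ)) := by
  have h1 := intervalIntegrable_normN M h hab
  have h2 := normL_integrable M h (left_mem_Icc.2 hab) (right_mem_Icc.2 hab)
  have h3 := intervalIntegral.integral_eq_sub_of_hasDeriv_right_of_le hab (continuousOn_psi M h)
    (fun t ht => hasDerivWithinAt_psi_segment M h ht) (h1.sub h2)
  rw [intervalIntegral.integral_sub h1 h2] at h3
  linarith

end Segment

/-! ### Subdivisions -/

section Subdivision

variable {m : ℕ} {s : Fin (m + 1) → ℝ}

theorem sum_sub_eq (A : Fin (m + 1) → ℝ) :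
    ∑ j : Fin m, (A j.succ - A j.castSucc) = A (Fin.last m) - A 0 := by
  induction m with
  | zero => simp
  | succ m ih =>
    rw [Fin.sum_univ_castSucc]
    have := ih fun j => A j.castSucc
    simp only [Fin.castSucc_zero] at this
    simp only [Fin.succ_castSucc, this, Fin.succ_last]
    ring

theorem exists_mem_Ico {x : ℝ} (h0 : s 0 ≤ x) (h1 : x < s (Fin.last m)) :
    ∃ j : Fin m, s j.castSucc ≤ x ∧ x < s j.succ := by
  by_contra! h
  have : ∀ j, s j ≤ x := by
    intro j
    induction j using Fin.induction with
    | zero => exact h0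
    | succ j ih => exact h j ih
  exact absurd h1 (this _).not_gt

/-- Used for arbitrary polygonal sums, whose subdivisions need not refine that of the path: a step
is cut at the breakpoints it contains. -/
theorem rel_of_pieces {Q : ℝ → ℝ → Prop} (hrefl : ∀ x, Q x x)
    (htrans : ∀ x y z, Q x y → Q y z → Q x z)
    (hp : ∀ j : Fin m, ∀ x y, s j.castSucc ≤ x → x ≤ y → y ≤ s j.succ → Q x y) {x y : ℝ}
    (hx : s 0 ≤ x) (hxy : x ≤ y) (hy : y ≤ s (Fin.last m)) : Q x y := by
  have : ∀ j, ∀ x y, s 0 ≤ x → x ≤ y → y ≤ s j → Q x y := by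
    intro j
    induction j using Fin.induction with
    | zero =>
      intro x y hx hxy hy
      rw [le_antisymm hxy (hy.trans hx)]
      exact hrefl y
    | succ j ih =>
      intro x y hx hxy hy
      rcases le_total y (s j.castSucc) with h1 | h1
      · exact ih x y hx hxy h1
      rcases le_total (s j.castSucc) x with h2 | h2
      · exact hp j x y h2 hxy hy
      · exact htrans _ _ _ (ih x _ hx h2 le_rfl) (hp j _ y le_rfl h1 hy)
  exact this _ x y hx hxy hy

/-- Primitives on the pieces of a subdivision glue. -/
theorem exists_glue (hs : StrictMono s) (F : Fin m → ℝ → ℝ) : ∃ A : ℝ → ℝ, ∀ j,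
    ∀ x ∈ Icc (s j.castSucc) (s j.succ), ∀ y ∈ Icc (s j.castSucc) (s j.succ),
      A y - A x = F j y - F j x := by
  -- Each summand sees `t` clamped to its own piece, so on the `j`-th piece all other summands are
  -- constant.
  refine ⟨fun t => ∑ j, F j (max (s j.castSucc) (min t (s j.succ))), fun j x hx y hy => ?_⟩
  rw [← Finset.sum_sub_distrib, Finset.sum_eq_single j]
  · rw [min_eq_left hx.2, max_eq_right hx.1, min_eq_left hy.2, max_eq_right hy.1]
  · intro k _ hk
    rcases lt_or_gt_of_ne hk with hk | hk
    · have h1 : s k.succ ≤ s j.castSucc := hs.monotone (by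
        rw [Fin.le_def]; simpa using hk)
      rw [min_eq_right (h1.trans hx.1), min_eq_right (h1.trans hy.1), sub_self]
    · have h1 : s j.succ ≤ s k.castSucc := hs.monotone (by
        rw [Fin.le_def]; simpa using hk)
      rw [max_eq_left ((min_le_left _ _).trans (hx.2.trans h1)),
        max_eq_left ((min_le_left _ _).trans (hy.2.trans h1)), sub_self]
  · simp

/-- A fine subdivision of `[0,1]` that refines a given one. -/
theorem exists_refinement (h0 : s 0 = 0) (h1 : s (Fin.last m) = 1) (hs : StrictMono s) {δ : ℝ}
    (hδ : 0 < δ) : ∃ (p : ℕ) (t : Fin (p + 1) → ℝ), StrictMono t ∧ t 0 = 0 ∧ t (Fin.last p) = 1 ∧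
      ∀ i : Fin p, t i.succ - t i.castSucc ≤ δ ∧
        ∃ j : Fin m, s j.castSucc ≤ t i.castSucc ∧ t i.succ ≤ s j.succ := by
  classical
  obtain ⟨N, hN⟩ := exists_nat_gt (1 / δ)
  have hN0 : (0 : ℝ) < N := (one_div_pos.2 hδ).trans hN
  have hNδ : 1 / (N : ℝ) ≤ δ := by
    rw [div_le_iff₀ hN0]
    rw [div_lt_iff₀ hδ] at hN
    linarith
  set T : Finset ℝ := Finset.univ.image s ∪ (Finset.range (N + 1)).image fun k : ℕ => (k : ℝ) / N
    with hT
  have hsT : ∀ j, s j ∈ T := fun j => Finset.mem_union_left _ (Finset.mem_image_of_mem _ (by simp))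
  have hkT : ∀ k : ℕ, k ≤ N → (k : ℝ) / N ∈ T := fun k hk =>
    Finset.mem_union_right _ (Finset.mem_image_of_mem (fun k : ℕ => (k : ℝ) / N)
      (Finset.mem_range.2 (by omega)))
  have hT01 : ∀ x ∈ T, x ∈ Icc (0 : ℝ) 1 := by
    intro x hx
    rcases Finset.mem_union.1 hx with hx | hx
    · obtain ⟨j, -, rfl⟩ := Finset.mem_image.1 hx
      exact ⟨h0 ▸ hs.monotone (Fin.zero_le j), h1 ▸ hs.monotone (Fin.le_last j)⟩
    · obtain ⟨k, hk, rfl⟩ := Finset.mem_image.1 hx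
      have : (k : ℝ) ≤ N := by exact_mod_cast Nat.lt_succ_iff.1 (Finset.mem_range.1 hk)
      exact ⟨by positivity, (div_le_one hN0).2 this⟩
  obtain ⟨p, hp⟩ : ∃ p, T.card = p + 1 :=
    Nat.exists_eq_succ_of_ne_zero (Finset.card_ne_zero_of_mem (hsT 0))
  set t := T.orderEmbOfFin hp
  have htT : ∀ i, t i ∈ T := fun i => Finset.orderEmbOfFin_mem T hp i
  have hTt : ∀ x ∈ T, ∃ i, t i = x := fun x hx => by
    have := Finset.range_orderEmbOfFin T hp
    have h2 : x ∈ (T : Set ℝ) := hx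
    rwa [← this] at h2
  have ht0 : t 0 = 0 := by
    obtain ⟨i, hi⟩ := hTt 0 (h0 ▸ hsT 0)
    exact le_antisymm (hi ▸ t.monotone (Fin.zero_le i)) (hT01 _ (htT 0)).1
  have ht1 : t (Fin.last p) = 1 := by
    obtain ⟨i, hi⟩ := hTt 1 (h1 ▸ hsT (Fin.last m))
    exact le_antisymm (hT01 _ (htT _)).2 (hi ▸ t.monotone (Fin.le_last i))
  have hgap : ∀ i : Fin p, ∀ x ∈ T, t i.castSucc < x → t i.succ ≤ x := by
    intro i x hx h
    obtain ⟨k, rfl⟩ := hTt x hx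
    rw [t.lt_iff_lt] at h
    exact t.monotone (Fin.castSucc_lt_iff_succ_le.1 h)
  refine ⟨p, t, t.strictMono, ht0, ht1, fun i => ⟨?_, ?_⟩⟩
  · have h2 : t i.castSucc < 1 := ht1 ▸ t.strictMono (Fin.castSucc_lt_last i)
    have h3 := (hT01 _ (htT i.castSucc)).1
    have h4 : ⌊t i.castSucc * N⌋₊ < N := by
      rw [Nat.floor_lt (by positivity)]
      nlinarith
    -- The next multiple of `1 / N` is a subdivision point, so the gap is at most `1 / N`.
    have h5 := hgap i _ (hkT (⌊t i.castSucc * N⌋₊ + 1) h4) (by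
      rw [lt_div_iff₀ hN0]
      exact_mod_cast Nat.lt_floor_add_one _)
    have h6 := Nat.floor_le (mul_nonneg h3 hN0.le)
    have h7 : ((⌊t i.castSucc * N⌋₊ + 1 : ℕ) : ℝ) / N ≤ t i.castSucc + 1 / N := by
      rw [div_le_iff₀ hN0]
      push_cast
      rw [add_mul, one_div_mul_cancel hN0.ne']
      linarith
    linarith
  · have h2 : t i.castSucc < 1 := ht1 ▸ t.strictMono (Fin.castSucc_lt_last i)
    obtain ⟨j, h3, h4⟩ := exists_mem_Ico (s := s) (x := t i.castSucc)
      (h0 ▸ (hT01 _ (htT _)).1) (h1 ▸ h2)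
    exact ⟨j, h3, hgap i _ (hsT _) h4⟩

end Subdivision

/-! ### Lengths of piecewise linear paths -/

namespace PLPath

open Gr

variable {n : ℕ} (γ : PLPath n)

/-- The value at time `0` of the linear continuation of the `j`-th piece. -/
def origin (j : Fin γ.m) : (γ.graph j).E → ℝ := γ.start j - γ.s j.castSucc • γ.vel j

theorem start_add (j : Fin γ.m) (t : ℝ) :
    γ.start j + (t - γ.s j.castSucc) • γ.vel j = γ.origin j + t • γ.vel j := by
  rw [origin, sub_smul]; abel

theorem isMetric' (j : Fin γ.m) : ∀ t ∈ Icc (γ.s j.castSucc) (γ.s j.succ),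
    (γ.graph j).G.IsMetric (γ.origin j + t • γ.vel j) := by
  intro t ht
  rw [← start_add]
  exact γ.isMetric j t ht

theorem toFun_eq' (j : Fin γ.m) (t : ℝ) (ht : t ∈ Icc (γ.s j.castSucc) (γ.s j.succ)) :
    γ.toFun t = MarkedMetricGraph.pt ⟨γ.graph j, γ.origin j + t • γ.vel j, γ.isMetric' j t ht⟩ := by
  rw [γ.toFun_eq j t ht]
  simp only [start_add]

theorem s_le (j : Fin γ.m) : γ.s j.castSucc ≤ γ.s j.succ :=
  γ.strictMono.monotone (Fin.castSucc_lt_succ (i := j)).le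

/-- The integral of the Lipschitz norm over the `j`-th piece up to `t`. -/
def pieceL (j : Fin γ.m) (t : ℝ) : ℝ :=
  ∫ x in (γ.s j.castSucc)..t, (γ.graph j).G.normL (γ.origin j + x • γ.vel j) (γ.vel j)

/-- The Lipschitz length of a piecewise linear path is the integral of the Lipschitz norm. -/
theorem isLUB_polygonalSums : IsLUB (polygonalSums γ.toFun) (∑ j, γ.pieceL j (γ.s j.succ)) := by
  obtain ⟨A, hA⟩ := exists_glue γ.strictMono γ.pieceL
  have htotal : ∑ j, γ.pieceL j (γ.s j.succ) = A 1 - A 0 := by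
    have h1 := sum_sub_eq fun j => A (γ.s j)
    rw [γ.s_last, γ.s_zero] at h1
    rw [← h1]
    refine Finset.sum_congr rfl fun j _ => ?_
    rw [hA j _ (left_mem_Icc.2 (γ.s_le j)) _ (right_mem_Icc.2 (γ.s_le j))]
    simp [pieceL]
  have hpiece : ∀ j, ∀ x ∈ Icc (γ.s j.castSucc) (γ.s j.succ),
      ∀ y ∈ Icc (γ.s j.castSucc) (γ.s j.succ), A y - A x =
        ∫ u in x..y, (γ.graph j).G.normL (γ.origin j + u • γ.vel j) (γ.vel j) := by
    intro j x hx y hy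
    rw [hA j x hx y hy]
    exact integral_normL_sub _ (γ.isMetric' j) hx hy
  rw [htotal]
  constructor
  -- Upper bound: maps of the pieces are composed across breakpoints, where the representative
  -- changes at no cost.
  · have hQ : ∀ {x y : ℝ}, 0 ≤ x → x ≤ y → y ≤ 1 → ∀ X Y : MarkedMetricGraph n,
        X.pt = γ.toFun x → Y.pt = γ.toFun y → ∀ ε > 0, LipMap X Y (A y - A x + ε) := by
      intro x y hx hxy hy
      refine rel_of_pieces (s := γ.s) (Q := fun x y => ∀ X Y : MarkedMetricGraph n,
        X.pt = γ.toFun x → Y.pt = γ.toFun y → ∀ ε > 0, LipMap X Y (A y - A x + ε))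
        ?_ ?_ ?_ (γ.s_zero ▸ hx) hxy (γ.s_last ▸ hy)
      · intro x X Y hX hY ε hε
        exact (lipMap_of_pt_eq (hX.trans hY.symm)).mono (by linarith)
      · intro x y z h1 h2 X Y hX hY ε hε
        obtain ⟨Z, hZ⟩ := Quot.exists_rep (γ.toFun y)
        exact ((h1 X Z hX hZ (ε / 2) (half_pos hε)).trans
          (h2 Z Y hZ hY (ε / 2) (half_pos hε))).mono (by linarith)
      · intro j x y hx hxy hy X Y hX hY ε hε
        have hx' : x ∈ Icc (γ.s j.castSucc) (γ.s j.succ) := ⟨hx, hxy.trans hy⟩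
        have hy' : y ∈ Icc (γ.s j.castSucc) (γ.s j.succ) := ⟨hx.trans hxy, hy⟩
        rw [γ.toFun_eq' j x hx'] at hX
        rw [γ.toFun_eq' j y hy'] at hY
        have h1 := lipMap_segment _ (γ.isMetric' j) hx' hy' hxy hε
        rw [← hpiece j x hx' y hy'] at h1
        exact (((lipMap_of_pt_eq hX).trans h1).trans (lipMap_of_pt_eq hY.symm)).mono (by linarith)
    rintro _ ⟨p, t, ht, h0, h1, rfl⟩
    have h2 := sum_sub_eq fun i => A (t i)
    rw [h0, h1] at h2
    rw [← h2]
    refine Finset.sum_le_sum fun i _ => ?_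
    have h3 : 0 ≤ t i.castSucc := h0 ▸ ht.monotone (Fin.zero_le _)
    have h4 : t i.succ ≤ 1 := h1 ▸ ht.monotone (Fin.le_last _)
    have h5 : t i.castSucc ≤ t i.succ := ht.monotone (Fin.castSucc_lt_succ (i := i)).le
    obtain ⟨X, hX⟩ := Quot.exists_rep (γ.toFun (t i.castSucc))
    obtain ⟨Y, hY⟩ := Quot.exists_rep (γ.toFun (t i.succ))
    refine le_of_forall_pos_le_add fun ε hε => ?_
    have h6 := (hQ h3 h5 h4 X Y hX hY ε hε).lipDist_le
    rw [← hX, ← hY]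
    exact h6
  · intro B hB
    refine le_of_forall_pos_le_add fun ε hε => ?_
    have hδ : ∀ j : Fin γ.m, ∃ δ > 0, ∀ x (hx : x ∈ Icc (γ.s j.castSucc) (γ.s j.succ))
        y (hy : y ∈ Icc (γ.s j.castSucc) (γ.s j.succ)), x ≤ y → y - x ≤ δ →
        A y - A x - ε * (y - x) ≤ lipDist (γ.toFun x) (γ.toFun y) := by
      intro j
      obtain ⟨δ, hδ, h⟩ := exists_integral_le_lipDist _ (γ.isMetric' j) hε
      refine ⟨δ, hδ, fun x hx y hy hxy hle => ?_⟩
      rw [hpiece j x hx y hy, γ.toFun_eq' j x hx, γ.toFun_eq' j y hy]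
      exact h x y hx hy hxy hle
    choose δ hδ0 hδ using hδ
    obtain ⟨δ', hδ'0, hδ'⟩ : ∃ δ' > 0, ∀ j, δ' ≤ δ j := by
      have : ∀ᶠ x in nhdsWithin (0 : ℝ) (Ioi 0), ∀ j, x ≤ δ j := by
        rw [Filter.eventually_all]
        intro j
        filter_upwards [Ioo_mem_nhdsGT (hδ0 j)] with x hx using hx.2.le
      obtain ⟨x, h1, h2⟩ := (this.and self_mem_nhdsWithin).exists
      exact ⟨x, h2, h1⟩
    obtain ⟨p, t, ht, h0, h1, hgap⟩ := exists_refinement γ.s_zero γ.s_last γ.strictMono hδ'0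
    have h2 := hB ⟨p, t, ht, h0, h1, rfl⟩
    -- Lower bound: the errors `ε * (t i.succ - t i.castSucc)` telescope to `ε` over `[0,1]`.
    have h3 := sum_sub_eq fun i => A (t i) - ε * t i
    simp only [h0, h1] at h3
    have h4 : ∑ i : Fin p, (A (t i.succ) - ε * t i.succ - (A (t i.castSucc) - ε * t i.castSucc)) ≤
        ∑ i : Fin p, lipDist (γ.toFun (t i.castSucc)) (γ.toFun (t i.succ)) := by
      refine Finset.sum_le_sum fun i _ => ?_
      obtain ⟨h5, j, h6, h7⟩ := hgap i
      have h8 : t i.castSucc ≤ t i.succ := ht.monotone (Fin.castSucc_lt_succ (i := i)).le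
      have h9 := hδ j _ ⟨h6, h8.trans h7⟩ _ ⟨h6.trans h8, h7⟩ h8 (h5.trans (hδ' j))
      linarith
    linarith

theorem speedN_eq (j : Fin γ.m) : γ.speedN j =
    fun t => (γ.graph j).G.normN n (γ.origin j + t • γ.vel j) (γ.vel j) := by
  ext t
  rw [speedN, start_add]

theorem speedNMax_eq (j : Fin γ.m) : γ.speedNMax j =
    fun t => (γ.graph j).G.normNMax n (γ.origin j + t • γ.vel j) (γ.vel j) := by
  ext t
  rw [speedNMax, start_add]

theorem intervalIntegrable_speedN (j : Fin γ.m) :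
    IntervalIntegrable (γ.speedN j) MeasureTheory.volume (γ.s j.castSucc) (γ.s j.succ) := by
  rw [speedN_eq]
  exact intervalIntegrable_normN _ (γ.isMetric' j) (γ.s_le j)

theorem speedNMax_ae_eq (j : Fin γ.m) : γ.speedNMax j
    =ᵐ[MeasureTheory.volume.restrict (uIoc (γ.s j.castSucc) (γ.s j.succ))] γ.speedN j := by
  rw [speedN_eq, speedNMax_eq]
  exact normNMax_ae_eq_normN _ (γ.isMetric' j) (γ.s_le j)

theorem intervalIntegrable_speedNMax (j : Fin γ.m) :
    IntervalIntegrable (γ.speedNMax j) MeasureTheory.volume (γ.s j.castSucc) (γ.s j.succ) :=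
  (γ.intervalIntegrable_speedN j).congr_ae (γ.speedNMax_ae_eq j).symm

theorem lenNMax_eq : γ.lenNMax = γ.lenN :=
  Finset.sum_congr rfl fun j _ =>
    intervalIntegral.integral_congr_ae_restrict (γ.speedNMax_ae_eq j)

/-- The increments of the potential on the pieces telescope because at a breakpoint both marked
graphs represent the same point, on which `Psi` has a single value. -/
theorem lenN_eq : γ.lenN = lenL γ.toFun + Psi (γ.toFun 1) - Psi (γ.toFun 0) := by
  have hne : (polygonalSums γ.toFun).Nonempty := by
    obtain ⟨p, t, h1, h2, h3, -⟩ := exists_refinement γ.s_zero γ.s_last γ.strictMono one_pos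
    exact ⟨_, p, t, h1, h2, h3, rfl⟩
  rw [lenL, γ.isLUB_polygonalSums.csSup_eq hne, lenN]
  have h1 := sum_sub_eq fun j => Psi (γ.toFun (γ.s j))
  simp only [γ.s_last, γ.s_zero] at h1
  rw [add_sub_assoc, ← h1, ← Finset.sum_add_distrib]
  refine Finset.sum_congr rfl fun j _ => ?_
  rw [speedN_eq, integral_normN _ (γ.isMetric' j) (γ.s_le j),
    γ.toFun_eq' j _ (left_mem_Icc.2 (γ.s_le j)), γ.toFun_eq' j _ (right_mem_Icc.2 (γ.s_le j)),
    Psi_pt, Psi_pt]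
  rfl

end PLPath

end

end OuterSp

theorem mainTheorem5 (n : ℕ) :
    -- the pointwise formula
    (∀ (V E : Type*) [Fintype V] [Fintype E] (G : OuterSp.Gr V E), G.IsAdmissible →
      Fintype.card E + 1 = Fintype.card V + n →
      ∀ ℓ τ : E → ℝ, G.IsMetric ℓ → OuterSp.Gr.IsIntegrable ℓ τ →
        ∃ D : ℝ, HasDerivWithinAt (fun t : ℝ => G.psi n (ℓ + t • τ)) D (Set.Ici 0) 0 ∧
          G.normN n ℓ τ = G.normL ℓ τ + D) ∧
    -- the potential is well defined on Outer space
    (∀ X : OuterSp.MarkedMetricGraph n, OuterSp.Psi X.pt = X.G.psi n X.ℓ) ∧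
    -- the formula for paths
    (∀ γ : OuterSp.PLPath n,
      BddAbove (OuterSp.polygonalSums γ.toFun) ∧
      (∀ j, IntervalIntegrable (γ.speedN j) MeasureTheory.volume
        (γ.s j.castSucc) (γ.s j.succ)) ∧
      (∀ j, IntervalIntegrable (γ.speedNMax j) MeasureTheory.volume
        (γ.s j.castSucc) (γ.s j.succ)) ∧
      γ.lenN = OuterSp.lenL γ.toFun + OuterSp.Psi (γ.toFun 1) - OuterSp.Psi (γ.toFun 0) ∧
      γ.lenNMax = γ.lenN) := by
  refine ⟨fun V E _ _ G hG _ ℓ τ hℓ hτ => ⟨G.normN n ℓ τ - G.normL ℓ τ, ?_, by ring⟩,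
    OuterSp.Psi_pt, fun γ => ⟨⟨_, γ.isLUB_polygonalSums.1⟩, γ.intervalIntegrable_speedN,
      γ.intervalIntegrable_speedNMax, γ.lenN_eq, γ.lenNMax_eq⟩⟩
  -- Integrability enters only as `0 ≤ τ e` on edges of length zero.
  exact OuterSp.Gr.hasDerivWithinAt_psi n hℓ.nonneg
    (fun e he => not_lt.1 fun h => (hτ.pos_of_neg e h).ne' he) fun _ hα => hℓ.weight_pos hα
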